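/- **Setting.** Let $f$ be a real random field on a periodic box with sides $L_1,\dots,L_d>0$ and volume $V=L_1\cdots L_d$. Assume that $f$ has moments of all orders and zero mean, and that its finite-dimensional distributions are translation invariant. For a wavevector $k$ (with $k_i\in\frac{2\pi}{L_i}\mathbb Z$) put $$f_k=V^{-1/2}\int f(x)e^{-ik\cdot x}\,dx,\qquad P(k)=\langle|f_k|^2\rangle .$$ The polyspectra are defined by $$\langle f_{k_1}\cdots f_{k_{N-1}}f_{-k_1-\cdots-k_{N-1}}\rangle_{\rm c}=V^{1-N/2}P^{(N)}(k_1,\dots,k_{N-1}),$$ and the normalized polyspectra by $$p^{(N)}(k_1,\dots,k_N)=\delta_{k_1+\cdots+k_N,0}\;\frac{P^{(N)}(k_1,\dots,k_{N-1})}{\sqrt{P(k_1)\cdots P(k_N)}} .$$ Assume the symmetry $P^{(N)}(-k_1,\dots,-k_{N-1})=P^{(N)}(k_1,\dots,k_{N-1})$. Let uhs be an upper half of the wavevectors: an additively closed set that does not contain $0$ and contains $k$ or $-k$ for every $k\neq0$. Let $S\subset$ uhs be a finite set of modes with $P(k)\neq0$ for $k\in S$, and write $$\alpha_k=f_k/\sqrt{P(k)}=a_k+ib_k=A_ke^{i\theta_k}\qquad(k\in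 S).$$ **The distribution as a formal series.** The joint density $\mathcal P$ of $(a_k,b_k)_{k\in S}$ is understood as a formal power series in $V^{-1/2}$. It is the termwise inverse Fourier transform $$\mathcal P=\int\prod_{k\in S}\frac{dK_k\,dL_k}{(2\pi)^2}\,e^{iX}\exp\Big(\sum_{N\ge2}\frac{(-i)^N}{N!}\langle X^N\rangle_{\rm c}\Big),\qquad X=\sum_{k\in S}(K_ka_k+L_kb_k),$$ where $V^{N/2-1}\langle X^N\rangle_{\rm c}$ is treated as independent of $V$, so that $\langle X^N\rangle_{\rm c}$ is of order $V^{1-N/2}$. In the variables $(A_k,\theta_k)$ the density carries the Jacobian $\prod_{k\in S} A_k$. The symbol $O(V^{-3/2})$ is meant for formal power series in $V^{-1/2}$. Let $P_N$ be the distribution of $N$ distinct modes $k_1,\dots,k_N\in S$, with all other modes of $S$ integrated out. The reduced distributions $R_N$ (for $A_k>0$) are defined by - $P_2=P_1P_1[1+R_2]$, - $P_3=P_1P_1P_1[1+R_2(k_1,k_2)+R_2(k_2,k_3)+R_2(k_1,k_3)+R_3]$, - $P_4=P_1P_1P_1P_1[1+\sum R_2+\sum R_2R_2+\sum R_3+R_4]$,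 where the sums run over the 6 pairs, the 3 splittings into two pairs, and the 4 triples. Let $P_N(\theta_{k_1},\dots,\theta_{k_N})$ be obtained from $P_N$ by integrating out the moduli. The $C_N$ are defined by - $(2\pi)^2P_2=1+C_2$, - $(2\pi)^3P_3=1+\sum C_2+C_3$, - $(2\pi)^4P_4=1+\sum C_2+\sum C_2C_2+\sum C_3+C_4$, with the same sums. Write $A_i=A_{k_i}$ and $\theta_i=\theta_{k_i}$. **(I) Two-point distribution.** $$\begin{aligned}R_2(k_1,k_2)=\;&\tfrac1{\sqrt V}A_1^2A_2\cos(2\theta_1-\theta_2)\,p^{(3)}(k_1,k_1,-k_2)+(1\leftrightarrow2)\\ &+\tfrac1{2V}\big[A_1^4A_2^2\cos^2(2\theta_1-\theta_2)-2A_1^2A_2^2-\tfrac12A_1^4+2A_1^2+A_2^2-1\big]\,p^{(3)}(k_1,k_1,-k_2)^2+(1\leftrightarrow2)\\ &+\tfrac1{3V}A_1^3A_2\cos(3\theta_1-\theta_2)\,p^{(4)}(k_1,k_1,k_1,-k_2)+(1\leftrightarrow2)\\ &+\tfrac1V\big(A_1^2A_2^2-A_1^2-A_2^2+1\big)\,p^{(4)}(k_1,k_2,-k_1,-k_2)+O(V^{-3/2}).\end{aligned}$$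 Before symmetrization the first and second terms are nonzero only if $2k_1=k_2$, and the third only if $3k_1=k_2$. **(II) Three-point distribution.** $R_3$ is the sum over all $3!$ permutations of $(k_1,k_2,k_3)$ of $$\begin{aligned}R_3^{(a)}=\;&\tfrac1{\sqrt V}A_1A_2A_3\cos(\theta_1+\theta_2-\theta_3)\,p^{(3)}(k_1,k_2,-k_3)\\ &+\tfrac1VA_1^2A_2A_3\cos(2\theta_1+\theta_2-\theta_3)\,p^{(4)}(k_1,k_1,k_2,-k_3)\\ &+\tfrac1{2V}A_1^2A_2A_3\cos(2\theta_1-\theta_2-\theta_3)\,p^{(4)}(k_1,k_1,-k_2,-k_3)\\ &+\tfrac1V\big[A_1^2A_2^2A_3^2\cos^2(\theta_1+\theta_2-\theta_3)-\tfrac12(A_1^2A_2^2+A_1^2A_3^2+A_2^2A_3^2-A_1^2-A_2^2-A_3^2+1)\big]\,p^{(3)}(k_1,k_2,-k_3)^2\\ &+\tfrac1V\big[A_1^2A_2^3A_3\cos(2\theta_1-\theta_2)\cos(2\theta_2-\theta_3)-A_1^2A_2A_3\cos(2\theta_1+\theta_2-\theta_3)\big]\,p^{(3)}(k_1,k_1,-k_2)\,p^{(3)}(k_2,k_2,-k_3)\\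 &+\tfrac1V\big[2A_1^3A_2^2A_3\cos(2\theta_1-\theta_2)\cos(\theta_1+\theta_2-\theta_3)-A_1^3A_3\cos(3\theta_1-\theta_3)\\ &\qquad-2A_1A_2^2A_3\cos(\theta_1-2\theta_2+\theta_3)\big]\,p^{(3)}(k_1,k_1,-k_2)\,p^{(3)}(k_1,k_2,-k_3)+O(V^{-3/2}).\end{aligned}$$ The six terms are nonzero only if, respectively, 1. $k_1+k_2=k_3$; 2. $2k_1+k_2=k_3$; 3. $2k_1=k_2+k_3$; 4. $k_1+k_2=k_3$; 5. $2k_1=k_2$ and $4k_1=k_3$; 6. $2k_1=k_2$ and $3k_1=k_3$. **(III) Four-point distribution.** $R_4$ is the sum over all $4!$ permutations of $(k_1,\dots,k_4)$ of $$\begin{aligned}R_4^{(a)}=\;&\tfrac1{3V}A_1A_2A_3A_4\cos(\theta_1+\theta_2+\theta_3-\theta_4)\,p^{(4)}(k_1,k_2,k_3,-k_4)\\ &+\tfrac1{4V}A_1A_2A_3A_4\cos(\theta_1+\theta_2-\theta_3-\theta_4)\,p^{(4)}(k_1,k_2,-k_3,-k_4)\\ &+\tfrac1V\big[2A_1^3A_2A_3A_4\cos(2\theta_1-\theta_3)\cos(\theta_1-\theta_2+\theta_4)\\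 &\qquad-2A_1A_2A_3A_4\cos(\theta_1+\theta_2-\theta_3-\theta_4)\big]\,p^{(3)}(k_1,k_1,-k_3)\,p^{(3)}(k_1,-k_2,k_4)\\ &+\tfrac1V\big[A_1^3A_2A_3A_4\cos(2\theta_1-\theta_4)\cos(\theta_1-\theta_2-\theta_3)\\ &\qquad-A_1A_2A_3A_4\cos(\theta_1+\theta_2+\theta_3-\theta_4)\big]\,p^{(3)}(k_1,k_1,-k_4)\,p^{(3)}(-k_1,k_2,k_3)\\ &+\tfrac1V\big[2A_1^2A_2A_3A_4^2\cos(2\theta_1-\theta_4)\cos(\theta_2-\theta_3+\theta_4)\\ &\qquad-A_1^2A_2A_3\cos(2\theta_1+\theta_2-\theta_3)\big]\,p^{(3)}(k_1,k_1,-k_4)\,p^{(3)}(k_2,-k_3,k_4)\\ &+\tfrac1V\big[A_1^2A_2A_3A_4^2\cos(2\theta_1-\theta_4)\cos(\theta_2+\theta_3-\theta_4)\\ &\qquad-\tfrac12A_1^2A_2A_3\cos(2\theta_1-\theta_2-\theta_3)\big]\,p^{(3)}(k_1,k_1,-k_4)\,p^{(3)}(k_2,k_3,-k_4)\\ &+\tfrac1V\big[4A_1^2A_2A_3A_4^2\cos(\theta_1+\theta_2-\theta_4)\cos(\theta_1-\theta_3+\theta_4)-2A_1^2A_2A_3\cos(2\theta_1+\theta_2-\theta_3)\\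 &\qquad-2A_2A_3A_4^2\cos(\theta_2+\theta_3-2\theta_4)\big]\,p^{(3)}(k_1,k_2,-k_4)\,p^{(3)}(k_1,-k_3,k_4)+O(V^{-3/2}).\end{aligned}$$ The seven terms are nonzero only if, respectively, 1. $k_1+k_2+k_3=k_4$; 2. $k_1+k_2=k_3+k_4$; 3. $2k_1=k_3$ and $k_1+k_4=k_2$; 4. $2k_1=k_4$ and $k_1=k_2+k_3$; 5. $2k_1=k_4$ and $k_2+k_4=k_3$; 6. $2k_1=k_4$ and $k_2+k_3=k_4$; 7. $k_1+k_2=k_4$ and $k_1+k_4=k_3$. **(IV) Phase correlations**, all up to $O(V^{-3/2})$. "Only" means that every integer linear relation among the wavevectors in question depends linearly on the stated ones. Two modes: - If $2k_1=k_2$: $C_2=\frac{\sqrt\pi}{2\sqrt V}\cos(2\theta_1-\theta_2)\,p^{(3)}(k_1,k_1,-k_2)+\frac1{2V}\cos[2(2\theta_1-\theta_2)]\,p^{(3)}(k_1,k_1,-k_2)^2$. - If $3k_1=k_2$: $C_2=\frac{\pi}{8V}\cos(3\theta_1-\theta_2)\,p^{(4)}(k_1,k_1,k_1,-k_2)$.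 - If none of $2k_1=k_2$, $2k_2=k_1$, $3k_1=k_2$, $3k_2=k_1$ holds: $C_2=0$. Three modes: - Only $k_1+k_2=k_3$: $C_3=\frac{\pi^{3/2}}{4\sqrt V}\cos(\theta_1+\theta_2-\theta_3)\,p^{(3)}(k_1,k_2,-k_3)+\frac1V\cos[2(\theta_1+\theta_2-\theta_3)]\,p^{(3)}(k_1,k_2,-k_3)^2$. - Only $2k_1+k_2=k_3$: $C_3=\frac{\pi}{4V}\cos(2\theta_1+\theta_2-\theta_3)\,p^{(4)}(k_1,k_1,k_2,-k_3)$. - Only $2k_1=k_2+k_3$: $C_3=\frac{\pi}{4V}\cos(2\theta_1-\theta_2-\theta_3)\,p^{(4)}(k_1,k_1,-k_2,-k_3)$. - If $(k_1,k_2,k_3)=(k,2k,3k)$: $C_3=\frac{\pi^{3/2}}{4\sqrt V}\cos(\theta_1+\theta_2-\theta_3)\,p^{(3)}(k,2k,-3k)+\frac1V\cos[2(\theta_1+\theta_2-\theta_3)]\,p^{(3)}(k,2k,-3k)^2+\frac{\pi}{8V}\cos(\theta_1-2\theta_2+\theta_3)\,[2p^{(4)}(2k,2k,-k,-3k)-p^{(3)}(k,k,-2k)\,p^{(3)}(k,2k,-3k)]$.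 - If $(k_1,k_2,k_3)=(k,2k,4k)$: $C_3=\frac{\pi}{4V}\cos(2\theta_1+\theta_2-\theta_3)\,p^{(4)}(k,k,2k,-4k)+\frac{\pi}{8V}[3\cos(2\theta_1-\theta_2)\cos(2\theta_2-\theta_3)-2\cos(2\theta_1+\theta_2-\theta_3)]\,p^{(3)}(k,k,-2k)\,p^{(3)}(2k,2k,-4k)$. Four modes: - Only $k_1+k_2+k_3=k_4$: $C_4=\frac{\pi^2}{8V}\cos(\theta_1+\theta_2+\theta_3-\theta_4)\,p^{(4)}(k_1,k_2,k_3,-k_4)$. - Only $k_1+k_2=k_3+k_4$: $C_4=\frac{\pi^2}{8V}\cos(\theta_1+\theta_2-\theta_3-\theta_4)\,p^{(4)}(k_1,k_2,-k_3,-k_4)$. - Only $2k_1=k_3$ and $k_1+k_4=k_2$: $C_4=\frac{\pi^2}{8V}\cos(\theta_1+\theta_2-\theta_3-\theta_4)\,p^{(4)}(k_1,k_2,-k_3,-k_4)+\frac{\pi^2}{16V}[3\cos(2\theta_1-\theta_3)\cos(\theta_1-\theta_2+\theta_4)-2\cos(\theta_1+\theta_2-\theta_3-\theta_4)]\,p^{(3)}(k_1,k_1,-k_3)\,p^{(3)}(k_1,-k_2,k_4)$.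 - Only $2k_1=k_4$ and $k_1=k_2+k_3$: $C_4=\frac{\pi^2}{8V}\cos(\theta_1+\theta_2+\theta_3-\theta_4)\,p^{(4)}(k_1,k_2,k_3,-k_4)+\frac{\pi^2}{16V}[3\cos(2\theta_1-\theta_4)\cos(\theta_1-\theta_2-\theta_3)-2\cos(\theta_1+\theta_2+\theta_3-\theta_4)]\,p^{(3)}(k_1,k_1,-k_4)\,p^{(3)}(-k_1,k_2,k_3)$. - Only $2k_1=k_4$ and $k_2+k_4=k_3$: $C_4=\frac{\pi}{4V}\cos(2\theta_1-\theta_2+\theta_3-2\theta_4)\,p^{(3)}(k_1,k_1,-k_4)\,p^{(3)}(k_2,-k_3,k_4)$. - Only $2k_1=k_4$ and $k_2+k_3=k_4$: $C_4=\frac{\pi}{4V}\cos(2\theta_1+\theta_2+\theta_3-2\theta_4)\,p^{(3)}(k_1,k_1,-k_4)\,p^{(3)}(k_2,k_3,-k_4)$. -/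

import Mathlib

noncomputable section

namespace FourierModes

open MeasureTheory

/-! ## Random fields on a periodic box and their Fourier modes -/

/-- The periodic box with side lengths `L i`. -/
abbrev Box {d : ℕ} (L : Fin d → ℝ) : Type := ∀ i, AddCircle (L i)

/-- Wavevectors of a `d`-dimensional periodic box: `n` stands for `k = (2π n_i / L_i)_i`. The map
`n ↦ k` is additive and injective, so integer linear relations are the same for `n` and `k`. -/
abbrev Wavevector (d : ℕ) : Type := Fin d → ℤ

/-- The volume `V = L_1 ⋯ L_d`. -/
def boxVolume {d : ℕ} (L : Fin d → ℝ) : ℝ := ∏ i, L i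

/-- A real random field on the box which has moments of all orders and zero mean, and whose
finite-dimensional distributions are invariant under translations. -/
structure IsHomogeneousField {d : ℕ} {L : Fin d → ℝ} {Ω : Type*} [MeasurableSpace Ω]
    (μ : Measure Ω) (f : Ω → Box L → ℝ) : Prop where
  measurable : Measurable (Function.uncurry f)
  moments : ∀ (x : Box L) (m : ℕ), Integrable (fun ω => |f ω x| ^ m) μ
  zero_mean : ∀ x : Box L, ∫ ω, f ω x ∂μ = 0
  homogeneous : ∀ (y : Box L) (m : ℕ) (x : Fin m → Box L),
    μ.map (fun ω (i : Fin m) => f ω (x i + y)) = μ.map (fun ω (i : Fin m) => f ω (x i))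

/-- The volume-normalized Fourier coefficient `f_k = V^{-1/2} ∫ f(x) e^{-i k·x} dx`. -/
def fourierMode {d : ℕ} {L : Fin d → ℝ} [∀ i, Fact (0 < L i)] {Ω : Type*}
    (f : Ω → Box L → ℝ) (k : Wavevector d) (ω : Ω) : ℂ :=
  ((Real.sqrt (boxVolume L) : ℝ) : ℂ)⁻¹ *
    ∫ x : Box L, (f ω x : ℂ) * ∏ i, fourier (-(k i)) (x i)

/-- The power spectrum `P(k) = ⟨|f_k|²⟩`. -/
def powerSpectrum {d : ℕ} {L : Fin d → ℝ} [∀ i, Fact (0 < L i)] {Ω : Type*} [MeasurableSpace Ω]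
    (μ : Measure Ω) (f : Ω → Box L → ℝ) (k : Wavevector d) : ℝ :=
  ∫ ω, ‖fourierMode f k ω‖ ^ 2 ∂μ

/-- The joint cumulant `⟨X_1 ⋯ X_n⟩_c` as a sum over the set partitions of the indices. -/
def jointCumulant {Ω : Type*} [MeasurableSpace Ω] (μ : Measure Ω) {n : ℕ}
    (X : Fin n → Ω → ℂ) : ℂ :=
  ∑ π : Finpartition (Finset.univ : Finset (Fin n)),
    (-1 : ℂ) ^ (π.parts.card - 1) * ((π.parts.card - 1).factorial : ℂ) *
      ∏ B ∈ π.parts, ∫ ω, ∏ i ∈ B, X i ω ∂μ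

/-- The polyspectrum `P^{(n+1)}(k_1, …, k_n)`, defined by
`⟨f_{k_1} ⋯ f_{k_n} f_{-k_1-⋯-k_n}⟩_c = V^{1-(n+1)/2} P^{(n+1)}(k_1, …, k_n)`. -/
def polyspectrum {d : ℕ} {L : Fin d → ℝ} [∀ i, Fact (0 < L i)] {Ω : Type*} [MeasurableSpace Ω]
    (μ : Measure Ω) (f : Ω → Box L → ℝ) (n : ℕ) (k : Fin n → Wavevector d) : ℂ :=
  ((boxVolume L ^ (((n : ℝ) + 1) / 2 - 1) : ℝ) : ℂ) *
    jointCumulant μ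
      (fun i : Fin (n + 1) =>
        fourierMode f ((Fin.snoc k (-∑ j, k j) : Fin (n + 1) → Wavevector d) i))

/-- The normalized polyspectrum `p^{(n+1)}(k_1, …, k_{n+1})
= δ_{k_1+⋯+k_{n+1}} P^{(n+1)}(k_1, …, k_n) / √(P(k_1) ⋯ P(k_{n+1}))`. -/
def normalizedPolyspectrum {d : ℕ} {L : Fin d → ℝ} [∀ i, Fact (0 < L i)] {Ω : Type*}
    [MeasurableSpace Ω] (μ : Measure Ω) (f : Ω → Box L → ℝ) (n : ℕ)
    (k : Fin (n + 1) → Wavevector d) : ℂ :=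
  if ∑ i, k i = 0 then
    polyspectrum μ f n (fun i : Fin n => k i.castSucc) /
      ((Real.sqrt (∏ i, powerSpectrum μ f (k i)) : ℝ) : ℂ)
  else 0

/-- The normalized bispectrum `p^{(3)}`. -/
def bispec {d : ℕ} {L : Fin d → ℝ} [∀ i, Fact (0 < L i)] {Ω : Type*} [MeasurableSpace Ω]
    (μ : Measure Ω) (f : Ω → Box L → ℝ) (k₁ k₂ k₃ : Wavevector d) : ℂ :=
  normalizedPolyspectrum μ f 2 ![k₁, k₂, k₃]

/-- The normalized trispectrum `p^{(4)}`. -/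
def trispec {d : ℕ} {L : Fin d → ℝ} [∀ i, Fact (0 < L i)] {Ω : Type*} [MeasurableSpace Ω]
    (μ : Measure Ω) (f : Ω → Box L → ℝ) (k₁ k₂ k₃ k₄ : Wavevector d) : ℂ :=
  normalizedPolyspectrum μ f 3 ![k₁, k₂, k₃, k₄]

/-- An upper half of the wavevectors: an additively closed set that contains exactly one of `k`,
`-k` for every `k ≠ 0`, and does not contain `0`. -/
structure IsUpperHalf {d : ℕ} (U : Set (Wavevector d)) : Prop where
  zero_notMem : (0 : Wavevector d) ∉ U
  add_mem : ∀ k ∈ U, ∀ l ∈ U, k + l ∈ U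
  total : ∀ k : Wavevector d, k ≠ 0 → k ∈ U ∨ -k ∈ U

/-- The normalized modes `α_k = f_k / √P(k)` for a finite family of wavevectors `k i`. -/
def normalizedMode {d : ℕ} {L : Fin d → ℝ} [∀ i, Fact (0 < L i)] {Ω : Type*} [MeasurableSpace Ω]
    (μ : Measure Ω) (f : Ω → Box L → ℝ) {ι : Type*} (k : ι → Wavevector d) (ω : Ω) (i : ι) : ℂ :=
  fourierMode f (k i) ω / ((Real.sqrt (powerSpectrum μ f (k i)) : ℝ) : ℂ)

/-! ## The joint distribution as a formal series in `V^{-1/2}` -/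

/-- The linear form `∑ (K_i a_i + L_i b_i)` for `J_i = K_i + i L_i` and `α_i = a_i + i b_i`. -/
def pairing {ι : Type*} [Fintype ι] (J α : ι → ℂ) : ℝ :=
  ∑ i, ((J i).re * (α i).re + (J i).im * (α i).im)

/-- The cumulant `⟨X^N⟩_c` of `X = ∑ (K_i a_i + L_i b_i)` for a random vector `α`. -/
def cumulantOfPairing {Ω : Type*} [MeasurableSpace Ω] (μ : Measure Ω) {ι : Type*} [Fintype ι]
    (α : Ω → ι → ℂ) (N : ℕ) (J : ι → ℂ) : ℂ :=
  jointCumulant μ (fun (_ : Fin N) ω => ((pairing J (α ω) : ℝ) : ℂ))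

/-- The coefficient of `(V^{-1/2})^m` in `log ⟨e^{-iX}⟩ = ∑_{N ≥ 2} (-i)^N / N! ⟨X^N⟩_c`, where
`⟨X^N⟩_c = V^{1-N/2} (V^{N/2-1} ⟨X^N⟩_c)` counts as a term of order `m = N - 2`. -/
def logCharCoeff {Ω : Type*} [MeasurableSpace Ω] (μ : Measure Ω) (V : ℝ) {ι : Type*} [Fintype ι]
    (α : Ω → ι → ℂ) (J : ι → ℂ) (m : ℕ) : ℂ :=
  (-Complex.I) ^ (m + 2) / ((m + 2).factorial : ℂ) *
    (((Real.sqrt V) ^ m : ℝ) : ℂ) * cumulantOfPairing μ α (m + 2) J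

/-- `⟨e^{-iX}⟩` as a formal power series in `V^{-1/2}`: the exponential of the series with the
coefficients `logCharCoeff`. The series `E` has no constant term, so only its powers `E ^ j`
with `j ≤ n` contribute to the coefficient of order `n`. -/
def charSeries {Ω : Type*} [MeasurableSpace Ω] (μ : Measure Ω) (V : ℝ) {ι : Type*} [Fintype ι]
    (α : Ω → ι → ℂ) (J : ι → ℂ) : PowerSeries ℂ :=
  let E : PowerSeries ℂ := PowerSeries.mk fun m => if m = 0 then 0 else logCharCoeff μ V α J m
  PowerSeries.mk fun n => Complex.exp (logCharCoeff μ V α J 0) *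
    ∑ j ∈ Finset.range (n + 1), PowerSeries.coeff n (E ^ j) / (j.factorial : ℂ)

/-- The coefficient of order `n` in `V^{-1/2}` of the joint probability density of the real and
imaginary parts of `α`: the inverse Fourier transform of that of `⟨e^{-iX}⟩`. -/
def densityCoeff {Ω : Type*} [MeasurableSpace Ω] (μ : Measure Ω) (V : ℝ) {ι : Type*} [Fintype ι]
    (α : Ω → ι → ℂ) (n : ℕ) (z : ι → ℂ) : ℂ :=
  ∫ J : ι → ℂ, (1 / (2 * Real.pi : ℂ) ^ (2 * Fintype.card ι)) *
    Complex.exp (Complex.I * (pairing J z : ℂ)) * PowerSeries.coeff n (charSeries μ V α J)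

/-- The same in the polar variables `α_i = A_i e^{iθ_i}`, with the Jacobian `∏ A_i`. -/
def polarDensityCoeff {Ω : Type*} [MeasurableSpace Ω] (μ : Measure Ω) (V : ℝ) {ι : Type*}
    [Fintype ι] (α : Ω → ι → ℂ) (n : ℕ) (A θ : ι → ℝ) : ℂ :=
  (∏ i, (A i : ℂ)) *
    densityCoeff μ V α n (fun i => (A i : ℂ) * Complex.exp (Complex.I * (θ i : ℂ)))

section Distributions

variable {d : ℕ} {L : Fin d → ℝ} [∀ i, Fact (0 < L i)] {Ω : Type*} [MeasurableSpace Ω]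
  (μ : Measure Ω) (f : Ω → Box L → ℝ) {ι : Type*} [Fintype ι] [DecidableEq ι]
  (k : ι → Wavevector d)

/-- The distribution of the moduli and phases of the modes in `T`, as a formal power series in
`V^{-1/2}`: all the modes outside `T` are integrated out. It depends on `A`, `θ` only through
their values on `T`. -/
def pointDist (T : Finset ι) (A θ : ι → ℝ) : PowerSeries ℂ :=
  PowerSeries.mk fun n =>
    ∫ A' : ↥(Tᶜ) → ℝ in Set.univ.pi (fun _ => Set.Ioi 0),
      ∫ θ' : ↥(Tᶜ) → ℝ in Set.univ.pi (fun _ => Set.Ioo 0 (2 * Real.pi)),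
        polarDensityCoeff μ (boxVolume L) (normalizedMode μ f k) n
          (Function.updateFinset A Tᶜ A') (Function.updateFinset θ Tᶜ θ')

/-- The reduced distribution: `P₂ = P₁ P₁ [1 + R₂]`. -/
def R₂ (a b : ι) (A θ : ι → ℝ) : PowerSeries ℂ :=
  pointDist μ f k {a, b} A θ *
    (pointDist μ f k {a} A θ * pointDist μ f k {b} A θ)⁻¹ - 1

/-- The reduced distribution: `P₃ = P₁ P₁ P₁ [1 + R₂ + R₂ + R₂ + R₃]`. -/
def R₃ (a b c : ι) (A θ : ι → ℝ) : PowerSeries ℂ :=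
  pointDist μ f k {a, b, c} A θ *
    (pointDist μ f k {a} A θ * pointDist μ f k {b} A θ * pointDist μ f k {c} A θ)⁻¹
  - (1 + R₂ μ f k a b A θ + R₂ μ f k b c A θ + R₂ μ f k a c A θ)

/-- The reduced distribution:
`P₄ = P₁ P₁ P₁ P₁ [1 + R₂ + sym.(6) + R₂ R₂ + sym.(3) + R₃ + sym.(4) + R₄]`. -/
def R₄ (a b c e : ι) (A θ : ι → ℝ) : PowerSeries ℂ :=
  pointDist μ f k {a, b, c, e} A θ *
    (pointDist μ f k {a} A θ * pointDist μ f k {b} A θ * pointDist μ f k {c} A θ *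
      pointDist μ f k {e} A θ)⁻¹
  - (1 + R₂ μ f k a b A θ + R₂ μ f k a c A θ + R₂ μ f k a e A θ
      + R₂ μ f k b c A θ + R₂ μ f k b e A θ + R₂ μ f k c e A θ
      + R₂ μ f k a b A θ * R₂ μ f k c e A θ + R₂ μ f k a c A θ * R₂ μ f k b e A θ
      + R₂ μ f k a e A θ * R₂ μ f k b c A θ
      + R₃ μ f k a b c A θ + R₃ μ f k a b e A θ + R₃ μ f k a c e A θ + R₃ μ f k b c e A θ)

/-- The distribution of the phases of the modes in `T`: the moduli are integrated out. -/
def phaseDist (T : Finset ι) (θ : ι → ℝ) : PowerSeries ℂ :=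
  PowerSeries.mk fun n =>
    ∫ A' : ↥T → ℝ in Set.univ.pi (fun _ => Set.Ioi 0),
      PowerSeries.coeff n (pointDist μ f k T (Function.updateFinset (fun _ => 0) T A') θ)

/-- The reduced phase distribution: `(2π)² P₂ = 1 + C₂`. -/
def C₂ (a b : ι) (θ : ι → ℝ) : PowerSeries ℂ :=
  PowerSeries.C ((2 * Real.pi : ℂ) ^ 2) * phaseDist μ f k {a, b} θ - 1

/-- The reduced phase distribution: `(2π)³ P₃ = 1 + C₂ + C₂ + C₂ + C₃`. -/
def C₃ (a b c : ι) (θ : ι → ℝ) : PowerSeries ℂ :=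
  PowerSeries.C ((2 * Real.pi : ℂ) ^ 3) * phaseDist μ f k {a, b, c} θ
  - (1 + C₂ μ f k a b θ + C₂ μ f k b c θ + C₂ μ f k c a θ)

/-- The reduced phase distribution:
`(2π)⁴ P₄ = 1 + C₂ + sym.(6) + C₂ C₂ + sym.(3) + C₃ + sym.(4) + C₄`. -/
def C₄ (a b c e : ι) (θ : ι → ℝ) : PowerSeries ℂ :=
  PowerSeries.C ((2 * Real.pi : ℂ) ^ 4) * phaseDist μ f k {a, b, c, e} θ
  - (1 + C₂ μ f k a b θ + C₂ μ f k a c θ + C₂ μ f k a e θ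
      + C₂ μ f k b c θ + C₂ μ f k b e θ + C₂ μ f k c e θ
      + C₂ μ f k a b θ * C₂ μ f k c e θ + C₂ μ f k a c θ * C₂ μ f k b e θ
      + C₂ μ f k a e θ * C₂ μ f k b c θ
      + C₃ μ f k a b c θ + C₃ μ f k a b e θ + C₃ μ f k a c e θ + C₃ μ f k b c e θ)

end Distributions

/-- `F = c₁ V^{-1/2} + c₂ V^{-1} + O(V^{-3/2})` for formal power series in `V^{-1/2}`. -/
def UpToSecondOrder (F : PowerSeries ℂ) (c₁ c₂ : ℂ) : Prop :=
  PowerSeries.X ^ 3 ∣ F - (PowerSeries.C c₁ * PowerSeries.X + PowerSeries.C c₂ * PowerSeries.X ^ 2)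

/-- Every integer linear relation among the `q i` depends linearly on the relations in `R`. -/
def NoOtherRelation {d n : ℕ} (q : Fin n → Wavevector d) (R : Set (Fin n → ℤ)) : Prop :=
  ∀ j : Fin n → ℤ, ∑ i, j i • q i = 0 → ∃ c : ℤ, c ≠ 0 ∧ c • j ∈ Submodule.span ℤ R

/-! ## The terms of the explicit formulas

`p₃`, `p₄` stand for the normalized bi- and trispectrum, `k`, `A`, `θ` for the wavevectors, moduli
and phases of the modes. -/

section Terms

variable {K ι : Type*} [AddCommGroup K] (p₃ : K → K → K → ℂ) (p₄ : K → K → K → K → ℂ)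
  (k : ι → K) (A θ : ι → ℝ)

/-- First term of `R₂` (order `V^{-1/2}`). -/
def R₂term₁ (a b : ι) : ℂ :=
  ((A a ^ 2 * A b * Real.cos (2 * θ a - θ b) : ℝ) : ℂ) * p₃ (k a) (k a) (-k b)

/-- Second term of `R₂` (order `V^{-1}`). -/
def R₂term₂ (a b : ι) : ℂ :=
  ((1 / 2 * (A a ^ 4 * A b ^ 2 * Real.cos (2 * θ a - θ b) ^ 2 - 2 * A a ^ 2 * A b ^ 2
      - 1 / 2 * A a ^ 4 + 2 * A a ^ 2 + A b ^ 2 - 1) : ℝ) : ℂ) * p₃ (k a) (k a) (-k b) ^ 2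

/-- Third term of `R₂` (order `V^{-1}`). -/
def R₂term₃ (a b : ι) : ℂ :=
  ((1 / 3 * (A a ^ 3 * A b * Real.cos (3 * θ a - θ b)) : ℝ) : ℂ) *
    p₄ (k a) (k a) (k a) (-k b)

/-- Fourth term of `R₂` (order `V^{-1}`). -/
def R₂term₄ (a b : ι) : ℂ :=
  ((A a ^ 2 * A b ^ 2 - A a ^ 2 - A b ^ 2 + 1 : ℝ) : ℂ) * p₄ (k a) (k b) (-k a) (-k b)

/-- First term of the asymmetric function of `R₃` (order `V^{-1/2}`). -/
def R₃term₁ (a b c : ι) : ℂ :=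
  ((A a * A b * A c * Real.cos (θ a + θ b - θ c) : ℝ) : ℂ) * p₃ (k a) (k b) (-k c)

/-- Second term of the asymmetric function of `R₃` (order `V^{-1}`). -/
def R₃term₂ (a b c : ι) : ℂ :=
  ((A a ^ 2 * A b * A c * Real.cos (2 * θ a + θ b - θ c) : ℝ) : ℂ) *
    p₄ (k a) (k a) (k b) (-k c)

/-- Third term of the asymmetric function of `R₃` (order `V^{-1}`). -/
def R₃term₃ (a b c : ι) : ℂ :=
  ((1 / 2 * (A a ^ 2 * A b * A c * Real.cos (2 * θ a - θ b - θ c)) : ℝ) : ℂ) *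
    p₄ (k a) (k a) (-k b) (-k c)

/-- Fourth term of the asymmetric function of `R₃` (order `V^{-1}`). -/
def R₃term₄ (a b c : ι) : ℂ :=
  ((A a ^ 2 * A b ^ 2 * A c ^ 2 * Real.cos (θ a + θ b - θ c) ^ 2
      - 1 / 2 * (A a ^ 2 * A b ^ 2 + A a ^ 2 * A c ^ 2 + A b ^ 2 * A c ^ 2
        - A a ^ 2 - A b ^ 2 - A c ^ 2 + 1) : ℝ) : ℂ) * p₃ (k a) (k b) (-k c) ^ 2

/-- Fifth term of the asymmetric function of `R₃` (order `V^{-1}`). -/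
def R₃term₅ (a b c : ι) : ℂ :=
  ((A a ^ 2 * A b ^ 3 * A c * Real.cos (2 * θ a - θ b) * Real.cos (2 * θ b - θ c)
      - A a ^ 2 * A b * A c * Real.cos (2 * θ a + θ b - θ c) : ℝ) : ℂ) *
    (p₃ (k a) (k a) (-k b) * p₃ (k b) (k b) (-k c))

/-- Sixth term of the asymmetric function of `R₃` (order `V^{-1}`). -/
def R₃term₆ (a b c : ι) : ℂ :=
  ((2 * A a ^ 3 * A b ^ 2 * A c * Real.cos (2 * θ a - θ b) * Real.cos (θ a + θ b - θ c)
      - A a ^ 3 * A c * Real.cos (3 * θ a - θ c)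
      - 2 * A a * A b ^ 2 * A c * Real.cos (θ a - 2 * θ b + θ c) : ℝ) : ℂ) *
    (p₃ (k a) (k a) (-k b) * p₃ (k a) (k b) (-k c))

/-- The `V^{-1}` part of the asymmetric function of `R₃`. -/
def R₃asym (a b c : ι) : ℂ :=
  R₃term₂ p₄ k A θ a b c + R₃term₃ p₄ k A θ a b c + R₃term₄ p₃ k A θ a b c
    + R₃term₅ p₃ k A θ a b c + R₃term₆ p₃ k A θ a b c

/-- First term of the asymmetric function of `R₄` (order `V^{-1}`, as all the others). -/
def R₄term₁ (a b c e : ι) : ℂ :=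
  ((1 / 3 * (A a * A b * A c * A e * Real.cos (θ a + θ b + θ c - θ e)) : ℝ) : ℂ) *
    p₄ (k a) (k b) (k c) (-k e)

/-- Second term of the asymmetric function of `R₄`. -/
def R₄term₂ (a b c e : ι) : ℂ :=
  ((1 / 4 * (A a * A b * A c * A e * Real.cos (θ a + θ b - θ c - θ e)) : ℝ) : ℂ) *
    p₄ (k a) (k b) (-k c) (-k e)

/-- Third term of the asymmetric function of `R₄`. -/
def R₄term₃ (a b c e : ι) : ℂ :=
  ((2 * A a ^ 3 * A b * A c * A e * Real.cos (2 * θ a - θ c) * Real.cos (θ a - θ b + θ e)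
      - 2 * A a * A b * A c * A e * Real.cos (θ a + θ b - θ c - θ e) : ℝ) : ℂ) *
    (p₃ (k a) (k a) (-k c) * p₃ (k a) (-k b) (k e))

/-- Fourth term of the asymmetric function of `R₄`. -/
def R₄term₄ (a b c e : ι) : ℂ :=
  ((A a ^ 3 * A b * A c * A e * Real.cos (2 * θ a - θ e) * Real.cos (θ a - θ b - θ c)
      - A a * A b * A c * A e * Real.cos (θ a + θ b + θ c - θ e) : ℝ) : ℂ) *
    (p₃ (k a) (k a) (-k e) * p₃ (-k a) (k b) (k c))

/-- Fifth term of the asymmetric function of `R₄`. -/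
def R₄term₅ (a b c e : ι) : ℂ :=
  ((2 * A a ^ 2 * A b * A c * A e ^ 2 * Real.cos (2 * θ a - θ e) * Real.cos (θ b - θ c + θ e)
      - A a ^ 2 * A b * A c * Real.cos (2 * θ a + θ b - θ c) : ℝ) : ℂ) *
    (p₃ (k a) (k a) (-k e) * p₃ (k b) (-k c) (k e))

/-- Sixth term of the asymmetric function of `R₄`. -/
def R₄term₆ (a b c e : ι) : ℂ :=
  ((A a ^ 2 * A b * A c * A e ^ 2 * Real.cos (2 * θ a - θ e) * Real.cos (θ b + θ c - θ e)
      - 1 / 2 * (A a ^ 2 * A b * A c * Real.cos (2 * θ a - θ b - θ c)) : ℝ) : ℂ) *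
    (p₃ (k a) (k a) (-k e) * p₃ (k b) (k c) (-k e))

/-- Seventh term of the asymmetric function of `R₄`. -/
def R₄term₇ (a b c e : ι) : ℂ :=
  ((4 * A a ^ 2 * A b * A c * A e ^ 2 * Real.cos (θ a + θ b - θ e) * Real.cos (θ a - θ c + θ e)
      - 2 * A a ^ 2 * A b * A c * Real.cos (2 * θ a + θ b - θ c)
      - 2 * A b * A c * A e ^ 2 * Real.cos (θ b + θ c - 2 * θ e) : ℝ) : ℂ) *
    (p₃ (k a) (k b) (-k e) * p₃ (k a) (-k c) (k e))

/-- The asymmetric function of `R₄` (order `V^{-1}`). -/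
def R₄asym (a b c e : ι) : ℂ :=
  R₄term₁ p₄ k A θ a b c e + R₄term₂ p₄ k A θ a b c e + R₄term₃ p₃ k A θ a b c e
    + R₄term₄ p₃ k A θ a b c e + R₄term₅ p₃ k A θ a b c e + R₄term₆ p₃ k A θ a b c e
    + R₄term₇ p₃ k A θ a b c e

end Terms

end FourierModes

end

/-! With J = K + iL one has X = Re Σ conj(J_i) α_i, so -iX is a linear form in the α_i and their
conjugates, with coefficients `letter J`. By multilinearity of cumulants, each order of log⟨e^{-iX}⟩
is a polynomial in these letters whose coefficients are normalized polyspectra (`logCharCoeff_eq`).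
Translation invariance kills every cumulant whose wavevectors do not add up to zero. As all modes
lie in an upper half, words made of α's alone or of conjugates alone drop out. Up to order V^{-1}
there remain the Gaussian exponent -Σ|J_i|²/4, a `cubic` polynomial with coefficients p₃(x,y,-z),
and a `quartic` one with coefficients p₄(x,y,z,-w) and p₄(x,y,-z,-w). Parity gives conjugate
monomials equal coefficients, which is why only cosines occur in the end. Hence ⟨e^{-iX}⟩ is the
Gaussian times 1, cubic, quartic + cubic²/2 in the orders 0, 1, 2 (`coeff_charSeries`).

The inverse Fourier transform of a Gaussian times a monomial is a Gaussian density times one complex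
Hermite polynomial per mode. So each order of the density is the value of a linear functional `wick
φ` that replaces a monomial ∏ α_i^{p_i} conj(α_i)^{q_i} by ∏ φ i p_i q_i (`integral_fourier_wick`).
The nonconstant Hermite polynomials are orthogonal to the constants, so integrating out a mode
amounts to setting its letters to zero (`integral_polarWick`, `wick_marginalWeight`): P_N comes from
the same polynomial restricted to the N modes. Integrating over the moduli only changes the weights,
from `modeWeight` to `phaseWeight`. The R_N and the C_N are thus one computation with two choices of
weights.

The recursive definitions of R_N and C_N are inclusion-exclusion over subsets of modes. What
survives is the part of the polynomial that involves all N modes, and the products over disjoint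
pairs are cancelled by R₂R₂ or C₂C₂ (`secondOrder_exact₂`, `secondOrder_exact₃`,
`secondOrder_exact₄`). Most products in cubic² vanish because the two linear relations they need are
incompatible for distinct wavevectors in an upper half (`isModeCoupling`).

Finally, both kinds of weights have the form ρ e^{i(q-p)θ} with real, suitably symmetric ρ
(`IsPolarWeight`), so conjugate monomials combine to cosines. At fixed moduli ρ is a polynomial in
A. Averaged over the moduli it is a Gamma value for q = 0, and it vanishes for p = q ≠ 0, which
removes many terms from the C_N. Under the assumptions of (IV), a coupling can be nonzero only if
its coefficient vector satisfies the equations that all relations satisfy, and this is a finite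
check over the orderings. -/

noncomputable section

namespace FourierModes

open MvPolynomial

/-! ## The Wick functional -/

section Wick

variable {ι : Type*} [Fintype ι] 

/-- The linear functional on polynomials in the modes `α_i` (letter `(i, true)`) and their conjugates
(letter `(i, false)`) which sends a monomial to the product of the weights `φ i p q`. -/
def wick (φ : ι → ℕ → ℕ → ℂ) : MvPolynomial (ι × Bool) ℂ →ₗ[ℂ] ℂ :=
  (MvPolynomial.basisMonomials (ι × Bool) ℂ).constr ℂ
    fun m => ∏ i, φ i (m (i, true)) (m (i, false))

lemma wick_monomial (φ : ι → ℕ → ℕ → ℂ) (m : ι × Bool →₀ ℕ) (c : ℂ) :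
    wick φ (monomial m c) = c * ∏ i, φ i (m (i, true)) (m (i, false)) := by
  have h : monomial m c = c • (MvPolynomial.basisMonomials (ι × Bool) ℂ) m := by
    simp [MvPolynomial.smul_monomial]
  rw [h, map_smul, wick, Module.Basis.constr_basis, smul_eq_mul]

lemma wick_C_mul (φ : ι → ℕ → ℕ → ℂ) (c : ℂ) (p : MvPolynomial (ι × Bool) ℂ) :
    wick φ (C c * p) = c * wick φ p := by
  rw [← MvPolynomial.smul_eq_C_mul, map_smul, smul_eq_mul]

/-- The variable of the mode `i`. -/
def up (i : ι) : MvPolynomial (ι × Bool) ℂ := X (i, true)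

/-- The variable of the complex conjugate of the mode `i`. -/
def dn (i : ι) : MvPolynomial (ι × Bool) ℂ := X (i, false)

variable [DecidableEq ι]

/-- Modes outside `T` have exponents zero, and the normalization `φ i 0 0 = 1` removes them from the
product over all modes. -/
lemma wick_prod {φ : ι → ℕ → ℕ → ℂ} (hφ : ∀ i, φ i 0 0 = 1) (T : Finset ι) (p q : ι → ℕ) :
    wick φ (∏ i ∈ T, (up i ^ p i * dn i ^ q i)) = ∏ i ∈ T, φ i (p i) (q i) := by
  have h : ∏ i ∈ T, ((up i : MvPolynomial (ι × Bool) ℂ) ^ p i * dn i ^ q i)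
      = monomial (∑ i ∈ T, (Finsupp.single (i, true) (p i) + Finsupp.single (i, false) (q i)))
        (1 : ℂ) := by
    rw [MvPolynomial.monomial_sum_one]
    refine Finset.prod_congr rfl fun i _ => ?_
    rw [up, dn, X_pow_eq_monomial, X_pow_eq_monomial, monomial_mul, one_mul]
  rw [h, wick_monomial, one_mul, ← Finset.prod_subset (Finset.subset_univ T)]
  · refine Finset.prod_congr rfl fun i hi => ?_
    congr 1 <;>
    simp [Finsupp.finsetSum_apply, Finsupp.single_apply, Finset.sum_ite_eq', hi]
  · intro i _ hi
    have : ∀ s, (∑ j ∈ T, (Finsupp.single (j, true) (p j) + Finsupp.single (j, false) (q j)) :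
        ι × Bool →₀ ℕ) (i, s) = 0 := by
      intro s
      rw [Finsupp.finsetSum_apply]
      refine Finset.sum_eq_zero fun j hj => ?_
      have : j ≠ i := fun h => hi (h ▸ hj)
      simp [this]
    rw [this, this, hφ]

/-- The normal form for explicit monomials: sorted by modes, with zero exponents written out. -/
lemma wick_pow₂ {φ : ι → ℕ → ℕ → ℂ} (hφ : ∀ i, φ i 0 0 = 1) {a b : ι} (hab : a ≠ b)
    (p₁ q₁ p₂ q₂ : ℕ) :
    wick φ (up a ^ p₁ * dn a ^ q₁ * (up b ^ p₂ * dn b ^ q₂)) = φ a p₁ q₁ * φ b p₂ q₂ := by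
  have h := wick_prod hφ {a, b} (fun i => if i = a then p₁ else p₂)
    (fun i => if i = a then q₁ else q₂)
  rw [Finset.prod_pair hab, Finset.prod_pair hab] at h
  simpa [hab.symm] using h

lemma wick_pow₃ {φ : ι → ℕ → ℕ → ℂ} (hφ : ∀ i, φ i 0 0 = 1) {a b c : ι} (hab : a ≠ b)
    (hac : a ≠ c) (hbc : b ≠ c) (p₁ q₁ p₂ q₂ p₃ q₃ : ℕ) :
    wick φ (up a ^ p₁ * dn a ^ q₁ * (up b ^ p₂ * dn b ^ q₂) * (up c ^ p₃ * dn c ^ q₃)) =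
      φ a p₁ q₁ * φ b p₂ q₂ * φ c p₃ q₃ := by
  have h := wick_prod hφ {a, b, c} (fun i => if i = a then p₁ else if i = b then p₂ else p₃)
    (fun i => if i = a then q₁ else if i = b then q₂ else q₃)
  rw [Finset.prod_insert (by simp [hab, hac]), Finset.prod_pair hbc,
    Finset.prod_insert (by simp [hab, hac]), Finset.prod_pair hbc] at h
  simpa [hab.symm, hac.symm, hbc.symm, mul_assoc] using h

lemma wick_pow₄ {φ : ι → ℕ → ℕ → ℂ} (hφ : ∀ i, φ i 0 0 = 1) {a b c e : ι} (hab : a ≠ b)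
    (hac : a ≠ c) (hae : a ≠ e) (hbc : b ≠ c) (hbe : b ≠ e) (hce : c ≠ e)
    (p₁ q₁ p₂ q₂ p₃ q₃ p₄ q₄ : ℕ) :
    wick φ (up a ^ p₁ * dn a ^ q₁ * (up b ^ p₂ * dn b ^ q₂) * (up c ^ p₃ * dn c ^ q₃) *
        (up e ^ p₄ * dn e ^ q₄)) =
      φ a p₁ q₁ * φ b p₂ q₂ * φ c p₃ q₃ * φ e p₄ q₄ := by
  have h := wick_prod hφ {a, b, c, e}
    (fun i => if i = a then p₁ else if i = b then p₂ else if i = c then p₃ else p₄)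
    (fun i => if i = a then q₁ else if i = b then q₂ else if i = c then q₃ else q₄)
  rw [Finset.prod_insert (by simp [hab, hac, hae]), Finset.prod_insert (by simp [hbc, hbe]),
    Finset.prod_pair hce,
    Finset.prod_insert (by simp [hab, hac, hae]), Finset.prod_insert (by simp [hbc, hbe]),
    Finset.prod_pair hce] at h
  simpa [hab.symm, hac.symm, hae.symm, hbc.symm, hbe.symm, hce.symm, mul_assoc] using h

end Wick

/-! ## Couplings of the modes -/

/-- The couplings `b x y z = p₃(k_x, k_y, -k_z)`, `q x y z w = p₄(k_x, k_y, k_z, -k_w)` and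
`r x y z w = p₄(k_x, k_y, -k_z, -k_w)` of modes in an upper half of the wavevectors: their
symmetries, and the coincidences of wavevectors that are excluded. -/
structure IsModeCoupling {ι : Type*} (b : ι → ι → ι → ℂ) (q r : ι → ι → ι → ι → ℂ) : Prop where
  b_swap : ∀ x y z, b x y z = b y x z
  b_self : ∀ y z, b z y z = 0
  b_same : ∀ x y u v, u ≠ v → b x y u * b x y v = 0
  b_same' : ∀ x y u v, u ≠ v → b x u y * b x v y = 0
  b_half : ∀ x y z, x ≠ y → b x x z * b y y z = 0
  b_opp : ∀ x y u v, b x u y * b y v x = 0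
  q_swap : ∀ x y z w, q x y z w = q y x z w
  q_swap' : ∀ x y z w, q x y z w = q x z y w
  q_self : ∀ x y w, q w x y w = 0
  r_swap : ∀ x y z w, r x y z w = r y x z w
  r_flip : ∀ x y z w, r x y z w = r z w x y
  r_cancel : ∀ x y w, y ≠ w → r x y x w = 0
  r_sq : ∀ x y, x ≠ y → r x x y y = 0

section Sums

variable {ι : Type*} [DecidableEq ι] {R : Type*} [CommRing R]

/-- The third index must differ from the first two, so with two modes available only the doublings
remain. -/
lemma sum_cube_pair (f : ι → ι → ι → R) {a b : ι} (hab : a ≠ b)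
    (hs : ∀ x y z, f x y z = f y x z) (h0 : ∀ y z, f z y z = 0) :
    ∑ x ∈ {a, b}, ∑ y ∈ {a, b}, ∑ z ∈ {a, b}, f x y z = f a a b + f b b a := by
  have h0' : ∀ y z, f y z z = 0 := fun y z => (hs y z z).trans (h0 y z)
  simp only [Finset.sum_pair hab, h0, h0', add_zero, zero_add]

/-- With three distinct modes, only the choice of the third index matters. The factor 2 counts the
two orders of the first two indices. -/
lemma sum_cube_triple (f : ι → ι → ι → R) {a b c : ι} (hab : a ≠ b) (hac : a ≠ c) (hbc : b ≠ c)
    (hs : ∀ x y z, f x y z = f y x z) (h0 : ∀ y z, f z y z = 0) :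
    ∑ x ∈ {a, b, c}, ∑ y ∈ {a, b, c}, ∑ z ∈ {a, b, c}, f x y z
      = (f a a b + f b b a) + (f a a c + f c c a) + (f b b c + f c c b)
        + 2 * (f a b c + f a c b + f b c a) := by
  have h0' : ∀ y z, f y z z = 0 := fun y z => (hs y z z).trans (h0 y z)
  have e : ∀ g : ι → R, ∑ x ∈ {a, b, c}, g x = g a + g b + g c := fun g => by
    rw [Finset.sum_insert (by simp [hab, hac]), Finset.sum_pair hbc, add_assoc]
  simp only [e, h0, h0', hs b a, hs c a, hs c b]
  ring

lemma sum_four {a b c e : ι} (hab : a ≠ b) (hac : a ≠ c) (hae : a ≠ e) (hbc : b ≠ c)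
    (hbe : b ≠ e) (hce : c ≠ e) (g : ι → R) :
    ∑ x ∈ {a, b, c, e}, g x = g a + g b + g c + g e := by
  rw [Finset.sum_insert (by simp [hab, hac, hae]), Finset.sum_insert (by simp [hbc, hbe]),
    Finset.sum_pair hce]
  ring

lemma sum_three {a b c : ι} (hab : a ≠ b) (hac : a ≠ c) (hbc : b ≠ c) (g : ι → R) :
    ∑ x ∈ {a, b, c}, g x = g a + g b + g c := by
  rw [Finset.sum_insert (by simp [hab, hac]), Finset.sum_pair hbc, add_assoc]

lemma sum_cube_quadruple (f : ι → ι → ι → R) {a b c e : ι} (hab : a ≠ b) (hac : a ≠ c)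
    (hae : a ≠ e) (hbc : b ≠ c) (hbe : b ≠ e) (hce : c ≠ e)
    (hs : ∀ x y z, f x y z = f y x z) (h0 : ∀ y z, f z y z = 0) :
    ∑ x ∈ {a, b, c, e}, ∑ y ∈ {a, b, c, e}, ∑ z ∈ {a, b, c, e}, f x y z
      = (f a a b + f b b a) + (f a a c + f c c a) + (f a a e + f e e a) + (f b b c + f c c b)
        + (f b b e + f e e b) + (f c c e + f e e c)
        + 2 * (f a b c + f a c b + f b c a) + 2 * (f a b e + f a e b + f b e a)
        + 2 * (f a c e + f a e c + f c e a) + 2 * (f b c e + f b e c + f c e b) := by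
  have h0' : ∀ y z, f y z z = 0 := fun y z => (hs y z z).trans (h0 y z)
  simp only [sum_four hab hac hae hbc hbe hce, h0, h0', hs b a, hs c a, hs c b, hs e a, hs e b,
    hs e c]
  ring

/-- The sum of `g` over the quadruples of elements of `T`. -/
def quadSum (g : ι → ι → ι → ι → R) (T : Finset ι) : R :=
  ∑ x ∈ T, ∑ y ∈ T, ∑ z ∈ T, ∑ w ∈ T, g x y z w

/-- The sum of `g` over all orderings of four elements. -/
def permSum₄ (g : ι → ι → ι → ι → R) (a b c e : ι) : R :=
  g a b c e + g a b e c + g a c b e + g a c e b + g a e b c + g a e c b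
  + (g b a c e + g b a e c + g b c a e + g b c e a + g b e a c + g b e c a)
  + (g c a b e + g c a e b + g c b a e + g c b e a + g c e a b + g c e b a)
  + (g e a b c + g e a c b + g e b a c + g e b c a + g e c a b + g e c b a)

/-- Inclusion-exclusion over the subsets of four modes retains the quadruples in which each mode
occurs, and these are the orderings. -/
lemma quadSum_exact₄ (g : ι → ι → ι → ι → R) {a b c e : ι} (hab : a ≠ b) (hac : a ≠ c)
    (hae : a ≠ e) (hbc : b ≠ c) (hbe : b ≠ e) (hce : c ≠ e) :
    quadSum g {a, b, c, e}
      - (quadSum g {a, b, c} + quadSum g {a, b, e} + quadSum g {a, c, e} + quadSum g {b, c, e})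
      + (quadSum g {a, b} + quadSum g {a, c} + quadSum g {a, e} + quadSum g {b, c}
        + quadSum g {b, e} + quadSum g {c, e})
      - (quadSum g {a} + quadSum g {b} + quadSum g {c} + quadSum g {e})
      = permSum₄ g a b c e := by
  simp only [quadSum, permSum₄, sum_four hab hac hae hbc hbe hce, sum_three hab hac hbc,
    sum_three hab hae hbe, sum_three hac hae hce, sum_three hbc hbe hce, Finset.sum_pair hab,
    Finset.sum_pair hac, Finset.sum_pair hae, Finset.sum_pair hbc, Finset.sum_pair hbe,
    Finset.sum_pair hce, Finset.sum_singleton]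
  abel

/-- The last index differs from the other three, so one of the two remaining modes is doubled among
the first three positions. The factor 3 counts the positions of the single one. -/
lemma quadSum_exact₃_of_symm (g : ι → ι → ι → ι → R) {a b c : ι} (hab : a ≠ b) (hac : a ≠ c)
    (hbc : b ≠ c) (h₁ : ∀ x y z w, g x y z w = g y x z w) (h₂ : ∀ x y z w, g x y z w = g x z y w)
    (h₀ : ∀ x y w, g w x y w = 0) :
    quadSum g {a, b, c} - (quadSum g {a, b} + quadSum g {a, c} + quadSum g {b, c})
      + (quadSum g {a} + quadSum g {b} + quadSum g {c})
      = 3 * (g a a b c + g b b a c + g a a c b + g c c a b + g b b c a + g c c b a) := by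
  have h₀' : ∀ x y w, g x w y w = 0 := fun x y w => (h₁ _ _ _ _).trans (h₀ _ _ _)
  have h₀'' : ∀ x y w, g x y w w = 0 := fun x y w => (h₂ _ _ _ _).trans (h₀' _ _ _)
  have k₁ : ∀ x y w, g x y x w = g x x y w := fun x y w => h₂ _ _ _ _
  have k₂ : ∀ x y w, g y x x w = g x x y w := fun x y w => (h₁ _ _ _ _).trans (k₁ _ _ _)
  simp only [quadSum, sum_three hab hac hbc, Finset.sum_pair hab,
    Finset.sum_pair hac, Finset.sum_pair hbc, Finset.sum_singleton, h₀, h₀', h₀'', k₁ a b, k₁ b a,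
    k₁ a c, k₁ c a, k₁ b c, k₁ c b, k₂ a b, k₂ b a, k₂ a c, k₂ c a, k₂ b c, k₂ c b]
  ring

lemma quadSum_exact₂_of_symm (g : ι → ι → ι → ι → R) {a b : ι} (hab : a ≠ b)
    (h₁ : ∀ x y z w, g x y z w = g y x z w) (h₂ : ∀ x y z w, g x y z w = g x z y w)
    (h₀ : ∀ x y w, g w x y w = 0) :
    quadSum g {a, b} - (quadSum g {a} + quadSum g {b}) = g a a a b + g b b b a := by
  have h₀' : ∀ x y w, g x w y w = 0 := fun x y w => (h₁ _ _ _ _).trans (h₀ _ _ _)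
  have h₀'' : ∀ x y w, g x y w w = 0 := fun x y w => (h₂ _ _ _ _).trans (h₀' _ _ _)
  simp only [quadSum, Finset.sum_pair hab, Finset.sum_singleton, h₀, h₀', h₀'']
  ring

/-- With three distinct modes in the pattern (x y | z w), the repeated mode cannot stand on both
sides, since it would cancel and force the other two to coincide. So it fills one side. The factor 4
comes from the two sides and the two orders on the other side. -/
lemma quadSum_exact₃_of_flip (g : ι → ι → ι → ι → R) {a b c : ι} (hab : a ≠ b) (hac : a ≠ c)
    (hbc : b ≠ c) (h₁ : ∀ x y z w, g x y z w = g y x z w)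
    (h₂ : ∀ x y z w, g x y z w = g z w x y) (h₃ : ∀ x y w, y ≠ w → g x y x w = 0)
    (h₄ : ∀ x y, x ≠ y → g x x y y = 0) :
    quadSum g {a, b, c} - (quadSum g {a, b} + quadSum g {a, c} + quadSum g {b, c})
      + (quadSum g {a} + quadSum g {b} + quadSum g {c})
      = 4 * (g a a b c + g b b a c + g c c a b) := by
  have h₁' : ∀ x y z w, g x y z w = g x y w z := fun x y z w => by rw [h₂, h₁, h₂]
  have h₃' : ∀ x y w, y ≠ w → g y x x w = 0 := fun x y w h => by rw [h₁, h₃ _ _ _ h]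
  have h₃'' : ∀ x y w, y ≠ w → g x y w x = 0 := fun x y w h => by rw [h₁', h₃ _ _ _ h]
  have h₃₃ : ∀ x y w, y ≠ w → g y x w x = 0 := fun x y w h => by rw [h₁, h₃'' _ _ _ h]
  have k : ∀ x y z, g x x z y = g x x y z := fun x y z => (h₁' _ _ _ _)
  have l : ∀ x y z, g y z x x = g x x y z := fun x y z => (h₂ _ _ _ _)
  simp only [quadSum, sum_three hab hac hbc, Finset.sum_pair hab,
    Finset.sum_pair hac, Finset.sum_pair hbc, Finset.sum_singleton, h₃ _ _ _ hab, h₃ _ _ _ hab.symm,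
    h₃ _ _ _ hac, h₃ _ _ _ hac.symm, h₃ _ _ _ hbc, h₃ _ _ _ hbc.symm,
    h₃' _ _ _ hab, h₃' _ _ _ hab.symm,
    h₃' _ _ _ hac, h₃' _ _ _ hac.symm, h₃' _ _ _ hbc, h₃' _ _ _ hbc.symm,
    h₃'' _ _ _ hab, h₃'' _ _ _ hab.symm,
    h₃'' _ _ _ hac, h₃'' _ _ _ hac.symm, h₃'' _ _ _ hbc, h₃'' _ _ _ hbc.symm,
    h₃₃ _ _ _ hab, h₃₃ _ _ _ hab.symm,
    h₃₃ _ _ _ hac, h₃₃ _ _ _ hac.symm, h₃₃ _ _ _ hbc, h₃₃ _ _ _ hbc.symm,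
    h₄ _ _ hab, h₄ _ _ hab.symm, h₄ _ _ hac, h₄ _ _ hac.symm, h₄ _ _ hbc, h₄ _ _ hbc.symm,
    k a b c, k b a c, k c a b, l a b c, l a c b, l b a c, l b c a, l c a b, l c b a]
  ring

/-- Both sides must contain each of the two modes once; there are two orders on either side. -/
lemma quadSum_exact₂_of_flip (g : ι → ι → ι → ι → R) {a b : ι} (hab : a ≠ b)
    (h₁ : ∀ x y z w, g x y z w = g y x z w)
    (h₂ : ∀ x y z w, g x y z w = g z w x y) (h₃ : ∀ x y w, y ≠ w → g x y x w = 0)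
    (h₄ : ∀ x y, x ≠ y → g x x y y = 0) :
    quadSum g {a, b} - (quadSum g {a} + quadSum g {b}) = 4 * g a b a b := by
  have h₁' : ∀ x y z w, g x y z w = g x y w z := fun x y z w => by rw [h₂, h₁, h₂]
  have h₃' : ∀ x y w, y ≠ w → g y x x w = 0 := fun x y w h => by rw [h₁, h₃ _ _ _ h]
  have h₃'' : ∀ x y w, y ≠ w → g x y w x = 0 := fun x y w h => by rw [h₁', h₃ _ _ _ h]
  simp only [quadSum, Finset.sum_pair hab, Finset.sum_singleton, h₃ _ _ _ hab, h₃ _ _ _ hab.symm,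
    h₃' _ _ _ hab, h₃' _ _ _ hab.symm, h₃'' _ _ _ hab, h₃'' _ _ _ hab.symm,
    h₄ _ _ hab, h₄ _ _ hab.symm, h₁ b a, h₁' a b b a]
  ring

end Sums

end FourierModes

end

noncomputable section

namespace FourierModes

open MvPolynomial

/-! ### The couplings as polynomials in the modes, and their parts that involve all of a given set
of modes. -/

section Couplings

variable {ι : Type*} (b : ι → ι → ι → ℂ) (q r : ι → ι → ι → ι → ℂ)

/-- The real part (times two) of the cubic monomial `α_x α_y conj α_z`. -/
def mon₃ (x y z : ι) : MvPolynomial (ι × Bool) ℂ := up x * up y * dn z + dn x * dn y * up z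

/-- The real part (times two) of the quartic monomial `α_x α_y α_z conj α_w`. -/
def mon₃₁ (x y z w : ι) : MvPolynomial (ι × Bool) ℂ :=
  up x * up y * up z * dn w + dn x * dn y * dn z * up w

/-- The real part (times two) of the quartic monomial `α_x α_y conj α_z conj α_w`. -/
def mon₂₂ (x y z w : ι) : MvPolynomial (ι × Bool) ℂ :=
  up x * up y * (dn z * dn w) + dn x * dn y * (up z * up w)

/-- A summand of the cubic coupling. -/
def cubicTerm (x y z : ι) : MvPolynomial (ι × Bool) ℂ := C (b x y z / 2) * mon₃ x y z

/-- A summand of the quartic coupling. -/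
def quarticTerm₃₁ (x y z w : ι) : MvPolynomial (ι × Bool) ℂ := C (q x y z w / 6) * mon₃₁ x y z w

/-- A summand of the quartic coupling. -/
def quarticTerm₂₂ (x y z w : ι) : MvPolynomial (ι × Bool) ℂ := C (r x y z w / 8) * mon₂₂ x y z w

/-- The cubic coupling of the modes in `T`. -/
def cubic (T : Finset ι) : MvPolynomial (ι × Bool) ℂ :=
  ∑ x ∈ T, ∑ y ∈ T, ∑ z ∈ T, cubicTerm b x y z

/-- The quartic coupling of the modes in `T`. -/
def quartic (T : Finset ι) : MvPolynomial (ι × Bool) ℂ :=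
  quadSum (quarticTerm₃₁ q) T + quadSum (quarticTerm₂₂ r) T

/-- The second order of the exponential of the couplings. -/
def secondOrder (T : Finset ι) : MvPolynomial (ι × Bool) ℂ :=
  quartic q r T + C (1 / 2) * cubic b T ^ 2

lemma mon₃_swap (x y z : ι) : mon₃ x y z = mon₃ y x z := by simp only [mon₃]; ring

variable {b q r} (hb : IsModeCoupling b q r)

include hb

lemma cubicTerm_swap (x y z : ι) : cubicTerm b x y z = cubicTerm b y x z := by
  rw [cubicTerm, cubicTerm, hb.b_swap, mon₃_swap]

lemma cubicTerm_self (y z : ι) : cubicTerm b z y z = 0 := by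
  rw [cubicTerm, hb.b_self]; simp

-- Carries the exclusions of `IsModeCoupling` over to the polynomials.
omit hb in
lemma cubicTerm_mul_eq_zero {x y z u v w : ι} (h : b x y z * b u v w = 0) :
    cubicTerm b x y z * cubicTerm b u v w = 0 := by
  have : (C (b x y z / 2) * C (b u v w / 2) : MvPolynomial (ι × Bool) ℂ) = 0 := by
    rw [← C_mul, div_mul_div_comm, h]; simp
  rw [cubicTerm, cubicTerm, mul_mul_mul_comm, this, zero_mul]

lemma quarticTerm₃₁_swap (x y z w : ι) : quarticTerm₃₁ q x y z w = quarticTerm₃₁ q y x z w := by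
  rw [quarticTerm₃₁, quarticTerm₃₁, hb.q_swap]; simp only [mon₃₁]; ring

lemma quarticTerm₃₁_swap' (x y z w : ι) : quarticTerm₃₁ q x y z w = quarticTerm₃₁ q x z y w := by
  rw [quarticTerm₃₁, quarticTerm₃₁, hb.q_swap']; simp only [mon₃₁]; ring

lemma quarticTerm₃₁_self (x y w : ι) : quarticTerm₃₁ q w x y w = 0 := by
  rw [quarticTerm₃₁, hb.q_self]; simp

lemma quarticTerm₂₂_swap (x y z w : ι) : quarticTerm₂₂ r x y z w = quarticTerm₂₂ r y x z w := by
  rw [quarticTerm₂₂, quarticTerm₂₂, hb.r_swap]; simp only [mon₂₂]; ring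

lemma quarticTerm₂₂_flip (x y z w : ι) : quarticTerm₂₂ r x y z w = quarticTerm₂₂ r z w x y := by
  rw [quarticTerm₂₂, quarticTerm₂₂, hb.r_flip]; simp only [mon₂₂]; ring

lemma quarticTerm₂₂_cancel (x y w : ι) (h : y ≠ w) : quarticTerm₂₂ r x y x w = 0 := by
  rw [quarticTerm₂₂, hb.r_cancel _ _ _ h]; simp

lemma quarticTerm₂₂_sq (x y : ι) (h : x ≠ y) : quarticTerm₂₂ r x x y y = 0 := by
  rw [quarticTerm₂₂, hb.r_sq _ _ h]; simp

variable [DecidableEq ι]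

omit [DecidableEq ι] in
lemma cubic_singleton (a : ι) : cubic b {a} = 0 := by
  simp [cubic, cubicTerm_self hb]

lemma cubic_pair {x y : ι} (hxy : x ≠ y) :
    cubic b {x, y} = cubicTerm b x x y + cubicTerm b y y x :=
  sum_cube_pair _ hxy (cubicTerm_swap hb) (cubicTerm_self hb)

/-- The part of the quartic coupling which involves both of two modes. -/
lemma quartic_exact₂ {a c : ι} (hac : a ≠ c) :
    quartic q r {a, c} - (quartic q r {a} + quartic q r {c})
      = quarticTerm₃₁ q a a a c + quarticTerm₃₁ q c c c a + 4 * quarticTerm₂₂ r a c a c := by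
  have h₁ := quadSum_exact₂_of_symm (quarticTerm₃₁ q) hac (quarticTerm₃₁_swap hb)
    (quarticTerm₃₁_swap' hb) (quarticTerm₃₁_self hb)
  have h₂ := quadSum_exact₂_of_flip (quarticTerm₂₂ r) hac (quarticTerm₂₂_swap hb)
    (quarticTerm₂₂_flip hb) (quarticTerm₂₂_cancel hb) (quarticTerm₂₂_sq hb)
  simp only [quartic]
  linear_combination h₁ + h₂

/-- In the square of the cubic coupling the mixed product drops out, because each of the two modes
would be the double of the other. -/
lemma secondOrder_exact₂ {a c : ι} (hac : a ≠ c) :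
    secondOrder b q r {a, c} - (secondOrder b q r {a} + secondOrder b q r {c})
      = quarticTerm₃₁ q a a a c + quarticTerm₃₁ q c c c a + 4 * quarticTerm₂₂ r a c a c
        + C (1 / 2) * (cubicTerm b a a c ^ 2 + cubicTerm b c c a ^ 2) := by
  have h := quartic_exact₂ hb hac
  have h0 : cubicTerm b a a c * cubicTerm b c c a = 0 :=
    cubicTerm_mul_eq_zero (hb.b_opp a c a c)
  simp only [secondOrder, cubic_singleton hb, cubic_pair hb hac]
  linear_combination h + 2 * C (1 / 2) * h0

/-- The part of the quartic coupling which involves all of three modes. -/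
lemma quartic_exact₃ {a c e : ι} (hac : a ≠ c) (hae : a ≠ e) (hce : c ≠ e) :
    quartic q r {a, c, e} - (quartic q r {a, c} + quartic q r {a, e} + quartic q r {c, e})
      + (quartic q r {a} + quartic q r {c} + quartic q r {e})
      = 3 * (quarticTerm₃₁ q a a c e + quarticTerm₃₁ q c c a e + quarticTerm₃₁ q a a e c
          + quarticTerm₃₁ q e e a c + quarticTerm₃₁ q c c e a + quarticTerm₃₁ q e e c a)
        + 4 * (quarticTerm₂₂ r a a c e + quarticTerm₂₂ r c c a e + quarticTerm₂₂ r e e a c) := by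
  have h₁ := quadSum_exact₃_of_symm (quarticTerm₃₁ q) hac hae hce (quarticTerm₃₁_swap hb)
    (quarticTerm₃₁_swap' hb) (quarticTerm₃₁_self hb)
  have h₂ := quadSum_exact₃_of_flip (quarticTerm₂₂ r) hac hae hce (quarticTerm₂₂_swap hb)
    (quarticTerm₂₂_flip hb) (quarticTerm₂₂_cancel hb) (quarticTerm₂₂_sq hb)
  simp only [quartic]
  linear_combination h₁ + h₂

/-- The sum of `g` over all orderings of three elements. -/
def permSum₃ {R : Type*} [CommRing R] (g : ι → ι → ι → R) (a b c : ι) : R :=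
  g a b c + g a c b + (g b a c + g b c a) + (g c a b + g c b a)

lemma cubic_triple {a c e : ι} (hac : a ≠ c) (hae : a ≠ e) (hce : c ≠ e) :
    cubic b {a, c, e} - (cubic b {a, c} + cubic b {c, e} + cubic b {a, e})
      = permSum₃ (cubicTerm b) a c e := by
  rw [cubic_pair hb hac, cubic_pair hb hae, cubic_pair hb hce, permSum₃, cubicTerm_swap hb c a,
    cubicTerm_swap hb e a, cubicTerm_swap hb e c, cubic,
    sum_cube_triple _ hac hae hce (cubicTerm_swap hb) (cubicTerm_self hb)]
  ring

/-- The square of the cubic coupling leaves three kinds of products that involve all three modes: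
the square of a relation x + y = z, the chain 2x = y, 2y = z, and the pair 2x = y, x + y = z. In all
other products the two relations identify distinct modes or make a sum of modes vanish. -/
lemma secondOrder_exact₃ {a c e : ι} (hac : a ≠ c) (hae : a ≠ e) (hce : c ≠ e) :
    secondOrder b q r {a, c, e}
      - (secondOrder b q r {a, c} + secondOrder b q r {a, e} + secondOrder b q r {c, e})
      + (secondOrder b q r {a} + secondOrder b q r {c} + secondOrder b q r {e})
      = permSum₃ (fun x y z => 3 * quarticTerm₃₁ q x x y z + 2 * quarticTerm₂₂ r x x y z
        + cubicTerm b x y z ^ 2 + cubicTerm b x x y * cubicTerm b y y z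
        + 2 * (cubicTerm b x x y * cubicTerm b x y z)) a c e := by
  have h := quartic_exact₃ hb hac hae hce
  have hC : (C (1 / 2) : MvPolynomial (ι × Bool) ℂ) * 2 = 1 := by
    rw [← map_ofNat (C : ℂ →+* MvPolynomial (ι × Bool) ℂ), ← C_mul]; norm_num
  have hC4 : (C (1 / 2) : MvPolynomial (ι × Bool) ℂ) * 4 = 2 := by linear_combination 2 * hC
  have k₁ := quarticTerm₂₂_swap hb
  have k₂ := quarticTerm₂₂_flip hb
  have k : ∀ x y z, quarticTerm₂₂ r x x z y = quarticTerm₂₂ r x x y z := fun x y z => by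
    rw [k₂, k₁, k₂]
  have sw := cubicTerm_swap hb
  -- products of couplings that exclude each other
  have p₁ : ∀ x y z, x ≠ y → cubicTerm b x x z * cubicTerm b y y z = 0 := fun x y z h =>
    cubicTerm_mul_eq_zero (hb.b_half x y z h)
  have p₂ : ∀ x y z, y ≠ z → cubicTerm b x x y * cubicTerm b x x z = 0 := fun x y z h =>
    cubicTerm_mul_eq_zero (hb.b_same x x y z h)
  have p₃ : ∀ x y z, x ≠ z → cubicTerm b x x y * cubicTerm b x z y = 0 := fun x y z h =>
    cubicTerm_mul_eq_zero (hb.b_same' x y x z h)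
  have p₄ : ∀ x y z, cubicTerm b x x y * cubicTerm b y z x = 0 := fun x y z =>
    cubicTerm_mul_eq_zero (hb.b_opp x y x z)
  have p₅ : ∀ x y z, cubicTerm b x y z * cubicTerm b z y x = 0 := fun x y z =>
    cubicTerm_mul_eq_zero (hb.b_opp x z y y)
  have t := cubic_triple hb hac hae hce
  have t' : cubic b {a, c, e} = (cubic b {a, c} + cubic b {c, e} + cubic b {a, e})
      + 2 * (cubicTerm b a c e + cubicTerm b a e c + cubicTerm b c e a) := by
    rw [permSum₃, sw c a e, sw e a c, sw e c a] at t
    linear_combination t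
  simp only [secondOrder, cubic_singleton hb, t', cubic_pair hb hac, cubic_pair hb hae,
    cubic_pair hb hce]
  simp only [permSum₃]
  rw [k a c e, k c a e, k e a c, sw c a e, sw e a c, sw e c a]
  have q₃ := p₃ c a e hce
  have q₃' := p₃ e a c hce.symm
  have q₃'' := p₃ e c a hae.symm
  have q₄ := p₄ a c e
  have q₄' := p₄ a e c
  have q₄'' := p₄ c e a
  have r₄'' := p₄ e c a
  have q₅ := p₅ a c e
  have q₆ := p₃ c e a hac.symm
  have q₅' := p₅ c a e
  have q₅'' := p₅ a e c
  rw [sw e c a] at q₃' q₄' q₅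
  rw [sw e a c] at q₃'' q₄'' q₅'
  rw [sw c a e] at r₄'' q₅' q₆
  -- A relation between three modes enters the cubic coupling with a factor 2, a doubling with a
  -- factor 1. So mixed terms of the square carry 2 (two doublings), 4 (a doubling and a triple) or
  -- 8 (two triples). The products with `C (1 / 2)` are the vanishing ones; `hC` normalizes the
  -- survivors.
  linear_combination h + C (1 / 2) * (2 * (p₂ a c e hce + p₁ c e a hce + p₁ a e c hae + p₂ c a e hae
      + p₁ a c e hac + p₂ e a c hac)
    + 4 * (p₃ a c e hae + q₄ + p₄ c a e + q₃ + p₃ a e c hac + q₄' + p₄ e a c + q₃'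
      + q₆ + q₄'' + r₄'' + q₃'')
    + 8 * (q₅ + q₅' + q₅''))
    + hC * (cubicTerm b e e a * cubicTerm b a a c + cubicTerm b c c a * cubicTerm b a a e
      + cubicTerm b a a c * cubicTerm b c c e + cubicTerm b e e c * cubicTerm b c c a
      + cubicTerm b a a e * cubicTerm b e e c + cubicTerm b c c e * cubicTerm b e e a
      + 2 * (cubicTerm b a a c * cubicTerm b a c e + cubicTerm b c c a * cubicTerm b a c e
        + cubicTerm b a a e * cubicTerm b a e c + cubicTerm b e e a * cubicTerm b a e c
        + cubicTerm b c c e * cubicTerm b c e a + cubicTerm b e e c * cubicTerm b c e a)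
      + 2 * (cubicTerm b a c e ^ 2 + cubicTerm b a e c ^ 2 + cubicTerm b c e a ^ 2))

-- Each letter is named after the modes that it involves. Inclusion-exclusion keeps exactly the
-- products whose factors together involve all four.
omit hb [DecidableEq ι] in
lemma sq_exact₄ {R : Type*} [CommRing R] (ab ac ae bc be ce abc abe ace bce : R) :
    (ab + ac + ae + bc + be + ce + abc + abe + ace + bce) ^ 2
      - ((ab + ac + bc + abc) ^ 2 + (ab + ae + be + abe) ^ 2 + (ac + ae + ce + ace) ^ 2
        + (bc + be + ce + bce) ^ 2)
      + (ab ^ 2 + ac ^ 2 + ae ^ 2 + bc ^ 2 + be ^ 2 + ce ^ 2)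
      = 2 * (ab * ce + ac * be + ae * bc
        + ab * ace + ac * abe + ae * abc + ab * bce + bc * abe + be * abc
        + ac * bce + bc * ace + ce * abc + ae * bce + be * ace + ce * abe
        + abc * abe + abc * ace + abc * bce + abe * ace + abe * bce + ace * bce) := by
  ring

/-- The terms of second order in the cubic couplings which involve four modes. -/
def cubicSq₄ (b : ι → ι → ι → ℂ) (x y z w : ι) : MvPolynomial (ι × Bool) ℂ :=
  2 * (cubicTerm b x x z * cubicTerm b x w y) + cubicTerm b x x w * cubicTerm b y z x
    + 2 * (cubicTerm b x x w * cubicTerm b y w z) + cubicTerm b x x w * cubicTerm b y z w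
    + 4 * (cubicTerm b x y w * cubicTerm b x w z)

-- Two triples that share x and y. Of the nine products five vanish: equal sums x + y, equal
-- differences of x and y (two of these), and two opposed pairs such as x + u = y, y + v = x.
omit [DecidableEq ι] in
lemma cubic_mul_of_overlap_two {x y u v : ι} (huv : u ≠ v) :
    2 * (cubicTerm b x y u + cubicTerm b x u y + cubicTerm b y u x) *
      (2 * (cubicTerm b x y v + cubicTerm b x v y + cubicTerm b y v x))
      = 4 * (cubicTerm b x u y * cubicTerm b x y v + cubicTerm b x v y * cubicTerm b x y u
        + cubicTerm b y u x * cubicTerm b y x v + cubicTerm b y v x * cubicTerm b y x u) := by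
  have z₁ := cubicTerm_mul_eq_zero (hb.b_same x y u v huv)
  have z₂ := cubicTerm_mul_eq_zero (hb.b_same' x y u v huv)
  have z₃ := cubicTerm_mul_eq_zero (hb.b_same' y x u v huv)
  have z₄ := cubicTerm_mul_eq_zero (hb.b_opp x y u v)
  have z₅ := cubicTerm_mul_eq_zero (hb.b_opp y x u v)
  rw [cubicTerm_swap hb y x v, cubicTerm_swap hb y x u]
  linear_combination 4 * (z₁ + z₂ + z₃ + z₄ + z₅)

lemma cubic_quadruple {a c e g : ι} (hac : a ≠ c) (hae : a ≠ e) (hag : a ≠ g) (hce : c ≠ e)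
    (hcg : c ≠ g) (heg : e ≠ g) :
    cubic b {a, c, e, g} = cubic b {a, c} + cubic b {a, e} + cubic b {a, g} + cubic b {c, e}
      + cubic b {c, g} + cubic b {e, g}
      + 2 * (cubicTerm b a c e + cubicTerm b a e c + cubicTerm b c e a)
      + 2 * (cubicTerm b a c g + cubicTerm b a g c + cubicTerm b c g a)
      + 2 * (cubicTerm b a e g + cubicTerm b a g e + cubicTerm b e g a)
      + 2 * (cubicTerm b c e g + cubicTerm b c g e + cubicTerm b e g c) := by
  rw [cubic_pair hb hac, cubic_pair hb hae, cubic_pair hb hce, cubic_pair hb hag,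
    cubic_pair hb hcg, cubic_pair hb heg, cubic,
    sum_cube_quadruple _ hac hae hag hce hcg heg (cubicTerm_swap hb) (cubicTerm_self hb)]

lemma cubic_triple' {a c e : ι} (hac : a ≠ c) (hae : a ≠ e) (hce : c ≠ e) :
    cubic b {a, c, e} = cubic b {a, c} + cubic b {a, e} + cubic b {c, e}
      + 2 * (cubicTerm b a c e + cubicTerm b a e c + cubicTerm b c e a) := by
  rw [cubic_pair hb hac, cubic_pair hb hae, cubic_pair hb hce, cubic,
    sum_cube_triple _ hac hae hce (cubicTerm_swap hb) (cubicTerm_self hb)]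

/-- A product of two cubic terms involves all four modes in three ways. A doubling and a triple
sharing one mode give the first four terms of `cubicSq₄`, according to the role of the shared mode
in either relation. Two triples sharing two modes give the last one. Two doublings on disjoint pairs
are kept apart, because they are what R₂R₂ and C₂C₂ subtract. -/
lemma secondOrder_exact₄ {a c e g : ι} (hac : a ≠ c) (hae : a ≠ e) (hag : a ≠ g) (hce : c ≠ e)
    (hcg : c ≠ g) (heg : e ≠ g) :
    secondOrder b q r {a, c, e, g}
      - (secondOrder b q r {a, c, e} + secondOrder b q r {a, c, g} + secondOrder b q r {a, e, g}
        + secondOrder b q r {c, e, g})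
      + (secondOrder b q r {a, c} + secondOrder b q r {a, e} + secondOrder b q r {a, g}
        + secondOrder b q r {c, e} + secondOrder b q r {c, g} + secondOrder b q r {e, g})
      - (secondOrder b q r {a} + secondOrder b q r {c} + secondOrder b q r {e}
        + secondOrder b q r {g})
      = permSum₄ (fun x y z w => quarticTerm₃₁ q x y z w + quarticTerm₂₂ r x y z w
          + cubicSq₄ b x y z w) a c e g
        + (cubic b {a, c} * cubic b {e, g} + cubic b {a, e} * cubic b {c, g}
          + cubic b {a, g} * cubic b {c, e}) := by
  have hC : (C (1 / 2) : MvPolynomial (ι × Bool) ℂ) * 2 = 1 := by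
    rw [← map_ofNat (C : ℂ →+* MvPolynomial (ι × Bool) ℂ), ← C_mul]; norm_num
  have h₁ := quadSum_exact₄ (quarticTerm₃₁ q) hac hae hag hce hcg heg
  have h₂ := quadSum_exact₄ (quarticTerm₂₂ r) hac hae hag hce hcg heg
  have h₃ := sq_exact₄ (cubic b {a, c}) (cubic b {a, e}) (cubic b {a, g}) (cubic b {c, e})
    (cubic b {c, g}) (cubic b {e, g})
    (2 * (cubicTerm b a c e + cubicTerm b a e c + cubicTerm b c e a))
    (2 * (cubicTerm b a c g + cubicTerm b a g c + cubicTerm b c g a))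
    (2 * (cubicTerm b a e g + cubicTerm b a g e + cubicTerm b e g a))
    (2 * (cubicTerm b c e g + cubicTerm b c g e + cubicTerm b e g c))
  have sw := cubicTerm_swap hb
  have e₁ := cubic_mul_of_overlap_two hb (x := a) (y := c) heg
  have e₂ := cubic_mul_of_overlap_two hb (x := a) (y := e) hcg
  have e₃ := cubic_mul_of_overlap_two hb (x := c) (y := e) hag
  have e₄ := cubic_mul_of_overlap_two hb (x := a) (y := g) hce
  have e₅ := cubic_mul_of_overlap_two hb (x := c) (y := g) hae
  have e₆ := cubic_mul_of_overlap_two hb (x := e) (y := g) hac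
  have h₄ : ∀ A B : MvPolynomial (ι × Bool) ℂ, A = 2 * B → C (1 / 2) * A = B := fun A B h => by
    rw [h, ← mul_assoc, hC, one_mul]
  have h₅ := h₄ _ _ h₃
  -- The sums of abstract letters in `sq_exact₄` are folded back into the cubic couplings of the
  -- subsets.
  rw [← cubic_quadruple hb hac hae hag hce hcg heg, ← cubic_triple' hb hac hae hce,
    ← cubic_triple' hb hac hag hcg, ← cubic_triple' hb hae hag heg,
    ← cubic_triple' hb hce hcg heg] at h₅
  have key : permSum₄ (cubicSq₄ b) a c e g = C (1 / 2) *
      (cubic b {a, c, e, g} ^ 2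
        - (cubic b {a, c, e} ^ 2 + cubic b {a, c, g} ^ 2 + cubic b {a, e, g} ^ 2
          + cubic b {c, e, g} ^ 2)
        + (cubic b {a, c} ^ 2 + cubic b {a, e} ^ 2 + cubic b {a, g} ^ 2 + cubic b {c, e} ^ 2
          + cubic b {c, g} ^ 2 + cubic b {e, g} ^ 2))
      - (cubic b {a, c} * cubic b {e, g} + cubic b {a, e} * cubic b {c, g}
          + cubic b {a, g} * cubic b {c, e}) := by
    rw [h₅]
    simp only [cubic_pair hb hac, cubic_pair hb hae, cubic_pair hb hag, cubic_pair hb hce,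
      cubic_pair hb hcg, cubic_pair hb heg, permSum₄, cubicSq₄]
    rw [sw c a e, sw e a c, sw e c a, sw c a g, sw g a c, sw g c a,
      sw e a g, sw g a e, sw g e a, sw e c g, sw g c e, sw g e c] at *
    linear_combination - (e₁ + e₂ + e₃ + e₄ + e₅ + e₆)
  have key' : permSum₄ (fun x y z w => quarticTerm₃₁ q x y z w + quarticTerm₂₂ r x y z w
      + cubicSq₄ b x y z w) a c e g = permSum₄ (quarticTerm₃₁ q) a c e g
        + permSum₄ (quarticTerm₂₂ r) a c e g + permSum₄ (cubicSq₄ b) a c e g := by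
    simp only [permSum₄]; ring
  rw [key', key, ← h₁, ← h₂]
  simp only [secondOrder, quartic, cubic_singleton hb]
  ring

end Couplings

end FourierModes

end

/-! ### Sums over orderings, and the Wick functional on the monomials that occur. -/

noncomputable section

namespace FourierModes

open MvPolynomial

lemma sum_perm_three {ι R : Type*} [CommRing R] (g : ι → ι → ι → R) (m : Fin 3 → ι) :
    ∑ σ : Equiv.Perm (Fin 3), g (m (σ 0)) (m (σ 1)) (m (σ 2)) = permSum₃ g (m 0) (m 1) (m 2) := by
  have h : (Finset.univ : Finset (Equiv.Perm (Fin 3))).val.map (fun σ => (σ 0, σ 1, σ 2))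
      = {(0, 1, 2), (0, 2, 1), (1, 0, 2), (1, 2, 0), (2, 0, 1), (2, 1, 0)} := by decide
  have h' := congrArg (fun s => (s.map fun t : Fin 3 × Fin 3 × Fin 3 =>
    g (m t.1) (m t.2.1) (m t.2.2)).sum) h
  simp only [Multiset.map_map, Function.comp_def, Multiset.insert_eq_cons, Multiset.map_cons,
    Multiset.map_singleton, Multiset.sum_cons, Multiset.sum_singleton] at h'
  rw [Finset.sum, h', permSum₃]
  ring

lemma sum_perm_four {ι R : Type*} [CommRing R] (g : ι → ι → ι → ι → R) (m : Fin 4 → ι) :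
    ∑ σ : Equiv.Perm (Fin 4), g (m (σ 0)) (m (σ 1)) (m (σ 2)) (m (σ 3)) = permSum₄ g (m 0) (m 1) (m 2) (m 3) := by
  have h : (Finset.univ : Finset (Equiv.Perm (Fin 4))).val.map (fun σ => (σ 0, σ 1, σ 2, σ 3))
      = {(0, 1, 2, 3), (0, 1, 3, 2), (0, 2, 1, 3), (0, 2, 3, 1), (0, 3, 1, 2), (0, 3, 2, 1),
        (1, 0, 2, 3), (1, 0, 3, 2), (1, 2, 0, 3), (1, 2, 3, 0), (1, 3, 0, 2), (1, 3, 2, 0),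
        (2, 0, 1, 3), (2, 0, 3, 1), (2, 1, 0, 3), (2, 1, 3, 0), (2, 3, 0, 1), (2, 3, 1, 0),
        (3, 0, 1, 2), (3, 0, 2, 1), (3, 1, 0, 2), (3, 1, 2, 0), (3, 2, 0, 1), (3, 2, 1, 0)} := by
    decide +kernel
  have h' := congrArg (fun s => (s.map fun t : Fin 4 × Fin 4 × Fin 4 × Fin 4 =>
    g (m t.1) (m t.2.1) (m t.2.2.1) (m t.2.2.2)).sum) h
  simp only [Multiset.map_map, Function.comp_def, Multiset.insert_eq_cons, Multiset.map_cons,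
    Multiset.map_singleton, Multiset.sum_cons, Multiset.sum_singleton] at h'
  rw [Finset.sum, h', permSum₄]
  ring

section Evaluation

variable {ι : Type*} [Fintype ι] [DecidableEq ι] {φ : ι → ℕ → ℕ → ℂ} (hφ : ∀ i, φ i 0 0 = 1)

include hφ

/-- As in the lemmas that follow, the product is expanded and each monomial is brought to the normal
form of `wick_pow₂`, `wick_pow₃` or `wick_pow₄`. -/
lemma wick_mon₃_pair {a b : ι} (hab : a ≠ b) :
    wick φ (mon₃ a a b) =
      φ a 2 0 * φ b 0 1
      + φ a 0 2 * φ b 1 0 := by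
  have h : mon₃ a a b =
      up a ^ 2 * dn a ^ 0 * (up b ^ 0 * dn b ^ 1)
      + up a ^ 0 * dn a ^ 2 * (up b ^ 1 * dn b ^ 0) := by
    simp only [mon₃]; ring
  rw [h]
  simp only [map_add, wick_pow₂ hφ hab]

lemma wick_mon₃_pair_sq {a b : ι} (hab : a ≠ b) :
    wick φ (mon₃ a a b * mon₃ a a b) =
      φ a 4 0 * φ b 0 2
      + φ a 2 2 * φ b 1 1
      + φ a 2 2 * φ b 1 1
      + φ a 0 4 * φ b 2 0 := by
  have h : mon₃ a a b * mon₃ a a b =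
      up a ^ 4 * dn a ^ 0 * (up b ^ 0 * dn b ^ 2)
      + up a ^ 2 * dn a ^ 2 * (up b ^ 1 * dn b ^ 1)
      + up a ^ 2 * dn a ^ 2 * (up b ^ 1 * dn b ^ 1)
      + up a ^ 0 * dn a ^ 4 * (up b ^ 2 * dn b ^ 0) := by
    simp only [mon₃]; ring
  rw [h]
  simp only [map_add, wick_pow₂ hφ hab]

lemma wick_mon₃₁_pair {a b : ι} (hab : a ≠ b) :
    wick φ (mon₃₁ a a a b) =
      φ a 3 0 * φ b 0 1
      + φ a 0 3 * φ b 1 0 := by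
  have h : mon₃₁ a a a b =
      up a ^ 3 * dn a ^ 0 * (up b ^ 0 * dn b ^ 1)
      + up a ^ 0 * dn a ^ 3 * (up b ^ 1 * dn b ^ 0) := by
    simp only [mon₃₁]; ring
  rw [h]
  simp only [map_add, wick_pow₂ hφ hab]

lemma wick_mon₂₂_pair {a b : ι} (hab : a ≠ b) :
    wick φ (mon₂₂ a b a b) =
      φ a 1 1 * φ b 1 1
      + φ a 1 1 * φ b 1 1 := by
  have h : mon₂₂ a b a b =
      up a ^ 1 * dn a ^ 1 * (up b ^ 1 * dn b ^ 1)
      + up a ^ 1 * dn a ^ 1 * (up b ^ 1 * dn b ^ 1) := by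
    simp only [mon₂₂]; ring
  rw [h]
  simp only [map_add, wick_pow₂ hφ hab]

lemma wick_mon₃_triple {a b c : ι} (hab : a ≠ b) (hac : a ≠ c) (hbc : b ≠ c) :
    wick φ (mon₃ a b c) =
      φ a 1 0 * φ b 1 0 * φ c 0 1
      + φ a 0 1 * φ b 0 1 * φ c 1 0 := by
  have h : mon₃ a b c =
      up a ^ 1 * dn a ^ 0 * (up b ^ 1 * dn b ^ 0) * (up c ^ 0 * dn c ^ 1)
      + up a ^ 0 * dn a ^ 1 * (up b ^ 0 * dn b ^ 1) * (up c ^ 1 * dn c ^ 0) := by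
    simp only [mon₃]; ring
  rw [h]
  simp only [map_add, wick_pow₃ hφ hab hac hbc]

lemma wick_mon₃₁_triple {a b c : ι} (hab : a ≠ b) (hac : a ≠ c) (hbc : b ≠ c) :
    wick φ (mon₃₁ a a b c) =
      φ a 2 0 * φ b 1 0 * φ c 0 1
      + φ a 0 2 * φ b 0 1 * φ c 1 0 := by
  have h : mon₃₁ a a b c =
      up a ^ 2 * dn a ^ 0 * (up b ^ 1 * dn b ^ 0) * (up c ^ 0 * dn c ^ 1)
      + up a ^ 0 * dn a ^ 2 * (up b ^ 0 * dn b ^ 1) * (up c ^ 1 * dn c ^ 0) := by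
    simp only [mon₃₁]; ring
  rw [h]
  simp only [map_add, wick_pow₃ hφ hab hac hbc]

lemma wick_mon₂₂_triple {a b c : ι} (hab : a ≠ b) (hac : a ≠ c) (hbc : b ≠ c) :
    wick φ (mon₂₂ a a b c) =
      φ a 2 0 * φ b 0 1 * φ c 0 1
      + φ a 0 2 * φ b 1 0 * φ c 1 0 := by
  have h : mon₂₂ a a b c =
      up a ^ 2 * dn a ^ 0 * (up b ^ 0 * dn b ^ 1) * (up c ^ 0 * dn c ^ 1)
      + up a ^ 0 * dn a ^ 2 * (up b ^ 1 * dn b ^ 0) * (up c ^ 1 * dn c ^ 0) := by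
    simp only [mon₂₂]; ring
  rw [h]
  simp only [map_add, wick_pow₃ hφ hab hac hbc]

lemma wick_mon₃_triple_sq {a b c : ι} (hab : a ≠ b) (hac : a ≠ c) (hbc : b ≠ c) :
    wick φ (mon₃ a b c * mon₃ a b c) =
      φ a 2 0 * φ b 2 0 * φ c 0 2
      + φ a 1 1 * φ b 1 1 * φ c 1 1
      + φ a 1 1 * φ b 1 1 * φ c 1 1
      + φ a 0 2 * φ b 0 2 * φ c 2 0 := by
  have h : mon₃ a b c * mon₃ a b c =
      up a ^ 2 * dn a ^ 0 * (up b ^ 2 * dn b ^ 0) * (up c ^ 0 * dn c ^ 2)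
      + up a ^ 1 * dn a ^ 1 * (up b ^ 1 * dn b ^ 1) * (up c ^ 1 * dn c ^ 1)
      + up a ^ 1 * dn a ^ 1 * (up b ^ 1 * dn b ^ 1) * (up c ^ 1 * dn c ^ 1)
      + up a ^ 0 * dn a ^ 2 * (up b ^ 0 * dn b ^ 2) * (up c ^ 2 * dn c ^ 0) := by
    simp only [mon₃]; ring
  rw [h]
  simp only [map_add, wick_pow₃ hφ hab hac hbc]

lemma wick_mon₃_double_double {a b c : ι} (hab : a ≠ b) (hac : a ≠ c) (hbc : b ≠ c) :
    wick φ (mon₃ a a b * mon₃ b b c) =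
      φ a 2 0 * φ b 2 1 * φ c 0 1
      + φ a 2 0 * φ b 0 3 * φ c 1 0
      + φ a 0 2 * φ b 3 0 * φ c 0 1
      + φ a 0 2 * φ b 1 2 * φ c 1 0 := by
  have h : mon₃ a a b * mon₃ b b c =
      up a ^ 2 * dn a ^ 0 * (up b ^ 2 * dn b ^ 1) * (up c ^ 0 * dn c ^ 1)
      + up a ^ 2 * dn a ^ 0 * (up b ^ 0 * dn b ^ 3) * (up c ^ 1 * dn c ^ 0)
      + up a ^ 0 * dn a ^ 2 * (up b ^ 3 * dn b ^ 0) * (up c ^ 0 * dn c ^ 1)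
      + up a ^ 0 * dn a ^ 2 * (up b ^ 1 * dn b ^ 2) * (up c ^ 1 * dn c ^ 0) := by
    simp only [mon₃]; ring
  rw [h]
  simp only [map_add, wick_pow₃ hφ hab hac hbc]

lemma wick_mon₃_double_sum {a b c : ι} (hab : a ≠ b) (hac : a ≠ c) (hbc : b ≠ c) :
    wick φ (mon₃ a a b * mon₃ a b c) =
      φ a 3 0 * φ b 1 1 * φ c 0 1
      + φ a 2 1 * φ b 0 2 * φ c 1 0
      + φ a 1 2 * φ b 2 0 * φ c 0 1
      + φ a 0 3 * φ b 1 1 * φ c 1 0 := by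
  have h : mon₃ a a b * mon₃ a b c =
      up a ^ 3 * dn a ^ 0 * (up b ^ 1 * dn b ^ 1) * (up c ^ 0 * dn c ^ 1)
      + up a ^ 2 * dn a ^ 1 * (up b ^ 0 * dn b ^ 2) * (up c ^ 1 * dn c ^ 0)
      + up a ^ 1 * dn a ^ 2 * (up b ^ 2 * dn b ^ 0) * (up c ^ 0 * dn c ^ 1)
      + up a ^ 0 * dn a ^ 3 * (up b ^ 1 * dn b ^ 1) * (up c ^ 1 * dn c ^ 0) := by
    simp only [mon₃]; ring
  rw [h]
  simp only [map_add, wick_pow₃ hφ hab hac hbc]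

lemma wick_mon₃₁_four {a b c e : ι} (hab : a ≠ b) (hac : a ≠ c) (hae : a ≠ e)
    (hbc : b ≠ c) (hbe : b ≠ e) (hce : c ≠ e) :
    wick φ (mon₃₁ a b c e) =
      φ a 1 0 * φ b 1 0 * φ c 1 0 * φ e 0 1
      + φ a 0 1 * φ b 0 1 * φ c 0 1 * φ e 1 0 := by
  have h : mon₃₁ a b c e =
      up a ^ 1 * dn a ^ 0 * (up b ^ 1 * dn b ^ 0) * (up c ^ 1 * dn c ^ 0) * (up e ^ 0 * dn e ^ 1)
      + up a ^ 0 * dn a ^ 1 * (up b ^ 0 * dn b ^ 1) * (up c ^ 0 * dn c ^ 1) * (up e ^ 1 * dn e ^ 0) := by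
    simp only [mon₃₁]; ring
  rw [h]
  simp only [map_add, wick_pow₄ hφ hab hac hae hbc hbe hce]

lemma wick_mon₂₂_four {a b c e : ι} (hab : a ≠ b) (hac : a ≠ c) (hae : a ≠ e)
    (hbc : b ≠ c) (hbe : b ≠ e) (hce : c ≠ e) :
    wick φ (mon₂₂ a b c e) =
      φ a 1 0 * φ b 1 0 * φ c 0 1 * φ e 0 1
      + φ a 0 1 * φ b 0 1 * φ c 1 0 * φ e 1 0 := by
  have h : mon₂₂ a b c e =
      up a ^ 1 * dn a ^ 0 * (up b ^ 1 * dn b ^ 0) * (up c ^ 0 * dn c ^ 1) * (up e ^ 0 * dn e ^ 1)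
      + up a ^ 0 * dn a ^ 1 * (up b ^ 0 * dn b ^ 1) * (up c ^ 1 * dn c ^ 0) * (up e ^ 1 * dn e ^ 0) := by
    simp only [mon₂₂]; ring
  rw [h]
  simp only [map_add, wick_pow₄ hφ hab hac hae hbc hbe hce]

lemma wick_mon₃_four₃ {a b c e : ι} (hab : a ≠ b) (hac : a ≠ c) (hae : a ≠ e)
    (hbc : b ≠ c) (hbe : b ≠ e) (hce : c ≠ e) :
    wick φ (mon₃ a a c * mon₃ a e b) =
      φ a 3 0 * φ b 0 1 * φ c 0 1 * φ e 1 0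
      + φ a 2 1 * φ b 1 0 * φ c 0 1 * φ e 0 1
      + φ a 1 2 * φ b 0 1 * φ c 1 0 * φ e 1 0
      + φ a 0 3 * φ b 1 0 * φ c 1 0 * φ e 0 1 := by
  have h : mon₃ a a c * mon₃ a e b =
      up a ^ 3 * dn a ^ 0 * (up b ^ 0 * dn b ^ 1) * (up c ^ 0 * dn c ^ 1) * (up e ^ 1 * dn e ^ 0)
      + up a ^ 2 * dn a ^ 1 * (up b ^ 1 * dn b ^ 0) * (up c ^ 0 * dn c ^ 1) * (up e ^ 0 * dn e ^ 1)
      + up a ^ 1 * dn a ^ 2 * (up b ^ 0 * dn b ^ 1) * (up c ^ 1 * dn c ^ 0) * (up e ^ 1 * dn e ^ 0)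
      + up a ^ 0 * dn a ^ 3 * (up b ^ 1 * dn b ^ 0) * (up c ^ 1 * dn c ^ 0) * (up e ^ 0 * dn e ^ 1) := by
    simp only [mon₃]; ring
  rw [h]
  simp only [map_add, wick_pow₄ hφ hab hac hae hbc hbe hce]

lemma wick_mon₃_four₄ {a b c e : ι} (hab : a ≠ b) (hac : a ≠ c) (hae : a ≠ e)
    (hbc : b ≠ c) (hbe : b ≠ e) (hce : c ≠ e) :
    wick φ (mon₃ a a e * mon₃ b c a) =
      φ a 2 1 * φ b 1 0 * φ c 1 0 * φ e 0 1
      + φ a 3 0 * φ b 0 1 * φ c 0 1 * φ e 0 1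
      + φ a 0 3 * φ b 1 0 * φ c 1 0 * φ e 1 0
      + φ a 1 2 * φ b 0 1 * φ c 0 1 * φ e 1 0 := by
  have h : mon₃ a a e * mon₃ b c a =
      up a ^ 2 * dn a ^ 1 * (up b ^ 1 * dn b ^ 0) * (up c ^ 1 * dn c ^ 0) * (up e ^ 0 * dn e ^ 1)
      + up a ^ 3 * dn a ^ 0 * (up b ^ 0 * dn b ^ 1) * (up c ^ 0 * dn c ^ 1) * (up e ^ 0 * dn e ^ 1)
      + up a ^ 0 * dn a ^ 3 * (up b ^ 1 * dn b ^ 0) * (up c ^ 1 * dn c ^ 0) * (up e ^ 1 * dn e ^ 0)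
      + up a ^ 1 * dn a ^ 2 * (up b ^ 0 * dn b ^ 1) * (up c ^ 0 * dn c ^ 1) * (up e ^ 1 * dn e ^ 0) := by
    simp only [mon₃]; ring
  rw [h]
  simp only [map_add, wick_pow₄ hφ hab hac hae hbc hbe hce]

lemma wick_mon₃_four₅ {a b c e : ι} (hab : a ≠ b) (hac : a ≠ c) (hae : a ≠ e)
    (hbc : b ≠ c) (hbe : b ≠ e) (hce : c ≠ e) :
    wick φ (mon₃ a a e * mon₃ b e c) =
      φ a 2 0 * φ b 1 0 * φ c 0 1 * φ e 1 1
      + φ a 2 0 * φ b 0 1 * φ c 1 0 * φ e 0 2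
      + φ a 0 2 * φ b 1 0 * φ c 0 1 * φ e 2 0
      + φ a 0 2 * φ b 0 1 * φ c 1 0 * φ e 1 1 := by
  have h : mon₃ a a e * mon₃ b e c =
      up a ^ 2 * dn a ^ 0 * (up b ^ 1 * dn b ^ 0) * (up c ^ 0 * dn c ^ 1) * (up e ^ 1 * dn e ^ 1)
      + up a ^ 2 * dn a ^ 0 * (up b ^ 0 * dn b ^ 1) * (up c ^ 1 * dn c ^ 0) * (up e ^ 0 * dn e ^ 2)
      + up a ^ 0 * dn a ^ 2 * (up b ^ 1 * dn b ^ 0) * (up c ^ 0 * dn c ^ 1) * (up e ^ 2 * dn e ^ 0)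
      + up a ^ 0 * dn a ^ 2 * (up b ^ 0 * dn b ^ 1) * (up c ^ 1 * dn c ^ 0) * (up e ^ 1 * dn e ^ 1) := by
    simp only [mon₃]; ring
  rw [h]
  simp only [map_add, wick_pow₄ hφ hab hac hae hbc hbe hce]

lemma wick_mon₃_four₆ {a b c e : ι} (hab : a ≠ b) (hac : a ≠ c) (hae : a ≠ e)
    (hbc : b ≠ c) (hbe : b ≠ e) (hce : c ≠ e) :
    wick φ (mon₃ a a e * mon₃ b c e) =
      φ a 2 0 * φ b 1 0 * φ c 1 0 * φ e 0 2
      + φ a 2 0 * φ b 0 1 * φ c 0 1 * φ e 1 1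
      + φ a 0 2 * φ b 1 0 * φ c 1 0 * φ e 1 1
      + φ a 0 2 * φ b 0 1 * φ c 0 1 * φ e 2 0 := by
  have h : mon₃ a a e * mon₃ b c e =
      up a ^ 2 * dn a ^ 0 * (up b ^ 1 * dn b ^ 0) * (up c ^ 1 * dn c ^ 0) * (up e ^ 0 * dn e ^ 2)
      + up a ^ 2 * dn a ^ 0 * (up b ^ 0 * dn b ^ 1) * (up c ^ 0 * dn c ^ 1) * (up e ^ 1 * dn e ^ 1)
      + up a ^ 0 * dn a ^ 2 * (up b ^ 1 * dn b ^ 0) * (up c ^ 1 * dn c ^ 0) * (up e ^ 1 * dn e ^ 1)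
      + up a ^ 0 * dn a ^ 2 * (up b ^ 0 * dn b ^ 1) * (up c ^ 0 * dn c ^ 1) * (up e ^ 2 * dn e ^ 0) := by
    simp only [mon₃]; ring
  rw [h]
  simp only [map_add, wick_pow₄ hφ hab hac hae hbc hbe hce]

lemma wick_mon₃_four₇ {a b c e : ι} (hab : a ≠ b) (hac : a ≠ c) (hae : a ≠ e)
    (hbc : b ≠ c) (hbe : b ≠ e) (hce : c ≠ e) :
    wick φ (mon₃ a b e * mon₃ a e c) =
      φ a 2 0 * φ b 1 0 * φ c 0 1 * φ e 1 1
      + φ a 1 1 * φ b 1 0 * φ c 1 0 * φ e 0 2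
      + φ a 1 1 * φ b 0 1 * φ c 0 1 * φ e 2 0
      + φ a 0 2 * φ b 0 1 * φ c 1 0 * φ e 1 1 := by
  have h : mon₃ a b e * mon₃ a e c =
      up a ^ 2 * dn a ^ 0 * (up b ^ 1 * dn b ^ 0) * (up c ^ 0 * dn c ^ 1) * (up e ^ 1 * dn e ^ 1)
      + up a ^ 1 * dn a ^ 1 * (up b ^ 1 * dn b ^ 0) * (up c ^ 1 * dn c ^ 0) * (up e ^ 0 * dn e ^ 2)
      + up a ^ 1 * dn a ^ 1 * (up b ^ 0 * dn b ^ 1) * (up c ^ 0 * dn c ^ 1) * (up e ^ 2 * dn e ^ 0)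
      + up a ^ 0 * dn a ^ 2 * (up b ^ 0 * dn b ^ 1) * (up c ^ 1 * dn c ^ 0) * (up e ^ 1 * dn e ^ 1) := by
    simp only [mon₃]; ring
  rw [h]
  simp only [map_add, wick_pow₄ hφ hab hac hae hbc hbe hce]

lemma wick_mon₃_four_disjoint {a b c e : ι} (hab : a ≠ b) (hac : a ≠ c) (hae : a ≠ e)
    (hbc : b ≠ c) (hbe : b ≠ e) (hce : c ≠ e) :
    wick φ (mon₃ a a b * mon₃ c c e) =
      φ a 2 0 * φ b 0 1 * φ c 2 0 * φ e 0 1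
      + φ a 2 0 * φ b 0 1 * φ c 0 2 * φ e 1 0
      + φ a 0 2 * φ b 1 0 * φ c 2 0 * φ e 0 1
      + φ a 0 2 * φ b 1 0 * φ c 0 2 * φ e 1 0 := by
  have h : mon₃ a a b * mon₃ c c e =
      up a ^ 2 * dn a ^ 0 * (up b ^ 0 * dn b ^ 1) * (up c ^ 2 * dn c ^ 0) * (up e ^ 0 * dn e ^ 1)
      + up a ^ 2 * dn a ^ 0 * (up b ^ 0 * dn b ^ 1) * (up c ^ 0 * dn c ^ 2) * (up e ^ 1 * dn e ^ 0)
      + up a ^ 0 * dn a ^ 2 * (up b ^ 1 * dn b ^ 0) * (up c ^ 2 * dn c ^ 0) * (up e ^ 0 * dn e ^ 1)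
      + up a ^ 0 * dn a ^ 2 * (up b ^ 1 * dn b ^ 0) * (up c ^ 0 * dn c ^ 2) * (up e ^ 1 * dn e ^ 0) := by
    simp only [mon₃]; ring
  rw [h]
  simp only [map_add, wick_pow₄ hφ hab hac hae hbc hbe hce]

end Evaluation

/-! ### Contributions of ordered triples and quadruples of modes. -/

section Exact

variable {ι : Type*} [Fintype ι] [DecidableEq ι] {b : ι → ι → ι → ℂ} {q r : ι → ι → ι → ι → ℂ}
  (φ : ι → ℕ → ℕ → ℂ)

omit [DecidableEq ι] in
lemma wick_cubicTerm (x y z : ι) :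
    wick φ (cubicTerm b x y z) = b x y z / 2 * wick φ (mon₃ x y z) := wick_C_mul _ _ _

omit [DecidableEq ι] in
lemma wick_cubicTerm_mul (x y z u v w : ι) :
    wick φ (cubicTerm b x y z * cubicTerm b u v w)
      = b x y z * b u v w / 4 * wick φ (mon₃ x y z * mon₃ u v w) := by
  rw [cubicTerm, cubicTerm, mul_mul_mul_comm, ← C_mul, wick_C_mul]
  ring

omit [DecidableEq ι] in
lemma wick_quarticTerm₃₁ (x y z w : ι) :
    wick φ (quarticTerm₃₁ q x y z w) = q x y z w / 6 * wick φ (mon₃₁ x y z w) := wick_C_mul _ _ _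

omit [DecidableEq ι] in
lemma wick_quarticTerm₂₂ (x y z w : ι) :
    wick φ (quarticTerm₂₂ r x y z w) = r x y z w / 8 * wick φ (mon₂₂ x y z w) := wick_C_mul _ _ _

omit [DecidableEq ι] in
lemma wick_ofNat_mul (n : ℕ) [n.AtLeastTwo] (p : MvPolynomial (ι × Bool) ℂ) :
    wick φ (ofNat(n) * p) = ofNat(n) * wick φ p := by
  rw [← map_ofNat (C : ℂ →+* MvPolynomial (ι × Bool) ℂ), wick_C_mul]

variable (b q r) in
/-- The contribution of second order of an ordered triple of modes. -/
def orderedTerm₃ (x y z : ι) : ℂ :=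
  q x x y z / 2 * wick φ (mon₃₁ x x y z) + r x x y z / 4 * wick φ (mon₂₂ x x y z)
  + b x y z ^ 2 / 4 * wick φ (mon₃ x y z * mon₃ x y z)
  + b x x y * b y y z / 4 * wick φ (mon₃ x x y * mon₃ y y z)
  + b x x y * b x y z / 2 * wick φ (mon₃ x x y * mon₃ x y z)

variable (b q r) in
/-- The contribution of second order of an ordered quadruple of modes. -/
def orderedTerm₄ (x y z w : ι) : ℂ :=
  q x y z w / 6 * wick φ (mon₃₁ x y z w) + r x y z w / 8 * wick φ (mon₂₂ x y z w)
  + b x x z * b x w y / 2 * wick φ (mon₃ x x z * mon₃ x w y)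
  + b x x w * b y z x / 4 * wick φ (mon₃ x x w * mon₃ y z x)
  + b x x w * b y w z / 2 * wick φ (mon₃ x x w * mon₃ y w z)
  + b x x w * b y z w / 4 * wick φ (mon₃ x x w * mon₃ y z w)
  + b x y w * b x w z * wick φ (mon₃ x y w * mon₃ x w z)

omit [DecidableEq ι] in
lemma wick_permSum₄ (g : ι → ι → ι → ι → MvPolynomial (ι × Bool) ℂ) (x y z w : ι) :
    wick φ (permSum₄ g x y z w) = permSum₄ (fun x y z w => wick φ (g x y z w)) x y z w := by
  simp only [permSum₄, map_add]

variable (hb : IsModeCoupling b q r)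

include hb

omit [DecidableEq ι] in
lemma wick_cubic_singleton (a : ι) : wick φ (cubic b {a}) = 0 := by
  rw [cubic_singleton hb, map_zero]

lemma wick_cubic_pair {x y : ι} (hxy : x ≠ y) :
    wick φ (cubic b {x, y})
      = b x x y / 2 * wick φ (mon₃ x x y) + b y y x / 2 * wick φ (mon₃ y y x) := by
  rw [cubic_pair hb hxy, map_add, wick_cubicTerm, wick_cubicTerm]

lemma wick_cubic_exact₃ {m : Fin 3 → ι} (hm : Function.Injective m) :
    wick φ (cubic b {m 0, m 1, m 2}) - (wick φ (cubic b {m 0, m 1}) + wick φ (cubic b {m 1, m 2})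
        + wick φ (cubic b {m 0, m 2}))
      = ∑ σ : Equiv.Perm (Fin 3),
          b (m (σ 0)) (m (σ 1)) (m (σ 2)) / 2 * wick φ (mon₃ (m (σ 0)) (m (σ 1)) (m (σ 2))) := by
  have h := congrArg (wick φ) (cubic_triple hb (hm.ne (show (0 : Fin 3) ≠ 1 by decide))
    (hm.ne (show (0 : Fin 3) ≠ 2 by decide)) (hm.ne (show (1 : Fin 3) ≠ 2 by decide)))
  rw [sum_perm_three (fun x y z => b x y z / 2 * wick φ (mon₃ x y z))]
  simpa only [permSum₃, map_add, map_sub, wick_cubicTerm] using h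

/-- A cubic term involves at most three modes, so four modes have no genuine correlation of first
order. -/
lemma wick_cubic_exact₄ {m : Fin 4 → ι} (hm : Function.Injective m) :
    wick φ (cubic b {m 0, m 1, m 2, m 3})
      - (wick φ (cubic b {m 0, m 1, m 2}) + wick φ (cubic b {m 0, m 1, m 3})
        + wick φ (cubic b {m 0, m 2, m 3}) + wick φ (cubic b {m 1, m 2, m 3}))
      + (wick φ (cubic b {m 0, m 1}) + wick φ (cubic b {m 0, m 2}) + wick φ (cubic b {m 0, m 3})
        + wick φ (cubic b {m 1, m 2}) + wick φ (cubic b {m 1, m 3}) + wick φ (cubic b {m 2, m 3}))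
      = 0 := by
  have h01 := hm.ne (show (0 : Fin 4) ≠ 1 by decide)
  have h02 := hm.ne (show (0 : Fin 4) ≠ 2 by decide)
  have h03 := hm.ne (show (0 : Fin 4) ≠ 3 by decide)
  have h12 := hm.ne (show (1 : Fin 4) ≠ 2 by decide)
  have h13 := hm.ne (show (1 : Fin 4) ≠ 3 by decide)
  have h23 := hm.ne (show (2 : Fin 4) ≠ 3 by decide)
  simp only [cubic_quadruple hb h01 h02 h03 h12 h13 h23, cubic_triple' hb h01 h02 h12,
    cubic_triple' hb h01 h03 h13, cubic_triple' hb h02 h03 h23, cubic_triple' hb h12 h13 h23,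
    map_add]
  ring

lemma wick_secondOrder_exact₂ {a c : ι} (hac : a ≠ c) :
    wick φ (secondOrder b q r {a, c})
      - (wick φ (secondOrder b q r {a}) + wick φ (secondOrder b q r {c}))
      = b a a c ^ 2 / 8 * wick φ (mon₃ a a c * mon₃ a a c)
        + b c c a ^ 2 / 8 * wick φ (mon₃ c c a * mon₃ c c a)
        + (q a a a c / 6 * wick φ (mon₃₁ a a a c) + q c c c a / 6 * wick φ (mon₃₁ c c c a))
        + r a c a c / 2 * wick φ (mon₂₂ a c a c) := by
  have h := congrArg (wick φ) (secondOrder_exact₂ hb hac)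
  simp only [map_add, map_sub, wick_C_mul, wick_ofNat_mul, wick_quarticTerm₃₁, pow_two,
    wick_quarticTerm₂₂, wick_cubicTerm_mul] at h
  linear_combination h

lemma wick_secondOrder_exact₃ {m : Fin 3 → ι} (hm : Function.Injective m) :
    wick φ (secondOrder b q r {m 0, m 1, m 2})
      - (wick φ (secondOrder b q r {m 0, m 1}) + wick φ (secondOrder b q r {m 0, m 2})
        + wick φ (secondOrder b q r {m 1, m 2}))
      + (wick φ (secondOrder b q r {m 0}) + wick φ (secondOrder b q r {m 1})
        + wick φ (secondOrder b q r {m 2}))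
      = ∑ σ : Equiv.Perm (Fin 3), orderedTerm₃ b q r φ (m (σ 0)) (m (σ 1)) (m (σ 2)) := by
  have h := congrArg (wick φ) (secondOrder_exact₃ hb (hm.ne (show (0 : Fin 3) ≠ 1 by decide))
    (hm.ne (show (0 : Fin 3) ≠ 2 by decide)) (hm.ne (show (1 : Fin 3) ≠ 2 by decide)))
  rw [sum_perm_three]
  simp only [permSum₃, orderedTerm₃, map_add, map_sub, wick_ofNat_mul, wick_quarticTerm₃₁, pow_two,
    wick_quarticTerm₂₂, wick_cubicTerm_mul] at h ⊢
  linear_combination h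

-- The functional is multiplicative on factors that involve disjoint sets of modes; here this is
-- read off from the four products of doublings. It makes the disjoint pairs cancel against the
-- products R₂R₂ and C₂C₂.
variable {φ} in
lemma wick_cubic_mul_cubic (hφ : ∀ i, φ i 0 0 = 1) {a c e g : ι} (hac : a ≠ c) (hae : a ≠ e)
    (hag : a ≠ g) (hce : c ≠ e) (hcg : c ≠ g) (heg : e ≠ g) :
    wick φ (cubic b {a, c} * cubic b {e, g})
      = wick φ (cubic b {a, c}) * wick φ (cubic b {e, g}) := by
  rw [wick_cubic_pair φ hb hac, wick_cubic_pair φ hb heg, cubic_pair hb hac, cubic_pair hb heg]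
  simp only [add_mul, mul_add, map_add, wick_cubicTerm_mul]
  rw [wick_mon₃_four_disjoint hφ hac hae hag hce hcg heg,
    wick_mon₃_four_disjoint hφ hac.symm hce hcg hae hag heg,
    wick_mon₃_four_disjoint hφ hac hag hae hcg hce heg.symm,
    wick_mon₃_four_disjoint hφ hac.symm hcg hce hag hae heg.symm,
    wick_mon₃_pair hφ hac, wick_mon₃_pair hφ hac.symm, wick_mon₃_pair hφ heg,
    wick_mon₃_pair hφ heg.symm]
  ring

lemma wick_secondOrder_exact₄ (hφ : ∀ i, φ i 0 0 = 1) {m : Fin 4 → ι} (hm : Function.Injective m) :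
    wick φ (secondOrder b q r {m 0, m 1, m 2, m 3})
      - (wick φ (secondOrder b q r {m 0, m 1, m 2}) + wick φ (secondOrder b q r {m 0, m 1, m 3})
        + wick φ (secondOrder b q r {m 0, m 2, m 3}) + wick φ (secondOrder b q r {m 1, m 2, m 3}))
      + (wick φ (secondOrder b q r {m 0, m 1}) + wick φ (secondOrder b q r {m 0, m 2})
        + wick φ (secondOrder b q r {m 0, m 3}) + wick φ (secondOrder b q r {m 1, m 2})
        + wick φ (secondOrder b q r {m 1, m 3}) + wick φ (secondOrder b q r {m 2, m 3}))
      - (wick φ (secondOrder b q r {m 0}) + wick φ (secondOrder b q r {m 1})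
        + wick φ (secondOrder b q r {m 2}) + wick φ (secondOrder b q r {m 3}))
      = ∑ σ : Equiv.Perm (Fin 4), orderedTerm₄ b q r φ (m (σ 0)) (m (σ 1)) (m (σ 2)) (m (σ 3))
        + (wick φ (cubic b {m 0, m 1}) * wick φ (cubic b {m 2, m 3})
          + wick φ (cubic b {m 0, m 2}) * wick φ (cubic b {m 1, m 3})
          + wick φ (cubic b {m 0, m 3}) * wick φ (cubic b {m 1, m 2})) := by
  have h01 := hm.ne (show (0 : Fin 4) ≠ 1 by decide)
  have h02 := hm.ne (show (0 : Fin 4) ≠ 2 by decide)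
  have h03 := hm.ne (show (0 : Fin 4) ≠ 3 by decide)
  have h12 := hm.ne (show (1 : Fin 4) ≠ 2 by decide)
  have h13 := hm.ne (show (1 : Fin 4) ≠ 3 by decide)
  have h23 := hm.ne (show (2 : Fin 4) ≠ 3 by decide)
  have h := congrArg (wick φ) (secondOrder_exact₄ (q := q) (r := r) hb h01 h02 h03 h12 h13 h23)
  have hg : ∀ x y z w, wick φ (quarticTerm₃₁ q x y z w + quarticTerm₂₂ r x y z w
      + cubicSq₄ b x y z w) = orderedTerm₄ b q r φ x y z w := by
    intro x y z w
    simp only [orderedTerm₄, cubicSq₄, map_add, wick_ofNat_mul, wick_quarticTerm₃₁,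
      wick_quarticTerm₂₂, wick_cubicTerm_mul]
    ring
  rw [sum_perm_four]
  rw [map_add, map_add, map_add, wick_cubic_mul_cubic hb hφ h01 h02 h03 h12 h13 h23,
    wick_cubic_mul_cubic hb hφ h02 h01 h03 h12.symm h23 h13,
    wick_cubic_mul_cubic hb hφ h03 h01 h02 h13.symm h23.symm h12, wick_permSum₄] at h
  simp only [hg] at h
  rw [← h]
  simp only [map_add, map_sub]

end Exact

end FourierModes

end

noncomputable section

namespace FourierModes

open MeasureTheory

open scoped ComplexConjugate

/-! ## Gaussian Fourier transforms of monomials -/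

/-- The integrand of the moments of a complex Gaussian weight with linear exponent. -/
def gaussIntegrand (p q : ℕ) (u v J : ℂ) : ℂ :=
  conj J ^ p * J ^ q * Complex.exp (u * conj J + v * J - (‖J‖ : ℂ) ^ 2 / 4)

/-- The moments of a complex Gaussian weight with linear exponent. -/
def gaussMoment (p q : ℕ) (u v : ℂ) : ℂ := ∫ J : ℂ, gaussIntegrand p q u v J

lemma continuous_gaussIntegrand (p q : ℕ) (u v : ℂ) : Continuous (gaussIntegrand p q u v) := by
  unfold gaussIntegrand
  have := Complex.continuous_conj
  fun_prop

lemma integrable_exp_neg_norm_sq {b : ℝ} (hb : 0 < b) :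
    Integrable fun J : ℂ => Real.exp (-b * ‖J‖ ^ 2) := by
  have h := (GaussianFourier.integrable_cexp_neg_mul_sq_norm_add (V := ℂ) (b := (b : ℂ))
    (by simpa using hb) 0 0).norm
  refine h.congr (Filter.Eventually.of_forall fun J => ?_)
  simp only [Complex.norm_exp]
  congr 1
  simp [← Complex.ofReal_pow]

/-- The power is absorbed by e^r, and the remaining exponent is bounded by completing the square.
The bound depends on the linear exponent only through c, so it is locally uniform and can dominate
derivatives as well. -/
lemma pow_mul_exp_le (n : ℕ) {c : ℝ} {r : ℝ} (hr : 0 ≤ r) :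
    r ^ n * Real.exp (c * r - r ^ 2 / 4) ≤
      n.factorial * Real.exp (2 * (c + 1) ^ 2) * Real.exp (-(1 / 8) * r ^ 2) := by
  have h₁ : r ^ n ≤ n.factorial * Real.exp r := by
    have := Real.pow_div_factorial_le_exp r hr n
    rwa [div_le_iff₀ (by positivity), mul_comm] at this
  calc r ^ n * Real.exp (c * r - r ^ 2 / 4)
      ≤ n.factorial * Real.exp r * Real.exp (c * r - r ^ 2 / 4) := by gcongr
    _ = n.factorial * Real.exp (r + (c * r - r ^ 2 / 4)) := by rw [mul_assoc, ← Real.exp_add]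
    _ ≤ n.factorial * Real.exp (2 * (c + 1) ^ 2 + -(1 / 8) * r ^ 2) := by
        refine mul_le_mul_of_nonneg_left (Real.exp_le_exp.2 ?_) (by positivity)
        -- The difference of the two exponents is (r - 4(c + 1))²/8.
        nlinarith [sq_nonneg (r - 4 * (c + 1))]
    _ = _ := by rw [Real.exp_add, mul_assoc]

lemma norm_gaussIntegrand_le (p q : ℕ) {u v J : ℂ} {c : ℝ} (h : ‖u‖ + ‖v‖ ≤ c) :
    ‖gaussIntegrand p q u v J‖ ≤ (p + q).factorial * Real.exp (2 * (c + 1) ^ 2) *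
      Real.exp (-(1 / 8) * ‖J‖ ^ 2) := by
  refine le_trans ?_ (pow_mul_exp_le (p + q) (c := c) (norm_nonneg J))
  rw [gaussIntegrand, norm_mul, norm_mul, norm_pow, norm_pow, RCLike.norm_conj, ← pow_add,
    Complex.norm_exp]
  gcongr
  have h₁ : (u * conj J + v * J).re ≤ c * ‖J‖ := by
    refine (Complex.re_le_norm _).trans ((norm_add_le _ _).trans ?_)
    rw [norm_mul, norm_mul, RCLike.norm_conj, ← add_mul]
    gcongr
  have h₂ : ((‖J‖ : ℂ) ^ 2 / 4).re = ‖J‖ ^ 2 / 4 := by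
    rw [show (‖J‖ : ℂ) ^ 2 / 4 = ((‖J‖ ^ 2 / 4 : ℝ) : ℂ) by push_cast; rfl, Complex.ofReal_re]
  rw [Complex.sub_re, h₂]
  linarith

lemma integrable_gaussIntegrand (p q : ℕ) (u v : ℂ) : Integrable (gaussIntegrand p q u v) :=
  Integrable.mono' ((integrable_exp_neg_norm_sq (by norm_num : (0 : ℝ) < 1 / 8)).const_mul
      ((p + q).factorial * Real.exp (2 * ((‖u‖ + ‖v‖) + 1) ^ 2)))
    (continuous_gaussIntegrand p q u v).aestronglyMeasurable
    (Filter.Eventually.of_forall fun _ => norm_gaussIntegrand_le p q le_rfl)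

/-- Differentiation under the integral in u produces a factor conj J, so all moments follow from the
one with p = q = 0. The dominating function serves the unit ball about u. -/
lemma hasDerivAt_gaussMoment (p q : ℕ) (u v : ℂ) :
    HasDerivAt (fun u => gaussMoment p q u v) (gaussMoment (p + 1) q u v) u := by
  refine (hasDerivAt_integral_of_dominated_loc_of_deriv_le (Metric.ball_mem_nhds u one_pos)
    (F' := fun u J => gaussIntegrand (p + 1) q u v J)
    (bound := fun J => (p + 1 + q).factorial * Real.exp (2 * ((‖u‖ + 1 + ‖v‖) + 1) ^ 2) *
      Real.exp (-(1 / 8) * ‖J‖ ^ 2))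
    (Filter.Eventually.of_forall fun x => (continuous_gaussIntegrand p q x v).aestronglyMeasurable)
    (integrable_gaussIntegrand p q u v)
    (continuous_gaussIntegrand (p + 1) q u v).aestronglyMeasurable
    (Filter.Eventually.of_forall fun J x hx => norm_gaussIntegrand_le (p + 1) q ?_)
    ((integrable_exp_neg_norm_sq (by norm_num)).const_mul _)
    (Filter.Eventually.of_forall fun J x _ => ?_)).2
  · have : ‖x‖ ≤ ‖u‖ + 1 := by
      have h1 : ‖x - u‖ < 1 := by simpa [dist_eq_norm] using hx
      have := norm_le_norm_add_norm_sub' x u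
      linarith
    linarith
  · have h : HasDerivAt (fun x : ℂ => x * conj J + v * J - (‖J‖ : ℂ) ^ 2 / 4) (conj J) x := by
      simpa using (((hasDerivAt_id x).mul_const (conj J)).add_const (v * J)).sub_const
        ((‖J‖ : ℂ) ^ 2 / 4)
    convert! h.cexp.const_mul (conj J ^ p * J ^ q) using 1
    rw [gaussIntegrand, pow_succ]
    ring

/-- Complex conjugation preserves the measure and exchanges the roles of J and conj J. -/
lemma gaussMoment_swap (p q : ℕ) (u v : ℂ) : gaussMoment p q u v = gaussMoment q p v u := by
  have h := (Complex.conjLIE.measurePreserving).integral_comp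
    Complex.conjLIE.toHomeomorph.measurableEmbedding (gaussIntegrand p q u v)
  rw [gaussMoment, ← h, gaussMoment]
  refine integral_congr_ae (Filter.Eventually.of_forall fun J => ?_)
  simp only [gaussIntegrand, Complex.conjLIE_apply, Complex.conj_conj, RCLike.norm_conj]
  ring_nf

/-- In real coordinates J = x + iy the linear exponent is (u + v)x + i(v - u)y. The two real
Gaussian integrals give the exponent (u + v)² - (v - u)² = 4uv. -/
lemma gaussMoment_zero_zero (u v : ℂ) :
    gaussMoment 0 0 u v = 4 * Real.pi * Complex.exp (4 * u * v) := by
  have h := Complex.volume_preserving_equiv_real_prod.symm.integral_comp'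
    (gaussIntegrand 0 0 u v)
  rw [gaussMoment, ← h]
  have h' : ∀ x : ℝ × ℝ, gaussIntegrand 0 0 u v (Complex.measurableEquivRealProd.symm x)
      = Complex.exp (-(1 / 4) * (x.1 : ℂ) ^ 2 + (u + v) * x.1 + 0) *
        Complex.exp (-(1 / 4) * (x.2 : ℂ) ^ 2 + (Complex.I * (v - u)) * x.2 + 0) := by
    intro x
    have hx : Complex.measurableEquivRealProd.symm x = ⟨x.1, x.2⟩ := rfl
    have hn : ((‖(⟨x.1, x.2⟩ : ℂ)‖ : ℝ) : ℂ) ^ 2 = (x.1 : ℂ) ^ 2 + (x.2 : ℂ) ^ 2 := by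
      rw [← Complex.ofReal_pow, Complex.sq_norm, Complex.normSq_apply]
      push_cast
      ring
    have hJ : (⟨x.1, x.2⟩ : ℂ) = x.1 + x.2 * Complex.I := by
      apply Complex.ext <;> simp
    rw [hx, gaussIntegrand, hn, ← Complex.exp_add, hJ]
    simp only [map_add, map_mul, Complex.conj_ofReal, Complex.conj_I, pow_zero, one_mul]
    ring_nf
  simp_rw [h']
  rw [Measure.volume_eq_prod]
  rw [integral_prod_mul (fun x : ℝ => Complex.exp (-(1 / 4) * (x : ℂ) ^ 2 + (u + v) * x + 0))
    (fun x : ℝ => Complex.exp (-(1 / 4) * (x : ℂ) ^ 2 + (Complex.I * (v - u)) * x + 0)),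
    integral_cexp_quadratic (by norm_num), integral_cexp_quadratic (by norm_num)]
  have hpi : (Real.pi / -(-(1 / 4)) : ℂ) = ((4 * Real.pi : ℝ) : ℂ) := by push_cast; ring
  have hsq : ((4 * Real.pi : ℝ) : ℂ) ^ (1 / 2 : ℂ) * ((4 * Real.pi : ℝ) : ℂ) ^ (1 / 2 : ℂ)
      = 4 * Real.pi := by
    rw [← Complex.cpow_add _ _ (by exact_mod_cast (by positivity : (4 * Real.pi : ℝ) ≠ 0))]
    norm_num
  rw [hpi, mul_mul_mul_comm, hsq, ← Complex.exp_add]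
  congr 2
  ring_nf
  rw [Complex.I_sq]
  ring

/-- The polynomial factor of `∂_u^p ∂_v^q e^{4uv}`. -/
def expPoly : ℕ → ℕ → ℂ → ℂ → ℂ
  | 0, q, u, _ => (4 * u) ^ q
  | p + 1, q, u, v => 4 * v * expPoly p q u v + 4 * q * expPoly p (q - 1) u v

/-- The truncated `q - 1` is harmless at `q = 0` because of the factor `q`. -/
lemma hasDerivAt_expPoly (p q : ℕ) (u v : ℂ) :
    HasDerivAt (fun u => expPoly p q u v) (4 * q * expPoly p (q - 1) u v) u := by
  induction p generalizing q with
  | zero =>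
    simp only [expPoly]
    convert! ((hasDerivAt_id u).const_mul 4).pow q using 1
    simp
    ring
  | succ p ih =>
    simp only [expPoly]
    convert! ((ih q).const_mul (4 * v)).add ((ih (q - 1)).const_mul (4 * (q : ℂ))) using 1
    ring

lemma gaussMoment_pow_zero (p : ℕ) (u v : ℂ) :
    gaussMoment p 0 u v = 4 * Real.pi * Complex.exp (4 * u * v) * (4 * v) ^ p := by
  induction p generalizing u with
  | zero => rw [gaussMoment_zero_zero, pow_zero, mul_one]
  | succ p ih =>
    have h₁ := hasDerivAt_gaussMoment p 0 u v
    have h₂ : HasDerivAt (fun u => 4 * Real.pi * Complex.exp (4 * u * v) * (4 * v) ^ p)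
        (4 * Real.pi * (Complex.exp (4 * u * v) * (4 * 1 * v)) * (4 * v) ^ p) u :=
      (((((hasDerivAt_id u).const_mul 4).mul_const v).cexp).const_mul _).mul_const _
    rw [show (fun u => gaussMoment p 0 u v) = _ from funext fun u => ih u] at h₁
    rw [h₁.unique h₂]
    ring

/-- Induction on p: differentiating the formula for p in u gives the recursion of `expPoly`, and
uniqueness of the derivative identifies the two sides. The case p = 0 is the case q = 0 after
conjugation. -/
lemma gaussMoment_eq (p q : ℕ) (u v : ℂ) :
    gaussMoment p q u v = 4 * Real.pi * Complex.exp (4 * u * v) * expPoly p q u v := by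
  induction p generalizing u q with
  | zero => rw [gaussMoment_swap, gaussMoment_pow_zero, expPoly, mul_right_comm 4 v u]
  | succ p ih =>
    have h₁ := hasDerivAt_gaussMoment p q u v
    have h₂ : HasDerivAt (fun u => 4 * Real.pi * Complex.exp (4 * u * v) * expPoly p q u v)
        (4 * Real.pi * (Complex.exp (4 * u * v) * (4 * 1 * v)) * expPoly p q u v
          + 4 * Real.pi * Complex.exp (4 * u * v) * (4 * q * expPoly p (q - 1) u v)) u :=
      (((((hasDerivAt_id u).const_mul 4).mul_const v).cexp).const_mul _).mul
        (hasDerivAt_expPoly p q u v)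
    rw [show (fun u => gaussMoment p q u v) = _ from funext fun u => ih q u] at h₁
    rw [h₁.unique h₂, expPoly]
    ring

/-- The complex Hermite polynomials `e^{|z|²} (-∂_z)^p (-∂_{z̄})^q e^{-|z|²}`. -/
def complexHermite : ℕ → ℕ → ℂ → ℂ
  | 0, q, z => z ^ q
  | p + 1, q, z => conj z * complexHermite p q z - q * complexHermite p (q - 1) z

/-- At u = iz/2 and v = i conj(z)/2 a step of the recursion matches because (-i/2)·4v = conj z and
(-i/2)²·4 = -1. -/
lemma complexHermite_eq (p q : ℕ) (z : ℂ) :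
    complexHermite p q z = (-Complex.I / 2) ^ p * (-Complex.I / 2) ^ q *
      expPoly p q (Complex.I * z / 2) (Complex.I * conj z / 2) := by
  induction p generalizing q with
  | zero =>
    rw [complexHermite, expPoly, pow_zero, one_mul, ← mul_pow]
    congr 1
    ring_nf
    rw [Complex.I_sq]
    ring
  | succ p ih =>
    rw [complexHermite, expPoly, ih, ih]
    -- The second factor (-i/2) needed for the lowering term is taken from the power q, so q = 0 is
    -- treated apart.
    rcases q with _ | q
    · ring_nf
      rw [Complex.I_sq]
      simp
    · simp only [Nat.add_sub_cancel]
      have h : Complex.I ^ 2 = -1 := Complex.I_sq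
      push_cast
      simp only [pow_succ]
      linear_combination (norm := ring_nf) (conj z * (-Complex.I / 2) ^ p * (-Complex.I / 2) ^ q *
        (-Complex.I / 2) * expPoly p (q + 1) (Complex.I * z / 2) (Complex.I * conj z / 2)
        - (-Complex.I / 2) ^ p * (-Complex.I / 2) ^ q * (q + 1) *
          expPoly p q (Complex.I * z / 2) (Complex.I * conj z / 2)) * h

lemma continuous_complexHermite (p q : ℕ) : Continuous (complexHermite p q) := by
  induction p generalizing q with
  | zero => simpa only [complexHermite] using continuous_pow q
  | succ p ih =>
    simp only [complexHermite]
    have := Complex.continuous_conj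
    have h1 := ih q
    have h2 := ih (q - 1)
    fun_prop

/-- The inverse Fourier transform of a monomial times a Gaussian. -/
lemma integral_fourier_gauss (p q : ℕ) (z : ℂ) :
    ∫ J : ℂ, Complex.exp (Complex.I * ((J.re * z.re + J.im * z.im : ℝ) : ℂ)) *
        (Complex.exp (-(‖J‖ : ℂ) ^ 2 / 4) * ((-Complex.I / 2 * conj J) ^ p *
          (-Complex.I / 2 * J) ^ q))
      = 4 * Real.pi * Complex.exp (-(‖z‖ : ℂ) ^ 2) * complexHermite p q z := by
  have h : ∀ J : ℂ, Complex.exp (Complex.I * ((J.re * z.re + J.im * z.im : ℝ) : ℂ)) *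
        (Complex.exp (-(‖J‖ : ℂ) ^ 2 / 4) * ((-Complex.I / 2 * conj J) ^ p *
          (-Complex.I / 2 * J) ^ q))
      = (-Complex.I / 2) ^ p * (-Complex.I / 2) ^ q *
        gaussIntegrand p q (Complex.I * z / 2) (Complex.I * conj z / 2) J := by
    intro J
    have h₁ : Complex.I * ((J.re * z.re + J.im * z.im : ℝ) : ℂ)
        = Complex.I * z / 2 * conj J + Complex.I * conj z / 2 * J := by
      apply Complex.ext <;> simp <;> ring
    rw [gaussIntegrand, h₁, sub_eq_add_neg, Complex.exp_add _ (-_), ← neg_div, mul_pow, mul_pow]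
    ring
  simp_rw [h]
  rw [integral_const_mul, ← gaussMoment, gaussMoment_eq, complexHermite_eq]
  have h₂ : 4 * (Complex.I * z / 2) * (Complex.I * conj z / 2) = -(‖z‖ : ℂ) ^ 2 := by
    rw [← Complex.mul_conj' z]
    ring_nf
    rw [Complex.I_sq]
    ring
  rw [h₂]
  ring

/-- A factor of constant modulus times the Gaussian integrand without linear exponent. -/
lemma integrable_fourier_gauss (p q : ℕ) (z : ℂ) :
    Integrable fun J : ℂ => Complex.exp (Complex.I * ((J.re * z.re + J.im * z.im : ℝ) : ℂ)) *
        (Complex.exp (-(‖J‖ : ℂ) ^ 2 / 4) * ((-Complex.I / 2 * conj J) ^ p *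
          (-Complex.I / 2 * J) ^ q)) := by
  have h := (integrable_gaussIntegrand p q 0 0).bdd_mul
    (c := (‖-Complex.I / 2‖ ^ p * ‖-Complex.I / 2‖ ^ q))
    (f := fun J : ℂ => Complex.exp (Complex.I * ((J.re * z.re + J.im * z.im : ℝ) : ℂ)) *
      ((-Complex.I / 2) ^ p * (-Complex.I / 2) ^ q))
    (by fun_prop) (Filter.Eventually.of_forall fun J => by
      rw [norm_mul, mul_comm Complex.I, Complex.norm_exp_ofReal_mul_I, one_mul, norm_mul, norm_pow,
        norm_pow])
  refine h.congr (Filter.Eventually.of_forall fun J => ?_)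
  simp only [gaussIntegrand, zero_mul, zero_add, zero_sub, mul_pow, neg_div]
  ring

end FourierModes

end

noncomputable section

namespace FourierModes

open MeasureTheory

open scoped ComplexConjugate

/-! ## Polar integrals of the complex Hermite polynomials -/

/-- The radial part of the complex Hermite polynomials. -/
def radialHermite : ℕ → ℕ → ℝ → ℝ
  | 0, q, A => A ^ q
  | p + 1, q, A => A * radialHermite p q A - q * radialHermite p (q - 1) A

/-- The recursion is covariant under rotations. Its first term gains e^{-iθ} from conj z, and its
second term loses one factor e^{iθ}, which has the same effect. -/
lemma complexHermite_polar (p q : ℕ) (A θ : ℝ) :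
    complexHermite p q ((A : ℂ) * Complex.exp (Complex.I * (θ : ℂ))) =
      (radialHermite p q A : ℂ) *
        (Complex.exp (-(Complex.I * (θ : ℂ))) ^ p * Complex.exp (Complex.I * (θ : ℂ)) ^ q) := by
  have hc : conj ((A : ℂ) * Complex.exp (Complex.I * (θ : ℂ)))
      = A * Complex.exp (-(Complex.I * (θ : ℂ))) := by
    rw [map_mul, Complex.conj_ofReal, ← Complex.exp_conj]
    simp
  have hu : Complex.exp (-(Complex.I * (θ : ℂ))) * Complex.exp (Complex.I * (θ : ℂ)) = 1 := by
    rw [← Complex.exp_add]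
    simp
  induction p generalizing q with
  | zero => simp [complexHermite, radialHermite, mul_pow]
  | succ p ih =>
    rw [complexHermite, radialHermite, hc, ih, ih]
    rcases q with _ | q
    · simp only [Nat.cast_zero, zero_mul, sub_zero]
      push_cast
      ring
    · simp only [Nat.add_sub_cancel]
      push_cast
      linear_combination ((q + 1) * radialHermite p q A *
        Complex.exp (-(Complex.I * (θ : ℂ))) ^ p * Complex.exp (Complex.I * (θ : ℂ)) ^ q) * hu

lemma integrableOn_pow_mul_exp_neg_sq (n : ℕ) :
    IntegrableOn (fun A : ℝ => A ^ (n + 1) * Real.exp (-A ^ 2)) (Set.Ioi 0) := by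
  have h := integrableOn_rpow_mul_exp_neg_mul_sq one_pos
    (s := ((n + 1 : ℕ) : ℝ)) (lt_of_lt_of_le (by norm_num) (Nat.cast_nonneg (n + 1)))
  simpa only [Real.rpow_natCast, neg_mul, one_mul] using h

lemma integral_pow_mul_exp_neg_sq (n : ℕ) :
    ∫ A : ℝ in Set.Ioi 0, A ^ (n + 1) * Real.exp (-A ^ 2) = Real.Gamma (n / 2 + 1) / 2 := by
  have h := integral_rpow_mul_exp_neg_rpow (p := 2) (q := ((n + 1 : ℕ) : ℝ)) two_pos
    (lt_of_lt_of_le (by norm_num) (Nat.cast_nonneg (n + 1)))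
  have h' : ∀ A : ℝ, A ^ (n + 1) * Real.exp (-A ^ 2)
      = A ^ ((n + 1 : ℕ) : ℝ) * Real.exp (-A ^ (2 : ℝ)) := fun A => by
    rw [Real.rpow_natCast, Real.rpow_two]
  simp_rw [h', h]
  rw [show (((n + 1 : ℕ) : ℝ) + 1) / 2 = n / 2 + 1 by push_cast; ring]
  ring

/-- The integral of `A e^{-A²} f(A)` over the moduli. -/
def radialMean (f : ℝ → ℝ) : ℝ := ∫ A : ℝ in Set.Ioi 0, A * Real.exp (-A ^ 2) * f A

/-- Integrability with respect to `A e^{-A²} dA`. -/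
def RadialIntegrable (f : ℝ → ℝ) : Prop :=
  IntegrableOn (fun A : ℝ => A * Real.exp (-A ^ 2) * f A) (Set.Ioi 0)

lemma RadialIntegrable.sub {f g : ℝ → ℝ} (hf : RadialIntegrable f) (hg : RadialIntegrable g) :
    RadialIntegrable fun A => f A - g A := by
  refine (Integrable.sub hf hg).congr (Filter.Eventually.of_forall fun A => ?_)
  simp only [Pi.sub_apply]
  ring

lemma RadialIntegrable.const_mul {f : ℝ → ℝ} (hf : RadialIntegrable f) (c : ℝ) :
    RadialIntegrable fun A => c * f A := by
  refine (Integrable.const_mul hf c).congr (Filter.Eventually.of_forall fun A => ?_)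
  ring

lemma radialMean_sub {f g : ℝ → ℝ} (hf : RadialIntegrable f) (hg : RadialIntegrable g) :
    radialMean (fun A => f A - g A) = radialMean f - radialMean g := by
  rw [radialMean, radialMean, radialMean, ← integral_sub hf hg]
  congr 1 with A
  ring

lemma radialMean_const_mul (f : ℝ → ℝ) (c : ℝ) :
    radialMean (fun A => c * f A) = c * radialMean f := by
  rw [radialMean, radialMean, ← integral_const_mul]
  congr 1 with A
  ring

lemma radialIntegrable_pow (n : ℕ) : RadialIntegrable fun A => A ^ n := by
  refine (integrableOn_pow_mul_exp_neg_sq n).congr (Filter.Eventually.of_forall fun A => ?_)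
  ring

lemma radialMean_pow (n : ℕ) : radialMean (fun A => A ^ n) = Real.Gamma (n / 2 + 1) / 2 := by
  rw [← integral_pow_mul_exp_neg_sq, radialMean]
  congr 1 with A
  ring

lemma radialIntegrable_pow_mul_radialHermite (r p q : ℕ) :
    RadialIntegrable fun A => A ^ r * radialHermite p q A := by
  induction p generalizing q r with
  | zero => simpa only [radialHermite, ← pow_add] using radialIntegrable_pow (r + q)
  | succ p ih =>
    have h : (fun A => A ^ r * radialHermite (p + 1) q A) = fun A =>
        A ^ (r + 1) * radialHermite p q A - q * (A ^ r * radialHermite p (q - 1) A) := by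
      funext A
      rw [radialHermite]
      ring
    rw [h]
    exact (ih _ _).sub ((ih _ _).const_mul _)

lemma radialIntegrable_radialHermite (p q : ℕ) : RadialIntegrable (radialHermite p q) := by
  simpa using radialIntegrable_pow_mul_radialHermite 0 p q

/-- Orthogonality of the Hermite polynomials to constants. The additional power A^r is needed for
the induction, since a step of the recursion changes r into r + 1. For p = 1 the terms (r + 1)!/2
and (r + 1)·r!/2 cancel; for larger p both vanish by induction. -/
lemma radialMean_pow_mul_radialHermite (p r : ℕ) :
    radialMean (fun A => A ^ r * radialHermite p (p + r) A) =
      if p = 0 then (r.factorial : ℝ) / 2 else 0 := by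
  induction p generalizing r with
  | zero =>
    simp only [radialHermite, ← pow_add, zero_add, if_true]
    rw [radialMean_pow, show (((r + r : ℕ) : ℝ) / 2 + 1) = r + 1 by push_cast; ring,
      Real.Gamma_nat_eq_factorial]
  | succ p ih =>
    have h : (fun A => A ^ r * radialHermite (p + 1) (p + 1 + r) A) = fun A =>
        A ^ (r + 1) * radialHermite p (p + (r + 1)) A
          - ((p + 1 + r : ℕ) : ℝ) * (A ^ r * radialHermite p (p + r) A) := by
      funext A
      rw [radialHermite, show p + 1 + r - 1 = p + r by omega, show p + 1 + r = p + (r + 1) by omega]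
      ring
    rw [h, radialMean_sub (radialIntegrable_pow_mul_radialHermite _ _ _)
      ((radialIntegrable_pow_mul_radialHermite _ _ _).const_mul _), radialMean_const_mul, ih, ih]
    rcases p with _ | p
    · simp [Nat.factorial_succ]
      ring
    · simp

/-- The only radial means needed for integrating out a mode, because the angular integral vanishes
for p ≠ q. -/
lemma radialMean_radialHermite_self (p : ℕ) :
    radialMean (radialHermite p p) = if p = 0 then 1 / 2 else 0 := by
  simpa using radialMean_pow_mul_radialHermite p 0

lemma integral_exp_angle (p q : ℕ) :
    ∫ θ : ℝ in Set.Ioo 0 (2 * Real.pi), Complex.exp (-(Complex.I * (θ : ℂ))) ^ p *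
      Complex.exp (Complex.I * (θ : ℂ)) ^ q = if p = q then 2 * (Real.pi : ℂ) else 0 := by
  have h : ∀ θ : ℝ, Complex.exp (-(Complex.I * (θ : ℂ))) ^ p * Complex.exp (Complex.I * (θ : ℂ)) ^ q
      = Complex.exp ((((q : ℤ) - p : ℤ) : ℂ) * Complex.I * θ) := fun θ => by
    rw [← Complex.exp_nat_mul, ← Complex.exp_nat_mul, ← Complex.exp_add]
    congr 1
    push_cast
    ring
  simp_rw [h]
  rw [← integral_Ioc_eq_integral_Ioo, ← intervalIntegral.integral_of_le Real.two_pi_pos.le]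
  split_ifs with hpq
  · subst hpq
    simp
  · have hne : (((q : ℤ) - p : ℤ) : ℂ) * Complex.I ≠ 0 := by
      refine mul_ne_zero ?_ Complex.I_ne_zero
      rw [Int.cast_ne_zero, sub_ne_zero]
      exact_mod_cast Ne.symm hpq
    rw [integral_exp_mul_complex hne]
    have : (((q : ℤ) - p : ℤ) : ℂ) * Complex.I * ((2 * Real.pi : ℝ) : ℂ)
        = ((q : ℤ) - p : ℤ) * (2 * Real.pi * Complex.I) := by
      push_cast
      ring
    rw [this, Complex.exp_int_mul_two_pi_mul_I]
    simp

end FourierModes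

end

noncomputable section

namespace FourierModes

open MeasureTheory MvPolynomial

open scoped ComplexConjugate

/-! ### The Fourier transform of a polynomial in the letters times a Gaussian. -/

section Transform

variable {ι : Type*} [Fintype ι]

/-- The values of the letters in the characteristic function. -/
def letter (J : ι → ℂ) (s : ι × Bool) : ℂ :=
  if s.2 then -Complex.I / 2 * conj (J s.1) else -Complex.I / 2 * J s.1

lemma eval_letter_monomial (J : ι → ℂ) (m : ι × Bool →₀ ℕ) (c : ℂ) :
    eval (letter J) (monomial m c) = c * ∏ i, ((-Complex.I / 2 * conj (J i)) ^ m (i, true) *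
      (-Complex.I / 2 * J i) ^ m (i, false)) := by
  rw [eval_monomial, Finsupp.prod_fintype _ _ (fun _ => pow_zero _), Fintype.prod_prod_type]
  simp only [Fintype.prod_bool, letter, if_true, Bool.false_eq_true, if_false]

lemma pairing_eq_sum (J z : ι → ℂ) :
    Complex.exp (Complex.I * (pairing J z : ℂ))
      = ∏ i, Complex.exp (Complex.I * (((J i).re * (z i).re + (J i).im * (z i).im : ℝ) : ℂ)) := by
  rw [← Complex.exp_sum, pairing]
  push_cast
  rw [Finset.mul_sum]

/-- The density of independent complex Gaussian variables. -/
def gaussDensity (z : ι → ℂ) : ℂ := ∏ i, ((Real.pi : ℂ)⁻¹ * Complex.exp (-(‖z i‖ : ℂ) ^ 2))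

/-- By linearity a monomial suffices, for which the integral factors over the modes. Integrability
is proved along with the value, because the additive step needs it. -/
lemma integral_fourier_wick (Q : MvPolynomial (ι × Bool) ℂ) (z : ι → ℂ) :
    (Integrable fun J : ι → ℂ => (1 / (2 * Real.pi : ℂ) ^ (2 * Fintype.card ι)) *
      Complex.exp (Complex.I * (pairing J z : ℂ)) *
        (Complex.exp (∑ i, -(‖J i‖ : ℂ) ^ 2 / 4) * eval (letter J) Q)) ∧
    ∫ J : ι → ℂ, (1 / (2 * Real.pi : ℂ) ^ (2 * Fintype.card ι)) *
      Complex.exp (Complex.I * (pairing J z : ℂ)) *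
        (Complex.exp (∑ i, -(‖J i‖ : ℂ) ^ 2 / 4) * eval (letter J) Q)
      = gaussDensity z * wick (fun i p q => complexHermite p q (z i)) Q := by
  induction Q using MvPolynomial.induction_on' with
  | monomial m c =>
    have h : ∀ J : ι → ℂ, (1 / (2 * Real.pi : ℂ) ^ (2 * Fintype.card ι)) *
        Complex.exp (Complex.I * (pairing J z : ℂ)) *
        (Complex.exp (∑ i, -(‖J i‖ : ℂ) ^ 2 / 4) * eval (letter J) (monomial m c))
        = (1 / (2 * Real.pi : ℂ) ^ (2 * Fintype.card ι)) * c *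
          ∏ i, (fun (i : ι) (J : ℂ) =>
            Complex.exp (Complex.I * ((J.re * (z i).re + J.im * (z i).im : ℝ) : ℂ)) *
            (Complex.exp (-(‖J‖ : ℂ) ^ 2 / 4) * ((-Complex.I / 2 * conj J) ^ m (i, true) *
              (-Complex.I / 2 * J) ^ m (i, false)))) i (J i) := by
      intro J
      rw [eval_letter_monomial, pairing_eq_sum, Complex.exp_sum]
      simp only [Finset.prod_mul_distrib]
      ring
    simp_rw [h]
    refine ⟨(Integrable.fintype_prod (μ := fun _ => volume) fun i =>
      integrable_fourier_gauss _ _ _).const_mul _, ?_⟩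
    rw [integral_const_mul, integral_fintype_prod_volume_eq_prod (fun (i : ι) (J : ℂ) =>
      Complex.exp (Complex.I * ((J.re * (z i).re + J.im * (z i).im : ℝ) : ℂ)) *
        (Complex.exp (-(‖J‖ : ℂ) ^ 2 / 4) * ((-Complex.I / 2 * conj J) ^ m (i, true) *
          (-Complex.I / 2 * J) ^ m (i, false))))]
    simp only [integral_fourier_gauss]
    rw [wick_monomial, gaussDensity]
    simp only [Finset.prod_mul_distrib, Finset.prod_const, Finset.card_univ]
    have hpi : (Real.pi : ℂ) ≠ 0 := by exact_mod_cast Real.pi_ne_zero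
    -- For each mode, 4π from the Gaussian integral divided by (2π)² is the normalization 1/π of the
    -- density.
    have hc : 1 / (2 * Real.pi : ℂ) ^ (2 * Fintype.card ι) *
        (4 ^ Fintype.card ι * (Real.pi : ℂ) ^ Fintype.card ι) = (Real.pi : ℂ)⁻¹ ^ Fintype.card ι := by
      rw [pow_mul, ← mul_pow, ← one_div_pow, ← mul_pow]
      congr 1
      field_simp
      norm_num
    rw [← hc]
    ring
  | add p q hp hq =>
    have h : ∀ J : ι → ℂ, (1 / (2 * Real.pi : ℂ) ^ (2 * Fintype.card ι)) *
        Complex.exp (Complex.I * (pairing J z : ℂ)) *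
        (Complex.exp (∑ i, -(‖J i‖ : ℂ) ^ 2 / 4) * eval (letter J) (p + q))
        = (1 / (2 * Real.pi : ℂ) ^ (2 * Fintype.card ι)) *
        Complex.exp (Complex.I * (pairing J z : ℂ)) *
        (Complex.exp (∑ i, -(‖J i‖ : ℂ) ^ 2 / 4) * eval (letter J) p)
        + (1 / (2 * Real.pi : ℂ) ^ (2 * Fintype.card ι)) *
        Complex.exp (Complex.I * (pairing J z : ℂ)) *
        (Complex.exp (∑ i, -(‖J i‖ : ℂ) ^ 2 / 4) * eval (letter J) q) := by
      intro J
      rw [map_add]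
      ring
    simp_rw [h]
    refine ⟨hp.1.add hq.1, ?_⟩
    rw [integral_add hp.1 hq.1, hp.2, hq.2, map_add, mul_add]

end Transform

/-! ### Integrating out modes and moduli. -/

section Marginals

variable {ι : Type*} [Fintype ι] [DecidableEq ι]

/-- The weights of the modes in `T` are those of `φ`, the others are integrated out. -/
def marginalWeight (T : Finset ι) (φ : ι → ℕ → ℕ → ℂ) (i : ι) (p q : ℕ) : ℂ :=
  if i ∈ T then φ i p q else if p = 0 ∧ q = 0 then 1 else 0

/-- The polynomial with the modes outside `T` set to zero. -/
def restrict (T : Finset ι) : MvPolynomial (ι × Bool) ℂ →ₐ[ℂ] MvPolynomial (ι × Bool) ℂ :=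
  aeval fun s => if s.1 ∈ T then X s else 0

/-- A weight that is 1 in degree zero and 0 otherwise has the same effect as setting the letters of
that mode to zero: any monomial that contains such a letter is killed on both sides. -/
lemma wick_marginalWeight (T : Finset ι) {φ : ι → ℕ → ℕ → ℂ} (hφ : ∀ i, φ i 0 0 = 1)
    (Q : MvPolynomial (ι × Bool) ℂ) :
    wick (marginalWeight T φ) Q = wick φ (restrict T Q) := by
  induction Q using MvPolynomial.induction_on' with
  | add p q hp hq => rw [map_add, map_add, map_add, hp, hq]
  | monomial m c =>
    have hr : restrict T (monomial m c)
        = C c * ∏ s, (if s.1 ∈ T then X s else 0 : MvPolynomial (ι × Bool) ℂ) ^ m s := by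
      rw [restrict, aeval_monomial, Finsupp.prod_fintype _ _ (fun _ => pow_zero _)]
      rfl
    by_cases hm : ∀ s, s.1 ∉ T → m s = 0
    · have : restrict T (monomial m c) = monomial m c := by
        rw [hr, monomial_eq, Finsupp.prod_fintype _ _ (fun _ => pow_zero _)]
        congr 1
        refine Finset.prod_congr rfl fun s _ => ?_
        by_cases hs : s.1 ∈ T
        · rw [if_pos hs]
        · rw [hm s hs, pow_zero, pow_zero]
      rw [this, wick_monomial, wick_monomial]
      congr 1
      refine Finset.prod_congr rfl fun i _ => ?_
      by_cases hi : i ∈ T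
      · simp [marginalWeight, hi]
      · simp [marginalWeight, hi, hm (i, true) hi, hm (i, false) hi, hφ]
    · push Not at hm
      obtain ⟨s, hs, hms⟩ := hm
      have : restrict T (monomial m c) = 0 := by
        rw [hr, Finset.prod_eq_zero (Finset.mem_univ s), mul_zero]
        rw [if_neg hs, zero_pow hms]
      rw [this, map_zero, wick_monomial, Finset.prod_eq_zero (Finset.mem_univ s.1), mul_zero]
      rw [marginalWeight, if_neg hs, if_neg]
      rintro ⟨h1, h2⟩
      obtain ⟨i, β⟩ := s
      cases β <;> contradiction

lemma prod_updateFinset (T : Finset ι) (F : ι → ℝ → ℝ → ℂ) (A θ : ι → ℝ) (A' θ' : T → ℝ) :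
    ∏ i, F i (Function.updateFinset A T A' i) (Function.updateFinset θ T θ' i)
      = (∏ i ∈ Tᶜ, F i (A i) (θ i)) * ∏ j : T, F j (A' j) (θ' j) := by
  rw [← Finset.prod_compl_mul_prod T]
  congr 1
  · refine Finset.prod_congr rfl fun i hi => ?_
    have hi' : i ∉ T := Finset.mem_compl.1 hi
    simp [Function.updateFinset, hi']
  · rw [← Finset.prod_coe_sort]
    refine Finset.prod_congr rfl fun j _ => ?_
    simp [Function.updateFinset, j.2]

/-- A factor of the polar density. -/
def polarFactor (p q : ℕ) (A θ : ℝ) : ℂ :=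
  (A : ℂ) * ((Real.pi : ℂ)⁻¹ * Complex.exp (-(A : ℂ) ^ 2)) *
    complexHermite p q ((A : ℂ) * Complex.exp (Complex.I * (θ : ℂ)))

lemma polarFactor_eq (p q : ℕ) (A θ : ℝ) :
    polarFactor p q A θ = (Real.pi : ℂ)⁻¹ * ((A * Real.exp (-A ^ 2) * radialHermite p q A : ℝ) : ℂ) *
      (Complex.exp (-(Complex.I * (θ : ℂ))) ^ p * Complex.exp (Complex.I * (θ : ℂ)) ^ q) := by
  rw [polarFactor, complexHermite_polar]
  push_cast
  ring

lemma continuous_polarFactor (p q : ℕ) (A : ℝ) : Continuous (polarFactor p q A) := by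
  unfold polarFactor
  have := continuous_complexHermite p q
  fun_prop

lemma integral_polarFactor_angle (p q : ℕ) (A : ℝ) :
    ∫ θ : ℝ in Set.Ioo 0 (2 * Real.pi), polarFactor p q A θ
      = (Real.pi : ℂ)⁻¹ * ((A * Real.exp (-A ^ 2) * radialHermite p q A : ℝ) : ℂ) *
        (if p = q then 2 * (Real.pi : ℂ) else 0) := by
  simp_rw [polarFactor_eq]
  rw [integral_const_mul, integral_exp_angle]

lemma integrable_polarFactor_modulus (p q : ℕ) (θ : ℝ) :
    IntegrableOn (fun A => polarFactor p q A θ) (Set.Ioi 0) := by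
  simp_rw [polarFactor_eq]
  exact ((radialIntegrable_radialHermite p q).ofReal.const_mul _).mul_const _

lemma integral_polarFactor_modulus (p q : ℕ) (θ : ℝ) :
    ∫ A : ℝ in Set.Ioi 0, polarFactor p q A θ = (Real.pi : ℂ)⁻¹ * (radialMean (radialHermite p q) : ℂ) *
      (Complex.exp (-(Complex.I * (θ : ℂ))) ^ p * Complex.exp (Complex.I * (θ : ℂ)) ^ q) := by
  simp_rw [polarFactor_eq]
  rw [integral_mul_const, integral_const_mul, integral_complex_ofReal]
  rfl

/-- The angular integral forces p = q and the radial one then p = 0. In that case the value is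
(1/π)·(1/2)·2π = 1. -/
lemma integral_polarFactor (p q : ℕ) :
    ∫ A : ℝ in Set.Ioi 0, ∫ θ : ℝ in Set.Ioo 0 (2 * Real.pi), polarFactor p q A θ
      = if p = 0 ∧ q = 0 then 1 else 0 := by
  simp_rw [integral_polarFactor_angle]
  rw [integral_mul_const, integral_const_mul, integral_complex_ofReal]
  change _ * ((radialMean (radialHermite p q) : ℝ) : ℂ) * _ = _
  have hpi : (Real.pi : ℂ) ≠ 0 := by exact_mod_cast Real.pi_ne_zero
  by_cases h : p = q
  · subst h
    rw [radialMean_radialHermite_self]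
    by_cases hp : p = 0
    · simp [hp]
      field_simp
    · simp [hp]
  · rw [if_neg h, mul_zero, if_neg]
    rintro ⟨rfl, rfl⟩
    exact h rfl

lemma integrable_integral_polarFactor (p q : ℕ) :
    IntegrableOn (fun A => ∫ θ : ℝ in Set.Ioo 0 (2 * Real.pi), polarFactor p q A θ)
      (Set.Ioi 0) := by
  simp_rw [integral_polarFactor_angle]
  exact ((radialIntegrable_radialHermite p q).ofReal.const_mul _).mul_const _

/-- The polar density associated with the polynomial `Q`. -/
def polarWick (Q : MvPolynomial (ι × Bool) ℂ) (A θ : ι → ℝ) : ℂ :=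
  (∏ i, ((A i : ℂ) * ((Real.pi : ℂ)⁻¹ * Complex.exp (-(A i : ℂ) ^ 2)))) *
    wick (fun i p q => complexHermite p q ((A i : ℂ) * Complex.exp (Complex.I * (θ i : ℂ)))) Q

omit [DecidableEq ι] in
lemma polarWick_monomial (m : ι × Bool →₀ ℕ) (c : ℂ) (A θ : ι → ℝ) :
    polarWick (monomial m c) A θ
      = c * ∏ i, polarFactor (m (i, true)) (m (i, false)) (A i) (θ i) := by
  rw [polarWick, wick_monomial, mul_left_comm, ← Finset.prod_mul_distrib]
  rfl

omit [DecidableEq ι] in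
lemma polarWick_add (P Q : MvPolynomial (ι × Bool) ℂ) (A θ : ι → ℝ) :
    polarWick (P + Q) A θ = polarWick P A θ + polarWick Q A θ := by
  rw [polarWick, map_add, mul_add]
  rfl

/-- The marginal of the polar density. -/
def marginalWick (T : Finset ι) (Q : MvPolynomial (ι × Bool) ℂ) (A θ : ι → ℝ) : ℂ :=
  (∏ i ∈ T, ((A i : ℂ) * ((Real.pi : ℂ)⁻¹ * Complex.exp (-(A i : ℂ) ^ 2)))) *
    wick (marginalWeight T
      fun i p q => complexHermite p q ((A i : ℂ) * Complex.exp (Complex.I * (θ i : ℂ)))) Q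

lemma marginalWick_monomial (T : Finset ι) (m : ι × Bool →₀ ℕ) (c : ℂ) (A θ : ι → ℝ) :
    marginalWick T (monomial m c) A θ
      = c * ((∏ i ∈ T, polarFactor (m (i, true)) (m (i, false)) (A i) (θ i)) *
        ∏ i ∈ Tᶜ, if m (i, true) = 0 ∧ m (i, false) = 0 then 1 else 0) := by
  rw [marginalWick, wick_monomial, mul_left_comm, ← Finset.prod_mul_prod_compl T, ← mul_assoc (∏ _ ∈ T, _),
    ← Finset.prod_mul_distrib]
  congr 2
  · refine Finset.prod_congr rfl fun i hi => ?_
    rw [marginalWeight, if_pos hi, polarFactor]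
  · refine Finset.prod_congr rfl fun i hi => ?_
    rw [marginalWeight, if_neg (Finset.mem_compl.1 hi)]

/-- Linearity reduces this to monomials, which factor over the modes. The integrability of the inner
and of the outer integral is part of the induction, since both are split in the additive step. -/
lemma integral_polarWick (T : Finset ι) (Q : MvPolynomial (ι × Bool) ℂ) (A θ : ι → ℝ) :
    (∀ A' : ↥(Tᶜ) → ℝ, IntegrableOn (fun θ' : ↥(Tᶜ) → ℝ => polarWick Q
      (Function.updateFinset A Tᶜ A') (Function.updateFinset θ Tᶜ θ'))
      (Set.univ.pi fun _ => Set.Ioo 0 (2 * Real.pi))) ∧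
    IntegrableOn (fun A' : ↥(Tᶜ) → ℝ =>
      ∫ θ' : ↥(Tᶜ) → ℝ in Set.univ.pi (fun _ => Set.Ioo 0 (2 * Real.pi)), polarWick Q
      (Function.updateFinset A Tᶜ A') (Function.updateFinset θ Tᶜ θ'))
      (Set.univ.pi fun _ => Set.Ioi 0) ∧
    ∫ A' : ↥(Tᶜ) → ℝ in Set.univ.pi (fun _ => Set.Ioi 0),
      ∫ θ' : ↥(Tᶜ) → ℝ in Set.univ.pi (fun _ => Set.Ioo 0 (2 * Real.pi)), polarWick Q
      (Function.updateFinset A Tᶜ A') (Function.updateFinset θ Tᶜ θ')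
      = marginalWick T Q A θ := by
  induction Q using MvPolynomial.induction_on' with
  | monomial m c =>
    have h : ∀ A' θ' : ↥(Tᶜ) → ℝ, polarWick (monomial m c)
        (Function.updateFinset A Tᶜ A') (Function.updateFinset θ Tᶜ θ')
        = c * (∏ i ∈ T, polarFactor (m (i, true)) (m (i, false)) (A i) (θ i)) *
          ∏ j : ↥(Tᶜ), polarFactor (m (j, true)) (m (j, false)) (A' j) (θ' j) := by
      intro A' θ'
      rw [polarWick_monomial,
        prod_updateFinset Tᶜ fun i => polarFactor (m (i, true)) (m (i, false)), compl_compl,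
        mul_assoc]
    simp_rw [h, IntegrableOn]
    -- The restriction to a box becomes a product of restricted measures, so that integrals of
    -- products factor.
    rw [volume_pi, Measure.restrict_pi_pi, Measure.restrict_pi_pi]
    have h₁ : ∀ A' : ↥(Tᶜ) → ℝ, Integrable (fun θ' : ↥(Tᶜ) → ℝ =>
        ∏ j : ↥(Tᶜ), polarFactor (m (j, true)) (m (j, false)) (A' j) (θ' j))
        (Measure.pi fun _ => volume.restrict (Set.Ioo 0 (2 * Real.pi))) := fun A' =>
      Integrable.fintype_prod (f := fun (j : ↥(Tᶜ)) =>
        polarFactor (m (j, true)) (m (j, false)) (A' j)) fun j =>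
        ((continuous_polarFactor _ _ _).integrableOn_Icc (a := 0) (b := 2 * Real.pi)).mono_set
          Set.Ioo_subset_Icc_self
    have h₂ : ∀ A' : ↥(Tᶜ) → ℝ, ∫ θ' : ↥(Tᶜ) → ℝ,
        c * (∏ i ∈ T, polarFactor (m (i, true)) (m (i, false)) (A i) (θ i)) *
          ∏ j : ↥(Tᶜ), polarFactor (m (j, true)) (m (j, false)) (A' j) (θ' j)
        ∂(Measure.pi fun _ => volume.restrict (Set.Ioo 0 (2 * Real.pi)))
        = c * (∏ i ∈ T, polarFactor (m (i, true)) (m (i, false)) (A i) (θ i)) *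
          ∏ j : ↥(Tᶜ), (fun (j : ↥(Tᶜ)) (a : ℝ) => ∫ t : ℝ in Set.Ioo 0 (2 * Real.pi),
            polarFactor (m (j, true)) (m (j, false)) a t) j (A' j) := fun A' => by
      rw [integral_const_mul, integral_fintype_prod_eq_prod fun (j : ↥(Tᶜ)) =>
        polarFactor (m (j, true)) (m (j, false)) (A' j)]
    simp_rw [h₂]
    refine ⟨fun A' => (h₁ A').const_mul _, (Integrable.fintype_prod fun j =>
      integrable_integral_polarFactor _ _).const_mul _, ?_⟩
    rw [integral_const_mul, integral_fintype_prod_eq_prod (fun (j : ↥(Tᶜ)) (a : ℝ) =>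
      ∫ t : ℝ in Set.Ioo 0 (2 * Real.pi), polarFactor (m (j, true)) (m (j, false)) a t),
      marginalWick_monomial]
    simp only [integral_polarFactor]
    rw [← Finset.prod_coe_sort Tᶜ, mul_assoc]
  | add P Q hP hQ =>
    have h : ∀ A' : ↥(Tᶜ) → ℝ, ∫ θ' : ↥(Tᶜ) → ℝ in Set.univ.pi (fun _ => Set.Ioo 0 (2 * Real.pi)),
        (polarWick P (Function.updateFinset A Tᶜ A') (Function.updateFinset θ Tᶜ θ')
        + polarWick Q (Function.updateFinset A Tᶜ A') (Function.updateFinset θ Tᶜ θ'))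
        = _ := fun A' => integral_add (hP.1 A') (hQ.1 A')
    simp_rw [polarWick_add, h]
    refine ⟨fun A' => (hP.1 A').add (hQ.1 A'), hP.2.1.add hQ.2.1, ?_⟩
    rw [integral_add hP.2.1 hQ.2.1, hP.2.2, hQ.2.2, marginalWick, marginalWick, marginalWick,
      map_add, mul_add]

/-- The weights of the phases: the Hermite polynomials averaged over the modulus. -/
def phaseWeight (θ : ι → ℝ) (i : ι) (p q : ℕ) : ℂ :=
  2 * (radialMean (radialHermite p q) : ℂ) *
    (Complex.exp (-(Complex.I * (θ i : ℂ))) ^ p * Complex.exp (Complex.I * (θ i : ℂ)) ^ q)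

/-- `marginalWick T` reads the moduli on `T` only, so the value 0 outside `T` is immaterial. -/
lemma integral_marginalWick (T : Finset ι) (Q : MvPolynomial (ι × Bool) ℂ) (θ : ι → ℝ) :
    (IntegrableOn (fun A' : ↥T → ℝ => marginalWick T Q (Function.updateFinset (fun _ => 0) T A') θ)
      (Set.univ.pi fun _ => Set.Ioi 0)) ∧
    ∫ A' : ↥T → ℝ in Set.univ.pi (fun _ => Set.Ioi 0),
      marginalWick T Q (Function.updateFinset (fun _ => 0) T A') θ
      = (1 / (2 * Real.pi : ℂ)) ^ T.card * wick (marginalWeight T (phaseWeight θ)) Q := by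
  induction Q using MvPolynomial.induction_on' with
  | monomial m c =>
    have h : ∀ A' : ↥T → ℝ, marginalWick T (monomial m c)
        (Function.updateFinset (fun _ => 0) T A') θ
        = c * (∏ i ∈ Tᶜ, if m (i, true) = 0 ∧ m (i, false) = 0 then 1 else 0) *
          ∏ j : ↥T, (fun (j : ↥T) (a : ℝ) =>
            polarFactor (m (j, true)) (m (j, false)) a (θ j)) j (A' j) := by
      intro A'
      rw [marginalWick_monomial, ← Finset.prod_coe_sort T, mul_comm (∏ _, _), mul_assoc]
      congr 2
      refine Finset.prod_congr rfl fun j _ => ?_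
      simp [Function.updateFinset, j.2]
    simp_rw [h, IntegrableOn]
    rw [volume_pi, Measure.restrict_pi_pi]
    refine ⟨(Integrable.fintype_prod fun j =>
      integrable_polarFactor_modulus _ _ _).const_mul _, ?_⟩
    rw [integral_const_mul, integral_fintype_prod_eq_prod (fun (j : ↥T) (a : ℝ) =>
      polarFactor (m (j, true)) (m (j, false)) a (θ j)), wick_monomial,
      ← Finset.prod_mul_prod_compl T]
    have h₁ : ∏ i ∈ Tᶜ, marginalWeight T (phaseWeight θ) i (m (i, true)) (m (i, false))
        = ∏ i ∈ Tᶜ, if m (i, true) = 0 ∧ m (i, false) = 0 then 1 else 0 :=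
      Finset.prod_congr rfl fun i hi => by
        rw [marginalWeight, if_neg (Finset.mem_compl.1 hi)]
    -- Per mode, the uniform density 1/(2π) times the factor 2 in `phaseWeight` is the 1/π of the
    -- Gaussian density.
    have h₂ : (1 / (2 * Real.pi : ℂ)) ^ T.card *
        ∏ i ∈ T, marginalWeight T (phaseWeight θ) i (m (i, true)) (m (i, false))
        = ∏ j : ↥T, ∫ a : ℝ in Set.Ioi 0, polarFactor (m (j, true)) (m (j, false)) a (θ j) := by
      rw [← Finset.prod_const, ← Finset.prod_mul_distrib, ← Finset.prod_coe_sort T]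
      refine Finset.prod_congr rfl fun j _ => ?_
      rw [integral_polarFactor_modulus, marginalWeight, if_pos j.2, phaseWeight]
      field_simp
    rw [h₁, ← h₂]
    ring
  | add P Q hP hQ =>
    have h : ∀ A : ι → ℝ, marginalWick T (P + Q) A θ
        = marginalWick T P A θ + marginalWick T Q A θ := fun A => by
      rw [marginalWick, marginalWick, marginalWick, map_add, mul_add]
    simp_rw [h]
    exact ⟨hP.1.add hQ.1, by rw [integral_add hP.1 hQ.1, hP.2, hQ.2, map_add, mul_add]⟩

end Marginals

end FourierModes

end

noncomputable section

namespace FourierModes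

open MeasureTheory

/-! ## Joint cumulants -/

section Cumulant

variable {Ω : Type*} [MeasurableSpace Ω] (μ : Measure Ω) [IsProbabilityMeasure μ]

/-- The random variables with moments of all orders. -/
def allMoments : Submodule ℂ (Ω → ℂ) where
  carrier := {X | ∀ p : ℕ, MemLp X p μ}
  add_mem' hX hY p := (hX p).add (hY p)
  zero_mem' _ := MemLp.zero
  smul_mem' c _ hX p := (hX p).const_smul c

variable {μ}

/-- Hölder's inequality with all exponents equal to the number of factors. -/
lemma integrable_prod_of_allMoments {ι : Type*} {X : ι → Ω → ℂ} (s : Finset ι)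
    (hX : ∀ i ∈ s, X i ∈ allMoments μ) : Integrable (fun ω => ∏ i ∈ s, X i ω) μ := by
  rcases s.eq_empty_or_nonempty with rfl | hs
  · simp
  · have h := MemLp.prod' (p := fun _ => ((s.card : ℕ) : ENNReal)) fun i hi => hX i hi s.card
    have hc : (∑ i ∈ s, (((s.card : ℕ) : ENNReal))⁻¹)⁻¹ = 1 := by
      rw [Finset.sum_const, nsmul_eq_mul, ENNReal.mul_inv_cancel (by simpa using hs.ne_empty)
        (ENNReal.natCast_ne_top _), inv_one]
    rw [hc] at h
    exact memLp_one_iff_integrable.1 h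

/-- The summand of the joint cumulant which belongs to a partition. -/
def partitionTerm (μ : Measure Ω) {n : ℕ} (X : Fin n → Ω → ℂ)
    (π : Finpartition (Finset.univ : Finset (Fin n))) : ℂ :=
  (-1 : ℂ) ^ (π.parts.card - 1) * ((π.parts.card - 1).factorial : ℂ) *
      ∏ B ∈ π.parts, ∫ ω, ∏ i ∈ B, X i ω ∂μ

-- The index i lies in exactly one block, so a partition depends on X i through a single integral,
-- linearly. This yields the multilinearity of the cumulant.
omit [IsProbabilityMeasure μ] in
lemma partitionTerm_update {n : ℕ} (X : Fin n → Ω → ℂ)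
    (π : Finpartition (Finset.univ : Finset (Fin n))) (i : Fin n) (Y : Ω → ℂ) :
    partitionTerm μ (Function.update X i Y) π =
      (-1 : ℂ) ^ (π.parts.card - 1) * ((π.parts.card - 1).factorial : ℂ) *
      ((∫ ω, Y ω * ∏ j ∈ (π.part i).erase i, X j ω ∂μ) *
        ∏ B ∈ π.parts.erase (π.part i), ∫ ω, ∏ j ∈ B, X j ω ∂μ) := by
  rw [partitionTerm, ← Finset.mul_prod_erase _ _ (π.part_mem.2 (Finset.mem_univ i))]
  congr 2
  · congr 1 with ω
    rw [← Finset.mul_prod_erase _ _ (π.mem_part_self.2 (Finset.mem_univ i)),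
      Function.update_self]
    congr 1
    refine Finset.prod_congr rfl fun j hj => ?_
    rw [Function.update_of_ne (Finset.ne_of_mem_erase hj)]
  · refine Finset.prod_congr rfl fun B hB => ?_
    congr 1 with ω
    refine Finset.prod_congr rfl fun j hj => ?_
    rw [Function.update_of_ne]
    rintro rfl
    exact Finset.ne_of_mem_erase hB (π.part_eq_of_mem (Finset.mem_of_mem_erase hB) hj).symm

lemma integrable_mul_prod_erase {n : ℕ} {X : Fin n → Ω → ℂ} (hX : ∀ i, X i ∈ allMoments μ)
    {Y : Ω → ℂ} (hY : Y ∈ allMoments μ) (B : Finset (Fin n)) (i : Fin n) :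
    Integrable (fun ω => Y ω * ∏ j ∈ B.erase i, X j ω) μ := by
  have h := integrable_prod_of_allMoments (μ := μ) (X := Function.update X i Y)
    (insert i (B.erase i)) fun j _ => by
      by_cases hj : j = i
      · subst hj; simpa using hY
      · simpa [hj] using hX j
  refine h.congr (Filter.Eventually.of_forall fun ω => ?_)
  change ∏ j ∈ insert i (B.erase i), _ = _
  rw [Finset.prod_insert (Finset.notMem_erase i B), Function.update_self]
  congr 1
  refine Finset.prod_congr rfl fun j hj => ?_
  rw [Function.update_of_ne (Finset.ne_of_mem_erase hj)]

omit [IsProbabilityMeasure μ] in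
lemma coe_update {n : ℕ} [DecidableEq (Fin n)] (X : Fin n → allMoments μ) (i : Fin n)
    (Y : allMoments μ) :
    (fun j => (Function.update X i Y j : Ω → ℂ))
      = Function.update (fun j => (X j : Ω → ℂ)) i (Y : Ω → ℂ) := by
  funext j
  by_cases hj : j = i
  · subst hj; simp
  · simp [hj]

variable (μ) in
/-- The joint cumulant as a multilinear map. -/
def cumulantMap (n : ℕ) : MultilinearMap ℂ (fun _ : Fin n => allMoments μ) ℂ where
  toFun X := jointCumulant μ fun i => (X i : Ω → ℂ)
  map_update_add' {inst} X i Y Z := by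
    -- The field of the structure quantifies over all decidability instances used in
    -- `Function.update`.
    have : inst = instDecidableEqFin n := Subsingleton.elim _ _
    subst this
    change ∑ π, partitionTerm μ _ π = ∑ π, partitionTerm μ _ π + ∑ π, partitionTerm μ _ π
    rw [← Finset.sum_add_distrib]
    refine Finset.sum_congr rfl fun π _ => ?_
    rw [coe_update, coe_update, coe_update, partitionTerm_update, partitionTerm_update,
      partitionTerm_update, ← mul_add, ← add_mul, ← integral_add
        (integrable_mul_prod_erase (fun j => (X j).2) Y.2 _ i)
        (integrable_mul_prod_erase (fun j => (X j).2) Z.2 _ i)]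
    simp only [Submodule.coe_add, Pi.add_apply, add_mul]
  map_update_smul' {inst} X i c Y := by
    have : inst = instDecidableEqFin n := Subsingleton.elim _ _
    subst this
    change ∑ π, partitionTerm μ _ π = c • ∑ π, partitionTerm μ _ π
    rw [Finset.smul_sum]
    refine Finset.sum_congr rfl fun π _ => ?_
    rw [coe_update, coe_update, partitionTerm_update, partitionTerm_update]
    simp only [Submodule.coe_smul, Pi.smul_apply, smul_eq_mul, mul_assoc c]
    rw [integral_const_mul]
    ring

lemma cumulantMap_apply {n : ℕ} (X : Fin n → allMoments μ) :
    cumulantMap μ n X = jointCumulant μ fun i => (X i : Ω → ℂ) := rfl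

omit [IsProbabilityMeasure μ] in
lemma jointCumulant_eq_zero {n : ℕ} {X : Fin n → Ω → ℂ}
    (h : ∀ π : Finpartition (Finset.univ : Finset (Fin n)),
      ∃ B ∈ π.parts, ∫ ω, ∏ i ∈ B, X i ω ∂μ = 0) : jointCumulant μ X = 0 := by
  refine Finset.sum_eq_zero fun π _ => ?_
  obtain ⟨B, hB, h0⟩ := h π
  rw [Finset.prod_eq_zero hB h0, mul_zero]

/-- The image of a partition under a permutation. -/
def permPartition {n : ℕ} (σ : Equiv.Perm (Fin n))
    (π : Finpartition (Finset.univ : Finset (Fin n))) :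
    Finpartition (Finset.univ : Finset (Fin n)) :=
  (π.map (⟨σ.finsetCongr, by simp⟩ : Finset (Fin n) ≃o Finset (Fin n))).copy (by
    simp [Equiv.finsetCongr])

lemma permPartition_parts {n : ℕ} (σ : Equiv.Perm (Fin n))
    (π : Finpartition (Finset.univ : Finset (Fin n))) :
    (permPartition σ π).parts = π.parts.map σ.finsetCongr.toEmbedding := rfl

lemma permPartition_bijective {n : ℕ} (σ : Equiv.Perm (Fin n)) :
    Function.Bijective (permPartition σ) := by
  rw [← Finite.injective_iff_bijective]
  intro π π' h
  have h' := congrArg Finpartition.parts h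
  rw [permPartition_parts, permPartition_parts] at h'
  exact Finpartition.ext (Finset.map_injective _ h')

-- A permutation of the indices permutes the partitions and preserves the number of blocks.
omit [IsProbabilityMeasure μ] in
lemma jointCumulant_comp_perm {n : ℕ} (X : Fin n → Ω → ℂ) (σ : Equiv.Perm (Fin n)) :
    jointCumulant μ (fun i => X (σ i)) = jointCumulant μ X := by
  rw [jointCumulant, jointCumulant]
  symm
  rw [← (permPartition_bijective σ).sum_comp]
  refine Finset.sum_congr rfl fun π _ => ?_
  rw [permPartition_parts, Finset.card_map, Finset.prod_map]
  congr 1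
  refine Finset.prod_congr rfl fun B _ => ?_
  congr 1 with ω
  simp [Equiv.finsetCongr]

-- Besides the one-block partition there is only the one into singletons, and its term contains the
-- mean of X 0.
omit [IsProbabilityMeasure μ] in
lemma jointCumulant_two {X : Fin 2 → Ω → ℂ} (h : ∫ ω, X 0 ω ∂μ = 0) :
    jointCumulant μ X = ∫ ω, X 0 ω * X 1 ω ∂μ := by
  have hne : (Finset.univ : Finset (Fin 2)) ≠ ⊥ := Finset.univ_nonempty.ne_empty
  rw [jointCumulant, Finset.sum_eq_single (Finpartition.indiscrete hne)]
  · simp [Finpartition.indiscrete]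
  · intro π _ hπ
    suffices ({0} : Finset (Fin 2)) ∈ π.parts by
      rw [Finset.prod_eq_zero this, mul_zero]
      simpa using h
    have h0 := π.part_mem.2 (Finset.mem_univ 0)
    have h0' := π.mem_part_self.2 (Finset.mem_univ 0)
    by_cases h1 : (1 : Fin 2) ∈ π.part 0
    · exfalso
      apply hπ
      have hu : π.part 0 = Finset.univ := by
        ext i
        fin_cases i <;> simp [h0', h1]
      apply Finpartition.ext
      ext B
      simp only [Finpartition.indiscrete, Finset.mem_singleton]
      constructor
      · intro hB
        obtain ⟨x, hx⟩ := π.nonempty_of_mem_parts hB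
        rw [← hu]
        exact π.eq_of_mem_parts hB h0 hx (by rw [hu]; exact Finset.mem_univ x)
      · rintro rfl
        rwa [hu] at h0
    · have hu : π.part 0 = {0} := by
        ext i
        fin_cases i <;> simp [h0', h1]
      rwa [hu] at h0
  · intro h
    exact absurd (Finset.mem_univ _) h

end Cumulant

end FourierModes

end

noncomputable section

namespace FourierModes

open MeasureTheory

open scoped ComplexConjugate

/-! ## Moments of the Fourier modes -/

section Characters

variable {d : ℕ} {L : Fin d → ℝ} [∀ i, Fact (0 < L i)]

/-- The plane wave `e^{-i k·x}`. -/
def planeWave (k : Wavevector d) (x : Box L) : ℂ := ∏ i, fourier (-(k i)) (x i)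

omit [∀ i, Fact (0 < L i)] in
lemma norm_planeWave (k : Wavevector d) (x : Box L) : ‖planeWave k x‖ = 1 := by
  rw [planeWave, norm_prod]
  exact Finset.prod_eq_one fun i _ => by rw [fourier_apply, Circle.norm_coe]

omit [∀ i, Fact (0 < L i)] in
lemma planeWave_add (k : Wavevector d) (x y : Box L) :
    planeWave k (x + y) = planeWave k x * planeWave k y := by
  rw [planeWave, planeWave, planeWave, ← Finset.prod_mul_distrib]
  refine Finset.prod_congr rfl fun i _ => ?_
  rw [Pi.add_apply, fourier_apply, fourier_apply, fourier_apply, smul_add, AddCircle.toCircle_add,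
    Circle.coe_mul]

omit [∀ i, Fact (0 < L i)] in
lemma planeWave_sum {n : ℕ} (k : Fin n → Wavevector d) (x : Box L) :
    planeWave (∑ j, k j) x = ∏ j, planeWave (k j) x := by
  simp only [planeWave]
  rw [Finset.prod_comm]
  refine Finset.prod_congr rfl fun i _ => ?_
  rw [Finset.sum_apply, ← Finset.sum_neg_distrib]
  induction (Finset.univ : Finset (Fin n)) using Finset.cons_induction with
  | empty => simp
  | cons j s hj ih => rw [Finset.sum_cons, Finset.prod_cons, fourier_add, ih]

omit [∀ i, Fact (0 < L i)] in
lemma planeWave_neg (k : Wavevector d) (x : Box L) :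
    planeWave (-k) x = conj (planeWave k x) := by
  rw [planeWave, planeWave, map_prod]
  refine Finset.prod_congr rfl fun i _ => ?_
  rw [Pi.neg_apply, ← fourier_neg]

omit [∀ i, Fact (0 < L i)] in
lemma continuous_planeWave (k : Wavevector d) : Continuous (planeWave (L := L) k) := by
  unfold planeWave
  fun_prop

/-- A nonconstant plane wave takes a value different from one. -/
lemma exists_planeWave_ne_one {k : Wavevector d} (hk : k ≠ 0) :
    ∃ x : Box L, planeWave k x ≠ 1 := by
  by_contra! h
  apply hk
  funext i
  by_contra hi
  have hL : 0 < L i := Fact.out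
  -- Half a wavelength along a direction with k_i ≠ 0: the plane wave has the value e^{-iπ} = -1
  -- there.
  have h1 := h (Pi.single i (((L i / (2 * k i) : ℝ)) : AddCircle (L i)))
  rw [planeWave, Finset.prod_eq_single i, Pi.single_eq_same, fourier_coe_apply] at h1
  · have hki : (k i : ℂ) ≠ 0 := by exact_mod_cast hi
    have hL' : (L i : ℂ) ≠ 0 := by exact_mod_cast hL.ne'
    have h2 : 2 * (Real.pi : ℂ) * Complex.I * ((-(k i) : ℤ) : ℂ) * ((L i / (2 * k i) : ℝ) : ℂ) / (L i : ℂ)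
        = -(Real.pi * Complex.I) := by
      push_cast
      field_simp
    rw [h2, Complex.exp_neg, Complex.exp_pi_mul_I] at h1
    norm_num at h1
  · intro j _ hj
    rw [Pi.single_eq_of_ne hj]
    simp [fourier_apply]
  · simp

end Characters

section Field

variable {d : ℕ} {L : Fin d → ℝ} [∀ i, Fact (0 < L i)] {Ω : Type*} [MeasurableSpace Ω]
  {μ : Measure Ω} {f : Ω → Box L → ℝ}

-- The largest factor dominates all others; the summand 1 covers the empty product.
omit [∀ i, Fact (0 < L i)] in
lemma prod_le_one_add_sum_pow {n : ℕ} (a : Fin n → ℝ) (ha : ∀ j, 0 ≤ a j) :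
    ∏ j, a j ≤ 1 + ∑ j, a j ^ n := by
  have h0 : ∀ j, 0 ≤ a j ^ n := fun j => pow_nonneg (ha j) n
  rcases Nat.eq_zero_or_pos n with rfl | hn
  · simp
  · obtain ⟨j, -, hj⟩ := Finset.exists_max_image (Finset.univ : Finset (Fin n)) a
      ⟨⟨0, hn⟩, Finset.mem_univ _⟩
    calc ∏ i, a i ≤ ∏ _i : Fin n, a j :=
          Finset.prod_le_prod (fun i _ => ha i) fun i hi => hj i hi
      _ = a j ^ n := by simp
      _ ≤ ∑ i, a i ^ n := Finset.single_le_sum (fun i _ => h0 i) (Finset.mem_univ j)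
      _ ≤ 1 + ∑ i, a i ^ n := by linarith

omit [MeasurableSpace Ω] in
lemma fourierMode_neg (k : Wavevector d) (ω : Ω) :
    fourierMode f (-k) ω = conj (fourierMode f k ω) := by
  have h : ∀ q : Wavevector d, fourierMode f q ω = ((Real.sqrt (boxVolume L) : ℝ) : ℂ)⁻¹ *
    ∫ x : Box L, (f ω x : ℂ) * planeWave q x := fun _ => rfl
  rw [h, h, map_mul, map_inv₀, Complex.conj_ofReal, ← integral_conj]
  congr 2 with x
  rw [map_mul, Complex.conj_ofReal, planeWave_neg]

lemma powerSpectrum_neg (k : Wavevector d) :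
    powerSpectrum μ f (-k) = powerSpectrum μ f k := by
  simp only [powerSpectrum, fourierMode_neg, RCLike.norm_conj]

variable [IsProbabilityMeasure μ] (hf : IsHomogeneousField μ f)

include hf

-- By homogeneity the moments of f(x) do not depend on x, so finiteness at each point suffices for
-- integrability over the finite measure ν.
omit [∀ i, Fact (0 < L i)] in
lemma integrable_field_pow_prod {n : ℕ} (j : Fin n) (m : ℕ) (ν : Measure (Fin n → Box L))
    [IsFiniteMeasure ν] :
    Integrable (fun p : Ω × (Fin n → Box L) => |f p.1 (p.2 j)| ^ m) (μ.prod ν) := by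
  have hmeas : Measurable fun p : Ω × (Fin n → Box L) => f p.1 (p.2 j) :=
    hf.measurable.comp (measurable_fst.prodMk ((measurable_pi_apply j).comp measurable_snd))
  have hm : Measurable fun p : Ω × (Fin n → Box L) => |f p.1 (p.2 j)| ^ m := by
    exact (continuous_abs.measurable.comp hmeas).pow_const m
  rw [integrable_prod_iff' hm.aestronglyMeasurable]
  refine ⟨Filter.Eventually.of_forall fun x => hf.moments (x j) m, ?_⟩
  have hconst : ∀ y : Box L, ∫ ω, |f ω y| ^ m ∂μ = ∫ ω, |f ω 0| ^ m ∂μ := by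
    intro y
    have h := hf.homogeneous y 1 (fun _ => 0)
    have hg : Measurable fun v : Fin 1 → ℝ => |v 0| ^ m := by fun_prop
    have hy : ∀ x : Box L, Measurable fun ω => f ω x := fun x =>
      hf.measurable.comp (measurable_id.prodMk measurable_const)
    have h' := congrArg (fun ρ => ∫ v, |v 0| ^ m ∂ρ) h
    beta_reduce at h'
    rw [integral_map (measurable_pi_lambda _ fun _ => hy _).aemeasurable hg.aestronglyMeasurable,
      integral_map (measurable_pi_lambda _ fun _ => hy _).aemeasurable hg.aestronglyMeasurable] at h'
    simpa using h'
  simp only [Real.norm_eq_abs, abs_pow, abs_abs, hconst]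
  exact integrable_const _

/-- Plane waves have modulus one, so a product of n field values is controlled by n-th moments. This
licenses Fubini for the moments of modes. -/
lemma integrable_field_prod {n : ℕ} (k : Fin n → Wavevector d) :
    Integrable (fun p : Ω × (Fin n → Box L) => ∏ j, ((f p.1 (p.2 j) : ℂ) * planeWave (k j) (p.2 j)))
      (μ.prod volume) := by
  have hm : Measurable fun p : Ω × (Fin n → Box L) =>
      ∏ j, ((f p.1 (p.2 j) : ℂ) * planeWave (k j) (p.2 j)) := by
    refine Finset.measurable_prod _ fun j _ => Measurable.mul ?_ ?_
    · exact Complex.measurable_ofReal.comp (hf.measurable.comp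
        (measurable_fst.prodMk ((measurable_pi_apply j).comp measurable_snd)))
    · exact (continuous_planeWave (k j)).measurable.comp
        ((measurable_pi_apply j).comp measurable_snd)
  refine Integrable.mono' (g := fun p => 1 + ∑ j, |f p.1 (p.2 j)| ^ n)
    ((integrable_const _).add (integrable_finsetSum _ fun j _ =>
      integrable_field_pow_prod hf j n volume)) hm.aestronglyMeasurable
    (Filter.Eventually.of_forall fun p => ?_)
  rw [norm_prod]
  simp only [norm_mul, norm_planeWave, mul_one, Complex.norm_real, Real.norm_eq_abs]
  exact prod_le_one_add_sum_pow _ fun j => abs_nonneg _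

omit hf [IsProbabilityMeasure μ] in
omit [MeasurableSpace Ω] in
lemma prod_fourierMode {n : ℕ} (k : Fin n → Wavevector d) (ω : Ω) :
    ∏ j, fourierMode f (k j) ω = ((Real.sqrt (boxVolume L) : ℝ) : ℂ)⁻¹ ^ n *
      ∫ x : Fin n → Box L, ∏ j, ((f ω (x j) : ℂ) * planeWave (k j) (x j)) := by
  rw [integral_fintype_prod_volume_eq_prod fun (j : Fin n) (x : Box L) =>
    (f ω x : ℂ) * planeWave (k j) x]
  simp only [fourierMode, Finset.prod_mul_distrib, Finset.prod_const, Finset.card_univ,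
    Fintype.card_fin]
  rfl

lemma integrable_prod_fourierMode {n : ℕ} (k : Fin n → Wavevector d) :
    Integrable (fun ω => ∏ j, fourierMode f (k j) ω) μ := by
  simp_rw [prod_fourierMode]
  exact (integrable_field_prod hf k).integral_prod_left.const_mul _

lemma fourierMode_mem_allMoments (k : Wavevector d) : fourierMode f k ∈ allMoments μ := by
  have hm : AEStronglyMeasurable (fourierMode f k) μ := by
    have h := (integrable_prod_fourierMode hf fun _ : Fin 1 => k).aestronglyMeasurable
    simpa using h
  intro p
  rcases Nat.eq_zero_or_pos p with rfl | hp
  · simpa using hm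
  · rw [← integrable_norm_rpow_iff hm (by exact_mod_cast hp.ne') (ENNReal.natCast_ne_top p)]
    have h := (integrable_prod_fourierMode hf fun _ : Fin p => k).norm
    simpa using h

/-- Moments of modes whose wavevectors do not add up to zero vanish. -/
lemma integral_prod_fourierMode_eq_zero {n : ℕ} {k : Fin n → Wavevector d} (hk : ∑ j, k j ≠ 0) :
    ∫ ω, ∏ j, fourierMode f (k j) ω ∂μ = 0 := by
  obtain ⟨y, hy⟩ := exists_planeWave_ne_one (L := L) hk
  simp_rw [prod_fourierMode]
  rw [integral_const_mul, integral_integral_swap (integrable_field_prod hf k)]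
  set F : (Fin n → Box L) → ℂ :=
    fun x => ∫ ω, ∏ j, ((f ω (x j) : ℂ) * planeWave (k j) (x j)) ∂μ with hF
  have hF' : ∀ x, F x = (∫ ω, ∏ j, (f ω (x j) : ℂ) ∂μ) * ∏ j, planeWave (k j) (x j) := by
    intro x
    simp only [hF, Finset.prod_mul_distrib]
    rw [integral_mul_const]
  have hy' : ∀ x : Box L, Measurable fun ω => f ω x := fun x =>
    hf.measurable.comp (measurable_id.prodMk measurable_const)
  -- A common shift of all points leaves the n-point moment unchanged and multiplies the plane waves
  -- by the plane wave of the total wavevector.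
  have hinv : ∀ x, F ((fun _ => y) + x) = planeWave (∑ j, k j) y * F x := by
    intro x
    have h := hf.homogeneous y n x
    have hg : Measurable fun v : Fin n → ℝ => ∏ j, ((v j : ℝ) : ℂ) :=
      Finset.measurable_prod _ fun j _ => Complex.measurable_ofReal.comp (measurable_pi_apply j)
    have h' := congrArg (fun ρ => ∫ v, ∏ j, ((v j : ℝ) : ℂ) ∂ρ) h
    beta_reduce at h'
    rw [integral_map (measurable_pi_lambda _ fun _ => hy' _).aemeasurable hg.aestronglyMeasurable,
      integral_map (measurable_pi_lambda _ fun _ => hy' _).aemeasurable hg.aestronglyMeasurable] at h'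
    rw [hF', hF', planeWave_sum]
    simp only [Pi.add_apply, add_comm y, h', planeWave_add, Finset.prod_mul_distrib]
    ring
  have : (volume : Measure (Fin n → Box L)).IsAddLeftInvariant :=
    Measure.pi.isAddLeftInvariant _
  have h1 := integral_add_left_eq_self (μ := (volume : Measure (Fin n → Box L))) F (fun _ => y)
  simp_rw [hinv] at h1
  rw [integral_const_mul] at h1
  -- The integral equals itself times a number different from one.
  have h2 : ∫ x, F x = 0 := by
    by_contra h0
    exact hy (mul_right_cancel₀ h0 (h1.trans (one_mul _).symm))
  rw [h2, mul_zero]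

lemma integral_prod_finset_fourierMode_eq_zero {n : ℕ} {k : Fin n → Wavevector d}
    {B : Finset (Fin n)} (hk : ∑ j ∈ B, k j ≠ 0) :
    ∫ ω, ∏ j ∈ B, fourierMode f (k j) ω ∂μ = 0 := by
  have h := integral_prod_fourierMode_eq_zero hf (k := fun j : Fin B.card => k (B.equivFin.symm j))
    (by
      rw [B.equivFin.symm.sum_comp fun j : B => k j, Finset.sum_coe_sort B k]
      exact hk)
  rw [← h]
  congr 1 with ω
  rw [B.equivFin.symm.prod_comp fun j : B => fourierMode f (k j) ω,
    Finset.prod_coe_sort B fun j => fourierMode f (k j) ω]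

/-- If the total wavevector is nonzero, every partition has a block with nonzero sum, whose moment
vanishes. -/
lemma jointCumulant_fourierMode_eq_zero {n : ℕ} {k : Fin n → Wavevector d} (hk : ∑ j, k j ≠ 0) :
    jointCumulant μ (fun j => fourierMode f (k j)) = 0 := by
  refine jointCumulant_eq_zero fun π => ?_
  by_contra! h
  apply hk
  have hb : ∑ j, k j = ∑ B ∈ π.parts, ∑ j ∈ B, k j := by
    conv_lhs => rw [← π.biUnion_parts]
    exact Finset.sum_biUnion π.disjoint
  rw [hb]
  refine Finset.sum_eq_zero fun B hB => ?_
  by_contra h0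
  exact h B hB (integral_prod_finset_fourierMode_eq_zero hf h0)

lemma integral_fourierMode_eq_zero {k : Wavevector d} (hk : k ≠ 0) :
    ∫ ω, fourierMode f k ω ∂μ = 0 := by
  simpa using integral_prod_fourierMode_eq_zero hf (k := fun _ : Fin 1 => k) (by simpa using hk)

end Field

end FourierModes

end

noncomputable section

namespace FourierModes

open MeasureTheory MvPolynomial

open scoped ComplexConjugate

/-! ## Symmetries of the normalized polyspectra -/

section Polyspectra

variable {d : ℕ} {L : Fin d → ℝ} [∀ i, Fact (0 < L i)] {Ω : Type*} [MeasurableSpace Ω]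
  {μ : Measure Ω} [IsProbabilityMeasure μ] {f : Ω → Box L → ℝ} (hf : IsHomogeneousField μ f)

lemma boxVolume_pos : 0 < boxVolume L := Finset.prod_pos fun _ _ => Fact.out

omit [IsProbabilityMeasure μ] in
lemma powerSpectrum_nonneg (k : Wavevector d) : 0 ≤ powerSpectrum μ f k :=
  integral_nonneg fun _ => by positivity

omit [IsProbabilityMeasure μ] in
lemma normalizedPolyspectrum_eq_zero {n : ℕ} {k : Fin (n + 1) → Wavevector d}
    (hk : ∑ i, k i ≠ 0) : normalizedPolyspectrum μ f n k = 0 := if_neg hk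

omit [IsProbabilityMeasure μ] in
lemma normalizedPolyspectrum_neg
    (hparity : ∀ (n : ℕ) (q : Fin n → Wavevector d),
      polyspectrum μ f n (fun i => -q i) = polyspectrum μ f n q)
    {n : ℕ} (k : Fin (n + 1) → Wavevector d) :
    normalizedPolyspectrum μ f n (fun i => -k i) = normalizedPolyspectrum μ f n k := by
  simp only [normalizedPolyspectrum, Finset.sum_neg_distrib, neg_eq_zero, powerSpectrum_neg,
    hparity n fun i => k i.castSucc]

include hf

/-- The Kronecker delta is redundant, because the cumulant vanishes by itself off the relation. The
resulting form treats all arguments alike, which gives the permutation symmetry. -/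
lemma normalizedPolyspectrum_eq {m : ℕ} (k : Fin (m + 2) → Wavevector d) :
    normalizedPolyspectrum μ f (m + 1) k = ((Real.sqrt (boxVolume L) ^ m : ℝ) : ℂ) *
      ((∏ j, ((Real.sqrt (powerSpectrum μ f (k j)) : ℝ) : ℂ)⁻¹) *
        jointCumulant μ fun j => fourierMode f (k j)) := by
  by_cases hk : ∑ j, k j = 0
  · have hsnoc : (Fin.snoc (fun i : Fin (m + 1) => k i.castSucc)
        (-∑ j : Fin (m + 1), k j.castSucc) : Fin (m + 2) → Wavevector d) = k := by
      rw [Fin.sum_univ_castSucc, add_eq_zero_iff_eq_neg] at hk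
      rw [hk, neg_neg]
      exact Fin.snoc_init_self k
    have hV : boxVolume L ^ ((((m + 1 : ℕ) : ℝ) + 1) / 2 - 1) = Real.sqrt (boxVolume L) ^ m := by
      rw [Real.sqrt_eq_rpow, ← Real.rpow_natCast, ← Real.rpow_mul boxVolume_pos.le]
      congr 1
      push_cast
      ring
    rw [normalizedPolyspectrum, if_pos hk, polyspectrum, hsnoc, hV,
      Real.sqrt_prod _ fun j _ => powerSpectrum_nonneg (k j), Finset.prod_inv_distrib]
    push_cast
    ring
  · rw [normalizedPolyspectrum_eq_zero hk, jointCumulant_fourierMode_eq_zero hf hk]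
    simp

lemma normalizedPolyspectrum_comp_perm {m : ℕ} (k : Fin (m + 2) → Wavevector d)
    (σ : Equiv.Perm (Fin (m + 2))) :
    normalizedPolyspectrum μ f (m + 1) (fun j => k (σ j)) = normalizedPolyspectrum μ f (m + 1) k := by
  rw [normalizedPolyspectrum_eq hf, normalizedPolyspectrum_eq hf,
    jointCumulant_comp_perm (fun j => fourierMode f (k j)) σ,
    Equiv.prod_comp σ fun j => ((Real.sqrt (powerSpectrum μ f (k j)) : ℝ) : ℂ)⁻¹]

lemma bispec_swap₁₂ (x y z : Wavevector d) : bispec μ f x y z = bispec μ f y x z := by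
  rw [bispec, bispec, ← normalizedPolyspectrum_comp_perm hf ![y, x, z] (Equiv.swap 0 1)]
  congr 1
  funext j
  fin_cases j <;> rfl

lemma bispec_swap₂₃ (x y z : Wavevector d) : bispec μ f x y z = bispec μ f x z y := by
  rw [bispec, bispec, ← normalizedPolyspectrum_comp_perm hf ![x, z, y] (Equiv.swap 1 2)]
  congr 1
  funext j
  fin_cases j <;> rfl

lemma trispec_swap₁₂ (x y z w : Wavevector d) : trispec μ f x y z w = trispec μ f y x z w := by
  rw [trispec, trispec, ← normalizedPolyspectrum_comp_perm hf ![y, x, z, w] (Equiv.swap 0 1)]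
  congr 1
  funext j
  fin_cases j <;> rfl

lemma trispec_swap₂₃ (x y z w : Wavevector d) : trispec μ f x y z w = trispec μ f x z y w := by
  rw [trispec, trispec, ← normalizedPolyspectrum_comp_perm hf ![x, z, y, w] (Equiv.swap 1 2)]
  congr 1
  funext j
  fin_cases j <;> rfl

lemma trispec_swap₃₄ (x y z w : Wavevector d) : trispec μ f x y z w = trispec μ f x y w z := by
  rw [trispec, trispec, ← normalizedPolyspectrum_comp_perm hf ![x, y, w, z] (Equiv.swap 2 3)]
  congr 1
  funext j
  fin_cases j <;> rfl

end Polyspectra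

section Relations

variable {d : ℕ} {L : Fin d → ℝ} [∀ i, Fact (0 < L i)] {Ω : Type*} [MeasurableSpace Ω]
  {μ : Measure Ω} {f : Ω → Box L → ℝ}

lemma bispec_eq_zero {x y z : Wavevector d} (h : x + y + z ≠ 0) : bispec μ f x y z = 0 :=
  normalizedPolyspectrum_eq_zero (by simpa [Fin.sum_univ_three] using h)

lemma trispec_eq_zero {x y z w : Wavevector d} (h : x + y + z + w ≠ 0) :
    trispec μ f x y z w = 0 :=
  normalizedPolyspectrum_eq_zero (by simpa [Fin.sum_univ_four] using h)

lemma bispec_mul_bispec_eq_zero {x y z u v w : Wavevector d}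
    (h : x + y + z = 0 → u + v + w = 0 → False) : bispec μ f x y z * bispec μ f u v w = 0 := by
  by_cases h₁ : x + y + z = 0
  · rw [bispec_eq_zero (h h₁), mul_zero]
  · rw [bispec_eq_zero h₁, zero_mul]

variable (hparity : ∀ (n : ℕ) (q : Fin n → Wavevector d),
  polyspectrum μ f n (fun i => -q i) = polyspectrum μ f n q)

include hparity

lemma bispec_neg (x y z : Wavevector d) : bispec μ f (-x) (-y) (-z) = bispec μ f x y z := by
  rw [bispec, bispec, ← normalizedPolyspectrum_neg hparity ![x, y, z]]
  congr 1
  funext j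
  fin_cases j <;> rfl

lemma trispec_neg (x y z w : Wavevector d) :
    trispec μ f (-x) (-y) (-z) (-w) = trispec μ f x y z w := by
  rw [trispec, trispec, ← normalizedPolyspectrum_neg hparity ![x, y, z, w]]
  congr 1
  funext j
  fin_cases j <;> rfl

end Relations

lemma IsUpperHalf.ne_zero {d : ℕ} {U : Set (Wavevector d)} (hU : IsUpperHalf U)
    {k : Wavevector d} (hk : k ∈ U) : k ≠ 0 := fun h => hU.zero_notMem (h ▸ hk)

lemma IsUpperHalf.sum_mem {d : ℕ} {U : Set (Wavevector d)} (hU : IsUpperHalf U) {n : ℕ}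
    (k : Fin (n + 1) → Wavevector d) (hk : ∀ i, k i ∈ U) : ∑ i, k i ∈ U := by
  induction n with
  | zero => simpa using hk 0
  | succ n ih =>
    rw [Fin.sum_univ_castSucc]
    exact hU.add_mem _ (ih _ fun i => hk _) _ (hk _)

lemma wavevector_eq_of_add_self {d : ℕ} {x y : Wavevector d} (h : x + x = y + y) : x = y := by
  funext i
  have := congrFun h i
  simp only [Pi.add_apply] at this
  omega

section Modes

variable {d : ℕ} {L : Fin d → ℝ} [∀ i, Fact (0 < L i)] {Ω : Type*} [MeasurableSpace Ω]
  (μ : Measure Ω) (f : Ω → Box L → ℝ) {ι : Type*} (k : ι → Wavevector d)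

/-- The couplings `p₃(k_x, k_y, -k_z)`. -/
def sumCoupling (x y z : ι) : ℂ := bispec μ f (k x) (k y) (-k z)

/-- The couplings `p₄(k_x, k_y, k_z, -k_w)`. -/
def sumCoupling₃₁ (x y z w : ι) : ℂ := trispec μ f (k x) (k y) (k z) (-k w)

/-- The couplings `p₄(k_x, k_y, -k_z, -k_w)`. -/
def sumCoupling₂₂ (x y z w : ι) : ℂ := trispec μ f (k x) (k y) (-k z) (-k w)

variable {μ f k}

/-- Each exclusion is linear arithmetic with the relations of the couplings. Either two modes would
coincide, against injectivity, or a sum of modes of the upper half would vanish. Parity enters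
through `r_flip` only. -/
lemma isModeCoupling [IsProbabilityMeasure μ] (hf : IsHomogeneousField μ f)
    (hparity : ∀ (n : ℕ) (q : Fin n → Wavevector d),
      polyspectrum μ f n (fun i => -q i) = polyspectrum μ f n q)
    {U : Set (Wavevector d)} (hU : IsUpperHalf U) (hk : Function.Injective k)
    (hkU : ∀ i, k i ∈ U) :
    IsModeCoupling (sumCoupling μ f k) (sumCoupling₃₁ μ f k) (sumCoupling₂₂ μ f k) where
  b_swap x y z := bispec_swap₁₂ hf _ _ _
  b_self y z := bispec_eq_zero fun h => hU.ne_zero (hkU y) (by rw [← h]; abel)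
  b_same x y u v huv := bispec_mul_bispec_eq_zero fun h₁ h₂ => huv <| hk <| by
    rw [← sub_eq_add_neg, sub_eq_zero] at h₁ h₂
    rw [← h₁, ← h₂]
  b_same' x y u v huv := bispec_mul_bispec_eq_zero fun h₁ h₂ => huv <| hk <| by
    rw [← sub_eq_add_neg, sub_eq_zero] at h₁ h₂
    exact add_left_cancel (h₁.trans h₂.symm)
  b_half x y z hxy := bispec_mul_bispec_eq_zero fun h₁ h₂ => hxy <| hk <| by
    rw [← sub_eq_add_neg, sub_eq_zero] at h₁ h₂
    exact wavevector_eq_of_add_self (h₁.trans h₂.symm)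
  b_opp x y u v := bispec_mul_bispec_eq_zero fun h₁ h₂ =>
    hU.ne_zero (hU.add_mem _ (hkU u) _ (hkU v)) (by
      have : k u + k v = (k x + k u + -k y) + (k y + k v + -k x) := by abel
      rw [this, h₁, h₂, add_zero])
  q_swap x y z w := trispec_swap₁₂ hf _ _ _ _
  q_swap' x y z w := trispec_swap₂₃ hf _ _ _ _
  q_self x y w := trispec_eq_zero fun h => hU.ne_zero (hU.add_mem _ (hkU x) _ (hkU y)) (by
    rw [← h]; abel)
  r_swap x y z w := trispec_swap₁₂ hf _ _ _ _
  -- Parity reverses all four signs; permutations then bring the positive arguments to the front.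
  r_flip x y z w := by
    rw [sumCoupling₂₂, sumCoupling₂₂, ← trispec_neg hparity, neg_neg, neg_neg,
      trispec_swap₂₃ hf, trispec_swap₁₂ hf, trispec_swap₃₄ hf, trispec_swap₂₃ hf,
      trispec_swap₃₄ hf]
  r_cancel x y w hyw := trispec_eq_zero fun h => hyw <| hk <| by
    rw [← sub_eq_zero, ← h]; abel
  r_sq x y hxy := trispec_eq_zero fun h => hxy <| hk <| wavevector_eq_of_add_self <| by
    rw [← sub_eq_zero, ← h]; abel

end Modes

end FourierModes

end

noncomputable section

namespace FourierModes

open MeasureTheory MvPolynomial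

open scoped ComplexConjugate

/-! ## The characteristic function of the modes -/

section Sums

variable {α : Type*} [Fintype α] {M : Type*} [AddCommMonoid M]

lemma sum_fin_succ_arrow {n : ℕ} (g : (Fin (n + 1) → α) → M) :
    ∑ w, g w = ∑ a, ∑ w : Fin n → α, g (Matrix.vecCons a w) := by
  rw [← (Fin.consEquiv fun _ : Fin (n + 1) => α).sum_comp, Fintype.sum_prod_type]
  rfl

lemma sum_arrow₂ (g : (Fin 2 → α) → M) : ∑ w, g w = ∑ a, ∑ b, g ![a, b] := by
  simp only [sum_fin_succ_arrow, Fintype.sum_unique]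
  rfl

lemma sum_arrow₃ (g : (Fin 3 → α) → M) : ∑ w, g w = ∑ a, ∑ b, ∑ c, g ![a, b, c] := by
  simp only [sum_fin_succ_arrow, Fintype.sum_unique]
  rfl

lemma sum_arrow₄ (g : (Fin 4 → α) → M) : ∑ w, g w = ∑ a, ∑ b, ∑ c, ∑ e, g ![a, b, c, e] := by
  simp only [sum_fin_succ_arrow, Fintype.sum_unique]
  rfl

end Sums

section CharSeries

variable {d : ℕ} {L : Fin d → ℝ} [∀ i, Fact (0 < L i)] {Ω : Type*} [MeasurableSpace Ω]
  {μ : Measure Ω} [IsProbabilityMeasure μ] {f : Ω → Box L → ℝ} (hf : IsHomogeneousField μ f)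
  {ι : Type*} [Fintype ι] (k : ι → Wavevector d)

/-- The wavevector of a letter. -/
def letterVector {ι : Type*} (k : ι → Wavevector d) (s : ι × Bool) : Wavevector d :=
  if s.2 then k s.1 else -k s.1

variable (μ f) in
/-- The normalized mode of a letter. -/
def letterMode (s : ι × Bool) : Ω → ℂ :=
  (((Real.sqrt (powerSpectrum μ f (letterVector k s)) : ℝ) : ℂ)⁻¹) •
    fourierMode f (letterVector k s)

-- For each mode, Ka + Lb = (conj J α + J conj α)/2, and f_{-k} = conj f_k turns the conjugate into
-- the mode of the opposite wavevector.
omit [IsProbabilityMeasure μ] in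
lemma pairing_eq_sum_letterMode (J : ι → ℂ) (ω : Ω) :
    -Complex.I * (pairing J (normalizedMode μ f k ω) : ℂ)
      = ∑ s, letter J s * letterMode μ f k s ω := by
  rw [Fintype.sum_prod_type, pairing]
  push_cast
  rw [Finset.mul_sum]
  refine Finset.sum_congr rfl fun i _ => ?_
  rw [Fintype.sum_bool]
  simp only [letter, letterMode, letterVector, if_true, Bool.false_eq_true, if_false,
    powerSpectrum_neg, Pi.smul_apply, fourierMode_neg, smul_eq_mul]
  have h : (((Real.sqrt (powerSpectrum μ f (k i)) : ℝ) : ℂ)⁻¹) * fourierMode f (k i) ω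
      = normalizedMode μ f k ω i := by
    rw [normalizedMode, div_eq_inv_mul]
  have h' : (((Real.sqrt (powerSpectrum μ f (k i)) : ℝ) : ℂ)⁻¹) * conj (fourierMode f (k i) ω)
      = conj (normalizedMode μ f k ω i) := by
    rw [← h, map_mul, map_inv₀, Complex.conj_ofReal]
  rw [h, h']
  generalize normalizedMode μ f k ω i = z
  apply Complex.ext
  · simp
  · simp
    ring

include hf in
omit [Fintype ι] in
lemma letterMode_mem (s : ι × Bool) : letterMode μ f k s ∈ allMoments μ :=
  (allMoments μ).smul_mem _ (fourierMode_mem_allMoments hf _)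

include hf in
omit [Fintype ι] in
lemma jointCumulant_letterMode {m : ℕ} (w : Fin (m + 2) → ι × Bool) :
    ((Real.sqrt (boxVolume L) ^ m : ℝ) : ℂ) * jointCumulant μ (fun j => letterMode μ f k (w j))
      = normalizedPolyspectrum μ f (m + 1) (fun j => letterVector k (w j)) := by
  have h := (cumulantMap μ (m + 2)).map_smul_univ
    (fun j => ((Real.sqrt (powerSpectrum μ f (letterVector k (w j))) : ℝ) : ℂ)⁻¹)
    (fun j => ⟨fourierMode f (letterVector k (w j)), fourierMode_mem_allMoments hf _⟩)
  rw [cumulantMap_apply, cumulantMap_apply] at h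
  rw [normalizedPolyspectrum_eq hf]
  congr 1

-- Multilinearity expands the cumulant of a power of -iX into words of letters. The factor V^{m/2}
-- and the normalization of the modes turn the cumulant of each word into a normalized polyspectrum.
include hf in
lemma logCharCoeff_eq (J : ι → ℂ) (m : ℕ) :
    logCharCoeff μ (boxVolume L) (normalizedMode μ f k) J m = 1 / ((m + 2).factorial : ℂ) *
      ∑ w : Fin (m + 2) → ι × Bool, (∏ j, letter J (w j)) *
        normalizedPolyspectrum μ f (m + 1) (fun j => letterVector k (w j)) := by
  -- This `X` is -i times the linear form, so it absorbs the prefactor (-i)^{m+2}.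
  let X : allMoments μ := ∑ s, letter J s • ⟨letterMode μ f k s, letterMode_mem hf k s⟩
  have hX : (X : Ω → ℂ) = fun ω => -Complex.I * (pairing J (normalizedMode μ f k ω) : ℂ) := by
    funext ω
    rw [pairing_eq_sum_letterMode]
    simp [X, Finset.sum_apply]
  have hp : (Complex.I • X : Ω → ℂ) = fun ω => (pairing J (normalizedMode μ f k ω) : ℂ) := by
    funext ω
    rw [Pi.smul_apply, hX, smul_eq_mul, ← mul_assoc]
    simp
  have h₁ : (-Complex.I) ^ (m + 2) * cumulantOfPairing μ (normalizedMode μ f k) (m + 2) J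
      = cumulantMap μ (m + 2) fun _ => X := by
    have h := (cumulantMap μ (m + 2)).map_smul_univ (fun _ => Complex.I) (fun _ => X)
    rw [cumulantMap_apply] at h
    rw [cumulantOfPairing, ← hp]
    erw [h]
    rw [Finset.prod_const, Finset.card_univ, Fintype.card_fin, smul_eq_mul, ← mul_assoc, ← mul_pow]
    simp
  have h₂ : cumulantMap μ (m + 2) (fun _ => X) = ∑ w : Fin (m + 2) → ι × Bool,
      (∏ j, letter J (w j)) * jointCumulant μ (fun j => letterMode μ f k (w j)) := by
    rw [MultilinearMap.map_sum]
    refine Finset.sum_congr rfl fun w _ => ?_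
    rw [MultilinearMap.map_smul_univ, smul_eq_mul, cumulantMap_apply]
  rw [logCharCoeff]
  simp only [← jointCumulant_letterMode hf]
  have h₃ : ∀ w : Fin (m + 2) → ι × Bool, (∏ j, letter J (w j)) *
      (((Real.sqrt (boxVolume L) ^ m : ℝ) : ℂ) * jointCumulant μ (fun j => letterMode μ f k (w j)))
      = ((Real.sqrt (boxVolume L) ^ m : ℝ) : ℂ) *
        ((∏ j, letter J (w j)) * jointCumulant μ (fun j => letterMode μ f k (w j))) :=
    fun w => by ring
  simp_rw [h₃]
  rw [← Finset.mul_sum, ← h₂, ← h₁]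
  ring

variable (μ f) in
/-- The part of the sum over the letters with given signs. -/
def signSum (J : ι → ℂ) {m : ℕ} (s : Fin (m + 2) → Bool) : ℂ :=
  ∑ i : Fin (m + 2) → ι, (∏ j, letter J (i j, s j)) *
    normalizedPolyspectrum μ f (m + 1) (fun j => letterVector k (i j, s j))

include hf in
lemma logCharCoeff_eq_signSum (J : ι → ℂ) (m : ℕ) :
    logCharCoeff μ (boxVolume L) (normalizedMode μ f k) J m = 1 / ((m + 2).factorial : ℂ) *
      ∑ s : Fin (m + 2) → Bool, signSum μ f k J s := by
  rw [logCharCoeff_eq hf]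
  congr 1
  rw [← (Equiv.arrowProdEquivProdArrow (Fin (m + 2)) (fun _ => ι) (fun _ => Bool)).symm.sum_comp,
    Fintype.sum_prod_type_right]
  rfl

-- By the symmetry of the polyspectra, only the number of conjugated letters matters.
include hf in
lemma signSum_comp_perm (J : ι → ℂ) {m : ℕ} (s : Fin (m + 2) → Bool)
    (σ : Equiv.Perm (Fin (m + 2))) :
    signSum μ f k J (fun j => s (σ j)) = signSum μ f k J s := by
  rw [signSum, signSum, ← (Equiv.arrowCongr σ.symm (Equiv.refl ι)).sum_comp]
  refine Finset.sum_congr rfl fun i _ => ?_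
  rw [← normalizedPolyspectrum_comp_perm hf (fun j => letterVector k (i j, s j)) σ,
    ← Equiv.prod_comp σ fun j => letter J (i j, s j)]
  rfl

-- Wavevectors of equal sign add up to an element of the upper half or to its negative, hence not to
-- zero.
omit [IsProbabilityMeasure μ] in
lemma signSum_const {U : Set (Wavevector d)} (hU : IsUpperHalf U) (hkU : ∀ i, k i ∈ U)
    (J : ι → ℂ) {m : ℕ} (β : Bool) : signSum μ f k J (fun _ : Fin (m + 2) => β) = 0 := by
  refine Finset.sum_eq_zero fun i _ => ?_
  have h := hU.ne_zero (hU.sum_mem (fun j => k (i j)) fun j => hkU _)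
  rw [normalizedPolyspectrum_eq_zero, mul_zero]
  cases β <;> simpa [letterVector] using h

include hf in
lemma normalizedPolyspectrum_self {x : Wavevector d} (hx : x ≠ 0) (hP : powerSpectrum μ f x ≠ 0) :
    normalizedPolyspectrum μ f 1 ![x, -x] = 1 := by
  have h₁ : ∏ j : Fin 2, ((Real.sqrt (powerSpectrum μ f (![x, -x] j)) : ℝ) : ℂ)⁻¹
      = ((powerSpectrum μ f x : ℝ) : ℂ)⁻¹ := by
    rw [Fin.prod_univ_two]
    simp only [Matrix.cons_val_zero, Matrix.cons_val_one, powerSpectrum_neg]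
    rw [← mul_inv, ← Complex.ofReal_mul, Real.mul_self_sqrt (powerSpectrum_nonneg _)]
  have h₂ : jointCumulant μ (fun j : Fin 2 => fourierMode f (![x, -x] j))
      = ((powerSpectrum μ f x : ℝ) : ℂ) := by
    rw [jointCumulant_two]
    · simp only [Matrix.cons_val_zero, Matrix.cons_val_one, fourierMode_neg, Complex.mul_conj,
        Complex.normSq_eq_norm_sq]
      rw [integral_complex_ofReal]
      rfl
    · exact integral_fourierMode_eq_zero hf hx
  have hP' : ((powerSpectrum μ f x : ℝ) : ℂ) ≠ 0 := by exact_mod_cast hP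
  refine (normalizedPolyspectrum_eq hf (m := 0) ![x, -x]).trans
    ((congrArg₂ (· * ·) rfl (congrArg₂ (· * ·) h₁ h₂)).trans ?_)
  simp [hP']

omit [IsProbabilityMeasure μ] in
lemma signSum_zero_eq (J : ι → ℂ) (s t : Bool) :
    signSum μ f k J (m := 0) ![s, t] = ∑ x, ∑ y, letter J (x, s) * letter J (y, t) *
      normalizedPolyspectrum μ f 1 ![letterVector k (x, s), letterVector k (y, t)] := by
  refine (sum_arrow₂ _).trans ?_
  refine Finset.sum_congr rfl fun x _ => Finset.sum_congr rfl fun y _ =>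
    congrArg₂ (· * ·) (Fin.prod_univ_two _) (congrArg _ ?_)
  funext j
  fin_cases j <;> rfl

omit [IsProbabilityMeasure μ] in
lemma signSum_one_eq (J : ι → ℂ) (s t u : Bool) :
    signSum μ f k J (m := 1) ![s, t, u] = ∑ x, ∑ y, ∑ z,
      letter J (x, s) * letter J (y, t) * letter J (z, u) *
      bispec μ f (letterVector k (x, s)) (letterVector k (y, t)) (letterVector k (z, u)) := by
  refine (sum_arrow₃ _).trans ?_
  refine Finset.sum_congr rfl fun x _ => Finset.sum_congr rfl fun y _ =>
    Finset.sum_congr rfl fun z _ => congrArg₂ (· * ·) (Fin.prod_univ_three _) (congrArg _ ?_)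
  funext j
  fin_cases j <;> rfl

omit [IsProbabilityMeasure μ] in
lemma signSum_two_eq (J : ι → ℂ) (s t u v : Bool) :
    signSum μ f k J (m := 2) ![s, t, u, v] = ∑ x, ∑ y, ∑ z, ∑ w,
      letter J (x, s) * letter J (y, t) * letter J (z, u) * letter J (w, v) *
      trispec μ f (letterVector k (x, s)) (letterVector k (y, t)) (letterVector k (z, u))
        (letterVector k (w, v)) := by
  refine (sum_arrow₄ _).trans ?_
  refine Finset.sum_congr rfl fun x _ => Finset.sum_congr rfl fun y _ =>
    Finset.sum_congr rfl fun z _ => Finset.sum_congr rfl fun w _ =>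
    congrArg₂ (· * ·) (Fin.prod_univ_four _) (congrArg _ ?_)
  funext j
  fin_cases j <;> rfl

include hf in
lemma signSum_eq_of_perm (J : ι → ℂ) {m : ℕ} {s t : Fin (m + 2) → Bool}
    (σ : Equiv.Perm (Fin (m + 2))) (h : (fun j => t (σ j)) = s) :
    signSum μ f k J s = signSum μ f k J t := by
  rw [← h, signSum_comp_perm hf]

-- The two signs must differ, and then the two modes must coincide: distinct modes are uncorrelated
-- at second order and each has unit power. The two orders of the letters cancel the 1/2!.
include hf in
lemma logCharCoeff_zero {U : Set (Wavevector d)} (hU : IsUpperHalf U) (hk : Function.Injective k)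
    (hkU : ∀ i, k i ∈ U) (hP : ∀ i, powerSpectrum μ f (k i) ≠ 0) (J : ι → ℂ) :
    logCharCoeff μ (boxVolume L) (normalizedMode μ f k) J 0 = ∑ i, -(‖J i‖ : ℂ) ^ 2 / 4 := by
  have hs : signSum μ f k J (m := 0) ![true, false] = ∑ i, -(‖J i‖ : ℂ) ^ 2 / 4 := by
    rw [signSum_zero_eq]
    refine Finset.sum_congr rfl fun x _ => ?_
    rw [Finset.sum_eq_single x]
    · have h := normalizedPolyspectrum_self hf (hU.ne_zero (hkU x)) (hP x)
      simp only [letterVector, letter, if_true, Bool.false_eq_true, if_false, h, mul_one]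
      rw [← Complex.conj_mul']
      linear_combination (conj (J x) * J x / 4) * Complex.I_sq
    · intro y _ hy
      rw [normalizedPolyspectrum_eq_zero, mul_zero]
      rw [Fin.sum_univ_two]
      intro h
      exact hy (hk (sub_eq_zero.1 ((sub_eq_add_neg _ _).trans h)).symm)
    · simp
  have hs' : signSum μ f k J (m := 0) ![false, true] = signSum μ f k J (m := 0) ![true, false] :=
    signSum_eq_of_perm hf k J (Equiv.swap 0 1) (by decide)
  have h₁ : signSum μ f k J (m := 0) ![true, true] = 0 := by
    refine (congrArg _ ?_).trans (signSum_const k hU hkU J (m := 0) true)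
    decide
  have h₂ : signSum μ f k J (m := 0) ![false, false] = 0 := by
    refine (congrArg _ ?_).trans (signSum_const k hU hkU J (m := 0) false)
    decide
  have h := sum_arrow₂ fun s : Fin 2 → Bool => signSum μ f k J (m := 0) s
  simp only [Fintype.sum_bool, hs, hs', h₁, h₂] at h
  refine (logCharCoeff_eq_signSum hf k J 0).trans ((congrArg (_ * ·) h).trans ?_)
  rw [show (((0 + 2 : ℕ)).factorial : ℂ) = 2 by norm_num [Nat.factorial]]
  ring

variable (hparity : ∀ (n : ℕ) (q : Fin n → Wavevector d),
  polyspectrum μ f n (fun i => -q i) = polyspectrum μ f n q)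

include hf hparity

/-- The six mixed sign patterns form two classes of three, hence the weight 3/3! = 1/2 in
`cubicTerm`. Parity identifies the coefficients of the two classes. -/
lemma logCharCoeff_one {U : Set (Wavevector d)} (hU : IsUpperHalf U) (hkU : ∀ i, k i ∈ U)
    (J : ι → ℂ) :
    logCharCoeff μ (boxVolume L) (normalizedMode μ f k) J 1
      = eval (letter J) (cubic (sumCoupling μ f k) Finset.univ) := by
  have e₁ : signSum μ f k J (m := 1) ![true, true, true] = 0 := by
    refine (congrArg _ ?_).trans (signSum_const k hU hkU J (m := 1) true)
    decide
  have e₂ : signSum μ f k J (m := 1) ![false, false, false] = 0 := by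
    refine (congrArg _ ?_).trans (signSum_const k hU hkU J (m := 1) false)
    decide
  have h := sum_arrow₃ fun s : Fin 3 → Bool => signSum μ f k J (m := 1) s
  simp only [Fintype.sum_bool] at h
  rw [e₁, e₂,
    signSum_eq_of_perm hf k J (s := ![true, false, true]) (t := ![true, true, false])
      (Equiv.swap 1 2) (by decide),
    signSum_eq_of_perm hf k J (s := ![false, true, true]) (t := ![true, true, false])
      (Equiv.swap 0 2) (by decide),
    signSum_eq_of_perm hf k J (s := ![false, true, false]) (t := ![false, false, true])
      (Equiv.swap 1 2) (by decide),
    signSum_eq_of_perm hf k J (s := ![true, false, false]) (t := ![false, false, true])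
      (Equiv.swap 0 2) (by decide)] at h
  have h₃ : eval (letter J) (cubic (sumCoupling μ f k) Finset.univ)
      = 1 / 2 * (signSum μ f k J (m := 1) ![true, true, false]
        + signSum μ f k J (m := 1) ![false, false, true]) := by
    rw [signSum_one_eq, signSum_one_eq]
    simp only [cubic, map_sum, ← Finset.sum_add_distrib, Finset.mul_sum]
    refine Finset.sum_congr rfl fun x _ => Finset.sum_congr rfl fun y _ =>
      Finset.sum_congr rfl fun z _ => ?_
    have hn := bispec_neg hparity (k x) (k y) (-k z)
    rw [neg_neg] at hn
    simp only [cubicTerm, mon₃, up, dn, map_mul, map_add, eval_C, eval_X, letterVector, if_true,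
      Bool.false_eq_true, if_false, hn, sumCoupling]
    ring
  refine (logCharCoeff_eq_signSum hf k J 1).trans ((congrArg (_ * ·) h).trans ?_)
  rw [h₃, show (((1 + 2 : ℕ)).factorial : ℂ) = 6 by norm_num [Nat.factorial]]
  ring

/-- Of the fourteen mixed sign patterns, four have one conjugate and four have three, with weight
4/4! = 1/6. The six balanced ones have weight 6/4! = 1/4, divided equally between the patterns ++--
and --++ as 1/8 each. -/
lemma logCharCoeff_two {U : Set (Wavevector d)} (hU : IsUpperHalf U) (hkU : ∀ i, k i ∈ U)
    (J : ι → ℂ) :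
    logCharCoeff μ (boxVolume L) (normalizedMode μ f k) J 2
      = eval (letter J) (quartic (sumCoupling₃₁ μ f k) (sumCoupling₂₂ μ f k) Finset.univ) := by
  have e₁ : signSum μ f k J (m := 2) ![true, true, true, true] = 0 := by
    refine (congrArg _ ?_).trans (signSum_const k hU hkU J (m := 2) true)
    decide
  have e₂ : signSum μ f k J (m := 2) ![false, false, false, false] = 0 := by
    refine (congrArg _ ?_).trans (signSum_const k hU hkU J (m := 2) false)
    decide
  have e₃ : signSum μ f k J (m := 2) ![false, false, true, true]
      = signSum μ f k J (m := 2) ![true, true, false, false] :=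
    signSum_eq_of_perm hf k J (Equiv.swap 0 2 * Equiv.swap 1 3) (by decide)
  have h := sum_arrow₄ fun s : Fin 4 → Bool => signSum μ f k J (m := 2) s
  simp only [Fintype.sum_bool] at h
  rw [e₁, e₂, e₃,
    signSum_eq_of_perm hf k J (s := ![true, true, false, true]) (t := ![true, true, true, false])
      (Equiv.swap 2 3) (by decide),
    signSum_eq_of_perm hf k J (s := ![true, false, true, true]) (t := ![true, true, true, false])
      (Equiv.swap 1 3) (by decide),
    signSum_eq_of_perm hf k J (s := ![false, true, true, true]) (t := ![true, true, true, false])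
      (Equiv.swap 0 3) (by decide),
    signSum_eq_of_perm hf k J (s := ![false, false, true, false]) (t := ![false, false, false, true])
      (Equiv.swap 2 3) (by decide),
    signSum_eq_of_perm hf k J (s := ![false, true, false, false]) (t := ![false, false, false, true])
      (Equiv.swap 1 3) (by decide),
    signSum_eq_of_perm hf k J (s := ![true, false, false, false]) (t := ![false, false, false, true])
      (Equiv.swap 0 3) (by decide),
    signSum_eq_of_perm hf k J (s := ![true, false, true, false]) (t := ![true, true, false, false])
      (Equiv.swap 1 2) (by decide),
    signSum_eq_of_perm hf k J (s := ![true, false, false, true]) (t := ![true, true, false, false])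
      (Equiv.swap 1 3) (by decide),
    signSum_eq_of_perm hf k J (s := ![false, true, true, false]) (t := ![true, true, false, false])
      (Equiv.swap 0 2) (by decide),
    signSum_eq_of_perm hf k J (s := ![false, true, false, true]) (t := ![true, true, false, false])
      (Equiv.swap 0 3) (by decide)] at h
  have h₅ : eval (letter J) (quartic (sumCoupling₃₁ μ f k) (sumCoupling₂₂ μ f k) Finset.univ)
      = 1 / 6 * (signSum μ f k J (m := 2) ![true, true, true, false]
          + signSum μ f k J (m := 2) ![false, false, false, true])
        + 1 / 8 * (signSum μ f k J (m := 2) ![true, true, false, false]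
          + signSum μ f k J (m := 2) ![false, false, true, true]) := by
    rw [signSum_two_eq, signSum_two_eq, signSum_two_eq, signSum_two_eq]
    simp only [quartic, quadSum, map_add, map_sum, ← Finset.sum_add_distrib, Finset.mul_sum]
    refine Finset.sum_congr rfl fun x _ => Finset.sum_congr rfl fun y _ =>
      Finset.sum_congr rfl fun z _ => Finset.sum_congr rfl fun w _ => ?_
    have hn := trispec_neg hparity (k x) (k y) (k z) (-k w)
    have hn' := trispec_neg hparity (k x) (k y) (-k z) (-k w)
    rw [neg_neg] at hn hn'
    rw [neg_neg] at hn'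
    simp only [quarticTerm₃₁, quarticTerm₂₂, mon₃₁, mon₂₂, up, dn, map_mul, map_add, eval_C, eval_X,
      letterVector, if_true, Bool.false_eq_true, if_false, hn, hn', sumCoupling₃₁, sumCoupling₂₂]
    ring
  refine (logCharCoeff_eq_signSum hf k J 2).trans ((congrArg (_ * ·) h).trans ?_)
  rw [h₅, e₃, show (((2 + 2 : ℕ)).factorial : ℂ) = 24 by norm_num [Nat.factorial]]
  ring

end CharSeries

end FourierModes

end

noncomputable section

namespace FourierModes

open MeasureTheory MvPolynomial

open scoped ComplexConjugate

/-! ## The distributions as formal series -/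

section OrderPoly

variable {ι : Type*} [Fintype ι] [DecidableEq ι]

/-- The polynomial of order `n ≤ 2` of the characteristic function of the modes in `T`. -/
def orderPoly (b : ι → ι → ι → ℂ) (q r : ι → ι → ι → ι → ℂ) (T : Finset ι) :
    ℕ → MvPolynomial (ι × Bool) ℂ
  | 0 => 1
  | 1 => cubic b T
  | _ => secondOrder b q r T

omit [Fintype ι] in
lemma restrict_up (T : Finset ι) (i : ι) : restrict T (up i) = if i ∈ T then up i else 0 := by
  rw [restrict, up, aeval_X]

omit [Fintype ι] in
lemma restrict_dn (T : Finset ι) (i : ι) : restrict T (dn i) = if i ∈ T then dn i else 0 := by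
  rw [restrict, dn, aeval_X]

lemma restrict_cubic (b : ι → ι → ι → ℂ) (T : Finset ι) :
    restrict T (cubic b Finset.univ) = cubic b T := by
  have h : ∀ x y z, restrict T (cubicTerm b x y z)
      = if x ∈ T then if y ∈ T then if z ∈ T then cubicTerm b x y z else 0 else 0 else 0 := by
    intro x y z
    simp only [cubicTerm, mon₃, map_mul, map_add, restrict_up, restrict_dn, algHom_C,
      algebraMap_eq]
    split_ifs <;> simp
  simp only [cubic, map_sum, h]
  simp only [Finset.sum_ite_irrel, Finset.sum_const_zero, Finset.sum_ite_mem, Finset.univ_inter]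

lemma restrict_quadSum {g : ι → ι → ι → ι → MvPolynomial (ι × Bool) ℂ} {T : Finset ι}
    (h : ∀ x y z w, restrict T (g x y z w) = if x ∈ T then if y ∈ T then if z ∈ T then
      if w ∈ T then g x y z w else 0 else 0 else 0 else 0) :
    restrict T (quadSum g Finset.univ) = quadSum g T := by
  simp only [quadSum, map_sum, h]
  simp only [Finset.sum_ite_irrel, Finset.sum_const_zero, Finset.sum_ite_mem, Finset.univ_inter]

lemma restrict_quartic (q r : ι → ι → ι → ι → ℂ) (T : Finset ι) :
    restrict T (quartic q r Finset.univ) = quartic q r T := by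
  rw [quartic, map_add, restrict_quadSum, restrict_quadSum]
  · rfl
  · intro x y z w
    simp only [quarticTerm₂₂, mon₂₂, map_mul, map_add, restrict_up, restrict_dn, algHom_C,
      algebraMap_eq]
    split_ifs <;> simp
  · intro x y z w
    simp only [quarticTerm₃₁, mon₃₁, map_mul, map_add, restrict_up, restrict_dn, algHom_C,
      algebraMap_eq]
    split_ifs <;> simp

lemma restrict_orderPoly (b : ι → ι → ι → ℂ) (q r : ι → ι → ι → ι → ℂ) (T : Finset ι) (n : ℕ) :
    restrict T (orderPoly b q r Finset.univ n) = orderPoly b q r T n := by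
  match n with
  | 0 => exact map_one _
  | 1 => exact restrict_cubic b T
  | n + 2 =>
    change restrict T (secondOrder b q r Finset.univ) = secondOrder b q r T
    rw [secondOrder, map_add, map_mul, map_pow, restrict_cubic, restrict_quartic, algHom_C,
      algebraMap_eq]
    rfl

end OrderPoly

/-- The weights of the modes at given moduli and phases. -/
def modeWeight {ι : Type*} (A θ : ι → ℝ) (i : ι) (p q : ℕ) : ℂ :=
  complexHermite p q ((A i : ℂ) * Complex.exp (Complex.I * (θ i : ℂ)))

lemma modeWeight_zero {ι : Type*} (A θ : ι → ℝ) (i : ι) : modeWeight A θ i 0 0 = 1 := by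
  simp [modeWeight, complexHermite]

lemma phaseWeight_zero {ι : Type*} (θ : ι → ℝ) (i : ι) : phaseWeight θ i 0 0 = 1 := by
  rw [phaseWeight, radialMean_radialHermite_self]
  simp

/-- The Gaussian distribution of the moduli and phases in `T`. -/
def gaussWeight {ι : Type*} (T : Finset ι) (A : ι → ℝ) : ℂ :=
  ∏ i ∈ T, ((A i : ℂ) * ((Real.pi : ℂ)⁻¹ * Complex.exp (-(A i : ℂ) ^ 2)))

section Distribution

variable {d : ℕ} {L : Fin d → ℝ} [∀ i, Fact (0 < L i)] {Ω : Type*} [MeasurableSpace Ω]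
  {μ : Measure Ω} [IsProbabilityMeasure μ] {f : Ω → Box L → ℝ} (hf : IsHomogeneousField μ f)
  (hparity : ∀ (n : ℕ) (q : Fin n → Wavevector d),
    polyspectrum μ f n (fun i => -q i) = polyspectrum μ f n q)
  {U : Set (Wavevector d)} (hU : IsUpperHalf U)
  {ι : Type*} [Fintype ι] [DecidableEq ι] {k : ι → Wavevector d} (hk : Function.Injective k)
  (hkU : ∀ i, k i ∈ U) (hP : ∀ i, powerSpectrum μ f (k i) ≠ 0)

variable (μ f k) in
/-- The polynomial of order `n ≤ 2` of the characteristic function of the modes in `T`. -/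
def modePoly (T : Finset ι) (n : ℕ) : MvPolynomial (ι × Bool) ℂ :=
  orderPoly (sumCoupling μ f k) (sumCoupling₃₁ μ f k) (sumCoupling₂₂ μ f k) T n

include hf hparity hU hk hkU hP

-- The order two of the exponential collects the quartic coupling from E and half the square of the
-- cubic one from E²/2. Higher orders are excluded by `n < 3`, since `orderPoly` does not describe
-- them.
omit [DecidableEq ι] in
lemma coeff_charSeries (J : ι → ℂ) {n : ℕ} (hn : n < 3) :
    PowerSeries.coeff n (charSeries μ (boxVolume L) (normalizedMode μ f k) J)
      = Complex.exp (∑ i, -(‖J i‖ : ℂ) ^ 2 / 4) *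
        eval (letter J) (modePoly μ f k Finset.univ n) := by
  rw [charSeries, PowerSeries.coeff_mk, logCharCoeff_zero hf k hU hk hkU hP]
  congr 1
  have h₁ := logCharCoeff_one hf k hparity hU hkU J
  have h₂ := logCharCoeff_two hf k hparity hU hkU J
  interval_cases n
  · simp [modePoly, orderPoly]
  · simp [Finset.sum_range_succ, PowerSeries.coeff_one, h₁, modePoly, orderPoly]
  · simp [Finset.sum_range_succ, PowerSeries.coeff_one, h₁, h₂, modePoly, orderPoly, secondOrder,
      pow_two, PowerSeries.coeff_mul, Finset.Nat.antidiagonal_succ]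
    ring

omit [DecidableEq ι] in
lemma polarDensityCoeff_eq {n : ℕ} (hn : n < 3) (A θ : ι → ℝ) :
    polarDensityCoeff μ (boxVolume L) (normalizedMode μ f k) n A θ
      = polarWick (modePoly μ f k Finset.univ n) A θ := by
  rw [polarDensityCoeff, densityCoeff]
  simp_rw [coeff_charSeries hf hparity hU hk hkU hP _ hn]
  rw [(integral_fourier_wick _ _).2, gaussDensity, polarWick, ← mul_assoc, ← Finset.prod_mul_distrib]
  congr 1
  refine Finset.prod_congr rfl fun i _ => ?_
  have h : ‖(A i : ℂ) * Complex.exp (Complex.I * (θ i : ℂ))‖ = |A i| := by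
    rw [norm_mul, mul_comm Complex.I, Complex.norm_exp_ofReal_mul_I, mul_one, Complex.norm_real,
      Real.norm_eq_abs]
  rw [h, ← Complex.ofReal_pow, sq_abs, Complex.ofReal_pow]

lemma coeff_pointDist_eq_marginalWick (T : Finset ι) {n : ℕ} (hn : n < 3) (A θ : ι → ℝ) :
    PowerSeries.coeff n (pointDist μ f k T A θ)
      = marginalWick T (modePoly μ f k Finset.univ n) A θ := by
  rw [pointDist, PowerSeries.coeff_mk]
  simp_rw [polarDensityCoeff_eq hf hparity hU hk hkU hP hn]
  exact (integral_polarWick T _ A θ).2.2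

lemma coeff_pointDist (T : Finset ι) {n : ℕ} (hn : n < 3) (A θ : ι → ℝ) :
    PowerSeries.coeff n (pointDist μ f k T A θ)
      = gaussWeight T A * wick (modeWeight A θ) (modePoly μ f k T n) := by
  rw [coeff_pointDist_eq_marginalWick hf hparity hU hk hkU hP T hn, marginalWick, gaussWeight]
  congr 1
  refine (wick_marginalWeight T (φ := modeWeight A θ) (modeWeight_zero A θ) _).trans ?_
  rw [modePoly, restrict_orderPoly]
  rfl

lemma coeff_phaseDist (T : Finset ι) {n : ℕ} (hn : n < 3) (θ : ι → ℝ) :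
    PowerSeries.coeff n (phaseDist μ f k T θ)
      = (1 / (2 * Real.pi : ℂ)) ^ T.card * wick (phaseWeight θ) (modePoly μ f k T n) := by
  rw [phaseDist, PowerSeries.coeff_mk]
  simp_rw [coeff_pointDist_eq_marginalWick hf hparity hU hk hkU hP T hn]
  rw [(integral_marginalWick T _ θ).2, wick_marginalWeight T (phaseWeight_zero θ), modePoly,
    restrict_orderPoly]
  rfl

end Distribution

end FourierModes

end

noncomputable section

namespace FourierModes

open MeasureTheory MvPolynomial

/-! ## Formal series up to second order -/

/-- The coefficients of a formal series up to second order. -/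
def HasJet (F : PowerSeries ℂ) (a b c : ℂ) : Prop :=
  PowerSeries.coeff 0 F = a ∧ PowerSeries.coeff 1 F = b ∧ PowerSeries.coeff 2 F = c

namespace HasJet

variable {F G : PowerSeries ℂ} {a b c a' b' c' : ℂ}

lemma congr (h : HasJet F a b c) (ha : a = a') (hb : b = b') (hc : c = c') :
    HasJet F a' b' c' := ha ▸ hb ▸ hc ▸ h

lemma add (hF : HasJet F a b c) (hG : HasJet G a' b' c') :
    HasJet (F + G) (a + a') (b + b') (c + c') := by
  obtain ⟨rfl, rfl, rfl⟩ := hF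
  obtain ⟨rfl, rfl, rfl⟩ := hG
  simp only [HasJet, map_add, and_self]

lemma sub (hF : HasJet F a b c) (hG : HasJet G a' b' c') :
    HasJet (F - G) (a - a') (b - b') (c - c') := by
  obtain ⟨rfl, rfl, rfl⟩ := hF
  obtain ⟨rfl, rfl, rfl⟩ := hG
  simp only [HasJet, map_sub, and_self]

lemma mul (hF : HasJet F a b c) (hG : HasJet G a' b' c') :
    HasJet (F * G) (a * a') (a * b' + b * a') (a * c' + b * b' + c * a') := by
  obtain ⟨rfl, rfl, rfl⟩ := hF
  obtain ⟨rfl, rfl, rfl⟩ := hG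
  refine ⟨?_, ?_, ?_⟩ <;>
  simp [PowerSeries.coeff_mul, Finset.Nat.antidiagonal_succ, add_assoc]

lemma one : HasJet 1 1 0 0 := by
  simp [HasJet, PowerSeries.coeff_one]

lemma C_mul (hF : HasJet F a b c) (x : ℂ) : HasJet (PowerSeries.C x * F) (x * a) (x * b) (x * c) := by
  obtain ⟨rfl, rfl, rfl⟩ := hF
  simp only [HasJet, PowerSeries.coeff_C_mul, and_self]

/-- Series without a term of first order suffice: they are the products of one-mode distributions,
since a mode has no cubic coupling with itself. -/
lemma inv (hF : HasJet F a 0 (a * c)) (ha : a ≠ 0) : HasJet F⁻¹ a⁻¹ 0 (-(a⁻¹ * c)) := by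
  have h : F * F⁻¹ = 1 := PowerSeries.mul_inv_cancel F (by
    rw [← PowerSeries.coeff_zero_eq_constantCoeff_apply, hF.1]; exact ha)
  have hm := hF.mul (G := F⁻¹) ⟨rfl, rfl, rfl⟩
  rw [h] at hm
  have h0 := hm.1.symm.trans one.1
  have h1 := hm.2.1.symm.trans one.2.1
  have h2 := hm.2.2.symm.trans one.2.2
  have e0 : PowerSeries.coeff 0 F⁻¹ = a⁻¹ := eq_inv_of_mul_eq_one_right h0
  refine ⟨e0, ?_, ?_⟩
  · simpa [ha] using h1
  · rw [e0] at h2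
    field_simp at h2 ⊢
    linear_combination h2

lemma mul_inv {u v s : ℂ} (hF : HasJet F a (a * u) (a * v)) (hG : HasJet G a 0 (a * s))
    (ha : a ≠ 0) : HasJet (F * G⁻¹) 1 u (v - s) := by
  refine (hF.mul (hG.inv ha)).congr ?_ ?_ ?_
  · field_simp
  · field_simp
    ring
  · field_simp
    ring

lemma upToSecondOrder (h : HasJet F 0 b c) : UpToSecondOrder F b c := by
  rw [UpToSecondOrder, PowerSeries.X_pow_dvd_iff]
  intro m hm
  obtain ⟨h0, h1, h2⟩ := h
  interval_cases m
  · simpa using h0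
  · simp [PowerSeries.coeff_X_pow, h1]
  · simp [PowerSeries.coeff_X_pow, h2]

end HasJet

section Reduced

variable {d : ℕ} {L : Fin d → ℝ} [∀ i, Fact (0 < L i)] {Ω : Type*} [MeasurableSpace Ω]
  {μ : Measure Ω} [IsProbabilityMeasure μ] {f : Ω → Box L → ℝ} (hf : IsHomogeneousField μ f)
  (hparity : ∀ (n : ℕ) (q : Fin n → Wavevector d),
    polyspectrum μ f n (fun i => -q i) = polyspectrum μ f n q)
  {U : Set (Wavevector d)} (hU : IsUpperHalf U)
  {ι : Type*} [Fintype ι] [DecidableEq ι] {k : ι → Wavevector d} (hk : Function.Injective k)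
  (hkU : ∀ i, k i ∈ U) (hP : ∀ i, powerSpectrum μ f (k i) ≠ 0)

omit [Fintype ι] [DecidableEq ι] in
lemma gaussWeight_ne_zero {A : ι → ℝ} (hA : ∀ i, 0 < A i) (T : Finset ι) : gaussWeight T A ≠ 0 := by
  refine Finset.prod_ne_zero_iff.2 fun i _ => mul_ne_zero ?_ (mul_ne_zero ?_ (Complex.exp_ne_zero _))
  · exact_mod_cast (hA i).ne'
  · exact inv_ne_zero (by exact_mod_cast Real.pi_ne_zero)

variable (μ f k) in
/-- The order `n ≤ 2` of the distribution of the modes in `T`, for given weights of the modes. -/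
def modeOrder (φ : ι → ℕ → ℕ → ℂ) (T : Finset ι) (n : ℕ) : ℂ := wick φ (modePoly μ f k T n)

include hf hparity hU hk hkU hP

lemma hasJet_pointDist (T : Finset ι) (A θ : ι → ℝ) :
    HasJet (pointDist μ f k T A θ) (gaussWeight T A)
      (gaussWeight T A * modeOrder μ f k (modeWeight A θ) T 1)
      (gaussWeight T A * modeOrder μ f k (modeWeight A θ) T 2) := by
  have h := fun n hn => coeff_pointDist hf hparity hU hk hkU hP T (n := n) hn A θ
  refine ⟨?_, h 1 (by norm_num), h 2 (by norm_num)⟩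
  rw [h 0 (by norm_num)]
  have h1 : wick (modeWeight A θ) (1 : MvPolynomial (ι × Bool) ℂ) = 1 := by
    simpa using wick_prod (modeWeight_zero A θ) ∅ (fun _ => 0) (fun _ => 0)
  rw [modePoly, orderPoly, h1, mul_one]

lemma hasJet_pointDist_singleton (a : ι) (A θ : ι → ℝ) :
    HasJet (pointDist μ f k {a} A θ) (gaussWeight {a} A) 0
      (gaussWeight {a} A * modeOrder μ f k (modeWeight A θ) {a} 2) := by
  have h := hasJet_pointDist hf hparity hU hk hkU hP {a} A θ
  refine h.congr rfl ?_ rfl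
  change _ * wick _ (cubic _ _) = 0
  rw [wick_cubic_singleton _ (isModeCoupling hf hparity hU hk hkU), mul_zero]

lemma hasJet_R₂ {A : ι → ℝ} (hA : ∀ i, 0 < A i) (θ : ι → ℝ) {a b : ι} (hab : a ≠ b) :
    HasJet (R₂ μ f k a b A θ) 0 (modeOrder μ f k (modeWeight A θ) {a, b} 1)
      (modeOrder μ f k (modeWeight A θ) {a, b} 2
        - (modeOrder μ f k (modeWeight A θ) {a} 2 + modeOrder μ f k (modeWeight A θ) {b} 2)) := by
  have h₁ := hasJet_pointDist_singleton hf hparity hU hk hkU hP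
  have h₂ := hasJet_pointDist hf hparity hU hk hkU hP {a, b} A θ
  have hg : gaussWeight {a, b} A = gaussWeight {a} A * gaussWeight {b} A := by
    simp only [gaussWeight, Finset.prod_pair hab, Finset.prod_singleton]
  refine ((h₂.mul_inv (((h₁ a A θ).mul (h₁ b A θ)).congr hg.symm ?_ ?_)
    (gaussWeight_ne_zero hA _)).sub HasJet.one).congr (sub_self 1) (sub_zero _) (sub_zero _)
  · ring
  · rw [hg]
    ring

/-- The denominator contributes minus each one-mode term, and each of them returns twice from the
subtracted R₂'s. The net coefficients are those of inclusion-exclusion. -/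
lemma hasJet_R₃ {A : ι → ℝ} (hA : ∀ i, 0 < A i) (θ : ι → ℝ) {m : Fin 3 → ι}
    (hm : Function.Injective m) :
    HasJet (R₃ μ f k (m 0) (m 1) (m 2) A θ) 0
      (∑ σ : Equiv.Perm (Fin 3), sumCoupling μ f k (m (σ 0)) (m (σ 1)) (m (σ 2)) / 2 *
        wick (modeWeight A θ) (mon₃ (m (σ 0)) (m (σ 1)) (m (σ 2))))
      (∑ σ : Equiv.Perm (Fin 3), orderedTerm₃ (sumCoupling μ f k) (sumCoupling₃₁ μ f k)
        (sumCoupling₂₂ μ f k) (modeWeight A θ) (m (σ 0)) (m (σ 1)) (m (σ 2))) := by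
  have hb := isModeCoupling hf hparity hU hk hkU
  have h01 := hm.ne (show (0 : Fin 3) ≠ 1 by decide)
  have h02 := hm.ne (show (0 : Fin 3) ≠ 2 by decide)
  have h12 := hm.ne (show (1 : Fin 3) ≠ 2 by decide)
  have h₁ := hasJet_pointDist_singleton hf hparity hU hk hkU hP
  have hT := hasJet_pointDist hf hparity hU hk hkU hP {m 0, m 1, m 2} A θ
  have h₂ := fun {a b : ι} => hasJet_R₂ hf hparity hU hk hkU hP hA θ (a := a) (b := b)
  have hg : gaussWeight {m 0, m 1, m 2} A
      = gaussWeight {m 0} A * gaussWeight {m 1} A * gaussWeight {m 2} A := by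
    simp only [gaussWeight, Finset.prod_singleton]
    rw [Finset.prod_insert (by simp [h01, h02]), Finset.prod_pair h12]
    ring
  refine ((hT.mul_inv (s := modeOrder μ f k (modeWeight A θ) {m 0} 2
    + modeOrder μ f k (modeWeight A θ) {m 1} 2 + modeOrder μ f k (modeWeight A θ) {m 2} 2)
    ((((h₁ _ A θ).mul (h₁ _ A θ)).mul (h₁ _ A θ)).congr hg.symm ?_ ?_)
    (gaussWeight_ne_zero hA _)).sub
    (((HasJet.one.add (h₂ h01)).add (h₂ h12)).add (h₂ h02))).congr ?_ ?_ ?_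
  · ring
  · rw [hg]
    ring
  · ring
  · rw [← wick_cubic_exact₃ _ hb hm]
    simp only [modeOrder, modePoly, orderPoly]
    ring
  · rw [← wick_secondOrder_exact₃ _ hb hm]
    simp only [modeOrder, modePoly, orderPoly]
    ring

/-- The subtractions reproduce the inclusion-exclusion sums. At first order nothing remains; at
second order the products R₂R₂ remove the disjoint pairs. -/
lemma hasJet_R₄ {A : ι → ℝ} (hA : ∀ i, 0 < A i) (θ : ι → ℝ) {m : Fin 4 → ι}
    (hm : Function.Injective m) :
    HasJet (R₄ μ f k (m 0) (m 1) (m 2) (m 3) A θ) 0 0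
      (∑ σ : Equiv.Perm (Fin 4), orderedTerm₄ (sumCoupling μ f k) (sumCoupling₃₁ μ f k)
        (sumCoupling₂₂ μ f k) (modeWeight A θ) (m (σ 0)) (m (σ 1)) (m (σ 2)) (m (σ 3))) := by
  have hb := isModeCoupling hf hparity hU hk hkU
  have h01 := hm.ne (show (0 : Fin 4) ≠ 1 by decide)
  have h02 := hm.ne (show (0 : Fin 4) ≠ 2 by decide)
  have h03 := hm.ne (show (0 : Fin 4) ≠ 3 by decide)
  have h12 := hm.ne (show (1 : Fin 4) ≠ 2 by decide)
  have h13 := hm.ne (show (1 : Fin 4) ≠ 3 by decide)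
  have h23 := hm.ne (show (2 : Fin 4) ≠ 3 by decide)
  have h₁ := hasJet_pointDist_singleton hf hparity hU hk hkU hP
  have hT := hasJet_pointDist hf hparity hU hk hkU hP {m 0, m 1, m 2, m 3} A θ
  have h₂ := fun {a b : ι} => hasJet_R₂ hf hparity hU hk hkU hP hA θ (a := a) (b := b)
  have h₃ : ∀ {s : Fin 3 → Fin 4} (hs : Function.Injective s), _ := fun {s} hs =>
    hasJet_R₃ hf hparity hU hk hkU hP hA θ (hm.comp hs)
  have e₃ : ∀ {s : Fin 3 → Fin 4} (hs : Function.Injective s), _ := fun {s} hs =>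
    wick_cubic_exact₃ (modeWeight A θ) hb (hm.comp hs)
  have e₃' : ∀ {s : Fin 3 → Fin 4} (hs : Function.Injective s), _ := fun {s} hs =>
    wick_secondOrder_exact₃ (modeWeight A θ) hb (hm.comp hs)
  have s₁ : Function.Injective (![0, 1, 2] : Fin 3 → Fin 4) := by decide
  have s₂ : Function.Injective (![0, 1, 3] : Fin 3 → Fin 4) := by decide
  have s₃ : Function.Injective (![0, 2, 3] : Fin 3 → Fin 4) := by decide
  have s₄ : Function.Injective (![1, 2, 3] : Fin 3 → Fin 4) := by decide
  have hg : gaussWeight {m 0, m 1, m 2, m 3} A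
      = gaussWeight {m 0} A * gaussWeight {m 1} A * gaussWeight {m 2} A * gaussWeight {m 3} A := by
    simp only [gaussWeight, Finset.prod_singleton]
    rw [Finset.prod_insert (by simp [h01, h02, h03]), Finset.prod_insert (by simp [h12, h13]),
      Finset.prod_pair h23]
    ring
  -- The three-mode terms are rewritten as inclusion-exclusion sums, so that what remains is linear
  -- in the contributions of subsets.
  have i₁ := (h₃ s₁).congr rfl (e₃ s₁).symm (e₃' s₁).symm
  have i₂ := (h₃ s₂).congr rfl (e₃ s₂).symm (e₃' s₂).symm
  have i₃ := (h₃ s₃).congr rfl (e₃ s₃).symm (e₃' s₃).symm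
  have i₄ := (h₃ s₄).congr rfl (e₃ s₄).symm (e₃' s₄).symm
  refine ((hT.mul_inv (s := modeOrder μ f k (modeWeight A θ) {m 0} 2
    + modeOrder μ f k (modeWeight A θ) {m 1} 2 + modeOrder μ f k (modeWeight A θ) {m 2} 2
    + modeOrder μ f k (modeWeight A θ) {m 3} 2)
    (((((h₁ _ A θ).mul (h₁ _ A θ)).mul (h₁ _ A θ)).mul (h₁ _ A θ)).congr hg.symm ?_ ?_)
    (gaussWeight_ne_zero hA _)).sub
    (((((((((((((HasJet.one.add (h₂ h01)).add (h₂ h02)).add (h₂ h03)).add (h₂ h12)).add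
      (h₂ h13)).add (h₂ h23)).add ((h₂ h01).mul (h₂ h23))).add ((h₂ h02).mul (h₂ h13))).add
      ((h₂ h03).mul (h₂ h12))).add i₁).add i₂).add i₃).add i₄)).congr ?_ ?_ ?_
  · ring
  · rw [hg]
    ring
  · ring
  · have := wick_cubic_exact₄ (modeWeight A θ) hb hm
    simp only [modeOrder, modePoly, orderPoly, Function.comp_apply, Matrix.cons_val]
    linear_combination this
  · have := wick_secondOrder_exact₄ (modeWeight A θ) hb (modeWeight_zero A θ) hm
    simp only [modeOrder, modePoly, orderPoly, Function.comp_apply, Matrix.cons_val]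
    linear_combination this

lemma hasJet_phaseDist {T : Finset ι} {n : ℕ} (hT : T.card = n) (θ : ι → ℝ) :
    HasJet (PowerSeries.C ((2 * Real.pi : ℂ) ^ n) * phaseDist μ f k T θ) 1
      (modeOrder μ f k (phaseWeight θ) T 1) (modeOrder μ f k (phaseWeight θ) T 2) := by
  have h := fun n hn => coeff_phaseDist hf hparity hU hk hkU hP T (n := n) hn θ
  have h1 : wick (phaseWeight θ) (1 : MvPolynomial (ι × Bool) ℂ) = 1 := by
    simpa using wick_prod (phaseWeight_zero θ) ∅ (fun _ => 0) (fun _ => 0)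
  have hpi : (2 * Real.pi : ℂ) ^ n * (1 / (2 * Real.pi : ℂ)) ^ n = 1 := by
    rw [← mul_pow, mul_one_div_cancel (by simp), one_pow]
  refine (HasJet.C_mul ⟨h 0 (by norm_num), h 1 (by norm_num), h 2 (by norm_num)⟩ _).congr ?_ ?_ ?_
  · rw [modePoly, orderPoly, h1, mul_one, hT, hpi]
  · rw [← mul_assoc, hT, hpi, one_mul, modeOrder]
  · rw [← mul_assoc, hT, hpi, one_mul, modeOrder]

-- The only coupling of a mode with itself is of the form |α|⁴, and its Hermite polynomial averages
-- to zero. Single phases are therefore uniform up to this order, so the C_N need no division by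
-- one-mode distributions.
omit hP in
lemma modeOrder_phaseWeight_singleton (θ : ι → ℝ) (a : ι) :
    modeOrder μ f k (phaseWeight θ) {a} 2 = 0 := by
  have hb := isModeCoupling hf hparity hU hk hkU
  have h : mon₂₂ a a a a = 2 * ∏ i ∈ {a}, (up i ^ 2 * dn i ^ 2) := by
    simp only [mon₂₂, Finset.prod_singleton]
    ring
  have h2 : phaseWeight θ a 2 2 = 0 := by
    rw [phaseWeight, radialMean_radialHermite_self]
    simp
  change wick _ (secondOrder _ _ _ _) = 0
  rw [secondOrder, cubic_singleton hb, quartic]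
  simp only [quadSum, Finset.sum_singleton, quarticTerm₃₁_self hb]
  rw [zero_add, zero_pow two_ne_zero, mul_zero, add_zero, wick_quarticTerm₂₂, h, wick_ofNat_mul,
    wick_prod (phaseWeight_zero θ) {a} (fun _ => 2) (fun _ => 2), Finset.prod_singleton, h2]
  simp

lemma hasJet_C₂ (θ : ι → ℝ) {a b : ι} (hab : a ≠ b) :
    HasJet (C₂ μ f k a b θ) 0 (modeOrder μ f k (phaseWeight θ) {a, b} 1)
      (modeOrder μ f k (phaseWeight θ) {a, b} 2) :=
  ((hasJet_phaseDist hf hparity hU hk hkU hP (Finset.card_pair hab) θ).sub HasJet.one).congr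
    (sub_self 1) (sub_zero _) (sub_zero _)

lemma hasJet_C₃ (θ : ι → ℝ) {m : Fin 3 → ι} (hm : Function.Injective m) :
    HasJet (C₃ μ f k (m 0) (m 1) (m 2) θ) 0
      (∑ σ : Equiv.Perm (Fin 3), sumCoupling μ f k (m (σ 0)) (m (σ 1)) (m (σ 2)) / 2 *
        wick (phaseWeight θ) (mon₃ (m (σ 0)) (m (σ 1)) (m (σ 2))))
      (∑ σ : Equiv.Perm (Fin 3), orderedTerm₃ (sumCoupling μ f k) (sumCoupling₃₁ μ f k)
        (sumCoupling₂₂ μ f k) (phaseWeight θ) (m (σ 0)) (m (σ 1)) (m (σ 2))) := by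
  have hb := isModeCoupling hf hparity hU hk hkU
  have h01 := hm.ne (show (0 : Fin 3) ≠ 1 by decide)
  have h02 := hm.ne (show (0 : Fin 3) ≠ 2 by decide)
  have h12 := hm.ne (show (1 : Fin 3) ≠ 2 by decide)
  have h₁ := modeOrder_phaseWeight_singleton hf hparity hU hk hkU θ
  have h₂ := fun {a b : ι} => hasJet_C₂ hf hparity hU hk hkU hP θ (a := a) (b := b)
  have hc : ({m 0, m 1, m 2} : Finset ι).card = 3 := Finset.card_eq_three.2
    ⟨_, _, _, h01, h02, h12, rfl⟩
  refine ((hasJet_phaseDist hf hparity hU hk hkU hP hc θ).sub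
    (((HasJet.one.add (h₂ h01)).add (h₂ h12)).add (h₂ h02.symm))).congr ?_ ?_ ?_
  · ring
  · rw [← wick_cubic_exact₃ _ hb hm, Finset.pair_comm (m 2)]
    simp only [modeOrder, modePoly, orderPoly]
    ring
  · have e : ∀ a, wick (phaseWeight θ) (secondOrder (sumCoupling μ f k) (sumCoupling₃₁ μ f k)
      (sumCoupling₂₂ μ f k) {a}) = 0 := h₁
    rw [← wick_secondOrder_exact₃ _ hb hm, Finset.pair_comm (m 2)]
    simp only [modeOrder, modePoly, orderPoly, e]
    ring

lemma hasJet_C₄ (θ : ι → ℝ) {m : Fin 4 → ι} (hm : Function.Injective m) :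
    HasJet (C₄ μ f k (m 0) (m 1) (m 2) (m 3) θ) 0 0
      (∑ σ : Equiv.Perm (Fin 4), orderedTerm₄ (sumCoupling μ f k) (sumCoupling₃₁ μ f k)
        (sumCoupling₂₂ μ f k) (phaseWeight θ) (m (σ 0)) (m (σ 1)) (m (σ 2)) (m (σ 3))) := by
  have hb := isModeCoupling hf hparity hU hk hkU
  have h01 := hm.ne (show (0 : Fin 4) ≠ 1 by decide)
  have h02 := hm.ne (show (0 : Fin 4) ≠ 2 by decide)
  have h03 := hm.ne (show (0 : Fin 4) ≠ 3 by decide)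
  have h12 := hm.ne (show (1 : Fin 4) ≠ 2 by decide)
  have h13 := hm.ne (show (1 : Fin 4) ≠ 3 by decide)
  have h23 := hm.ne (show (2 : Fin 4) ≠ 3 by decide)
  have h₂ := fun {a b : ι} => hasJet_C₂ hf hparity hU hk hkU hP θ (a := a) (b := b)
  have i : ∀ {s : Fin 3 → Fin 4} (hs : Function.Injective s), _ := fun {s} hs =>
    (hasJet_C₃ hf hparity hU hk hkU hP θ (hm.comp hs)).congr rfl
      (wick_cubic_exact₃ (phaseWeight θ) hb (hm.comp hs)).symm
      (wick_secondOrder_exact₃ (phaseWeight θ) hb (hm.comp hs)).symm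
  have s₁ : Function.Injective (![0, 1, 2] : Fin 3 → Fin 4) := by decide
  have s₂ : Function.Injective (![0, 1, 3] : Fin 3 → Fin 4) := by decide
  have s₃ : Function.Injective (![0, 2, 3] : Fin 3 → Fin 4) := by decide
  have s₄ : Function.Injective (![1, 2, 3] : Fin 3 → Fin 4) := by decide
  have hc : ({m 0, m 1, m 2, m 3} : Finset ι).card = 4 := by
    rw [Finset.card_insert_of_notMem (by simp [h01, h02, h03]),
      Finset.card_eq_three.2 ⟨_, _, _, h12, h13, h23, rfl⟩]
  refine ((hasJet_phaseDist hf hparity hU hk hkU hP hc θ).sub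
    (((((((((((((HasJet.one.add (h₂ h01)).add (h₂ h02)).add (h₂ h03)).add (h₂ h12)).add
      (h₂ h13)).add (h₂ h23)).add ((h₂ h01).mul (h₂ h23))).add ((h₂ h02).mul (h₂ h13))).add
      ((h₂ h03).mul (h₂ h12))).add (i s₁)).add (i s₂)).add (i s₃)).add (i s₄))).congr ?_ ?_ ?_
  · ring
  · have := wick_cubic_exact₄ (phaseWeight θ) hb hm
    simp only [modeOrder, modePoly, orderPoly, Function.comp_apply, Matrix.cons_val]
    linear_combination this
  · have e : ∀ a, wick (phaseWeight θ) (secondOrder (sumCoupling μ f k) (sumCoupling₃₁ μ f k)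
      (sumCoupling₂₂ μ f k) {a}) = 0 := modeOrder_phaseWeight_singleton hf hparity hU hk hkU θ
    have := wick_secondOrder_exact₄ (phaseWeight θ) hb (phaseWeight_zero θ) hm
    simp only [modeOrder, modePoly, orderPoly, Function.comp_apply, Matrix.cons_val, e] at this ⊢
    linear_combination this

end Reduced

end FourierModes

end

noncomputable section

namespace FourierModes

open MvPolynomial

/-! ## Evaluation in polar form -/

/-- The phase factor `e^{ix}`. -/
def phase (x : ℝ) : ℂ := Complex.exp (Complex.I * (x : ℂ))

lemma phase_ne_zero (x : ℝ) : phase x ≠ 0 := Complex.exp_ne_zero _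

lemma phase_add (x y : ℝ) : phase (x + y) = phase x * phase y := by
  rw [phase, phase, phase, ← Complex.exp_add]
  push_cast
  ring_nf

lemma phase_sub (x y : ℝ) : phase (x - y) = phase x / phase y := by
  rw [phase, phase, phase, ← Complex.exp_sub]
  push_cast
  ring_nf

lemma phase_ofNat_mul (n : ℕ) [n.AtLeastTwo] (x : ℝ) : phase (ofNat(n) * x) = phase x ^ (ofNat(n) : ℕ) := by
  rw [phase, phase, ← Complex.exp_nat_mul, Nat.cast_ofNat, Complex.ofReal_mul, Complex.ofReal_ofNat]
  ring_nf

lemma ofReal_cos_eq_phase (x : ℝ) : ((Real.cos x : ℝ) : ℂ) = (phase x + (phase x)⁻¹) / 2 := by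
  rw [phase, ← Complex.exp_neg, Complex.ofReal_cos, Complex.cos]
  ring_nf

/-- Weights that consist of a symmetric function of the degrees and the corresponding phases. -/
structure IsPolarWeight {ι : Type*} (φ : ι → ℕ → ℕ → ℂ) (ρ : ι → ℕ → ℕ → ℝ) (θ : ι → ℝ) :
    Prop where
  eq : ∀ i p q, φ i p q = (ρ i p q : ℂ) * ((phase (θ i))⁻¹ ^ p * phase (θ i) ^ q)
  zero : ∀ i, ρ i 0 0 = 1
  symm : ∀ i p, ρ i 0 p = ρ i p 0
  symm' : ∀ i, ρ i 1 2 = ρ i 2 1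

section Evaluation

variable {ι : Type*} {φ : ι → ℕ → ℕ → ℂ} {ρ : ι → ℕ → ℕ → ℝ} {θ : ι → ℝ}
  (hφ : IsPolarWeight φ ρ θ)

include hφ

lemma IsPolarWeight.map_zero (i : ι) : φ i 0 0 = 1 := by
  rw [hφ.eq, hφ.zero]
  simp

variable [Fintype ι] [DecidableEq ι]

/-- Here and below, conjugate monomials have the same modulus by the symmetries of ρ and opposite
phases, so they add up to a cosine. With e^{iθ} as a nonzero variable this is an identity of
rational functions. -/
lemma wick_polar_mon₃_pair {a b : ι} (hab : a ≠ b) :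
    wick φ (mon₃ a a b) =
      ((2 * ρ a 2 0 * ρ b 1 0 * Real.cos (2 * θ a - θ b) : ℝ) : ℂ) := by
  have a0 := phase_ne_zero (θ a)
  have b0 := phase_ne_zero (θ b)
  rw [wick_mon₃_pair hφ.map_zero hab]
  simp only [hφ.eq, hφ.symm, Complex.ofReal_mul,
    Complex.ofReal_ofNat, ofReal_cos_eq_phase, phase_sub, phase_ofNat_mul]
  field_simp
  ring

lemma wick_polar_mon₃_pair_sq {a b : ι} (hab : a ≠ b) :
    wick φ (mon₃ a a b * mon₃ a a b) =
      ((2 * ρ a 4 0 * ρ b 2 0 * Real.cos (2 * (2 * θ a - θ b))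
        + 2 * ρ a 2 2 * ρ b 1 1 : ℝ) : ℂ) := by
  have a0 := phase_ne_zero (θ a)
  have b0 := phase_ne_zero (θ b)
  rw [wick_mon₃_pair_sq hφ.map_zero hab]
  simp only [hφ.eq, hφ.symm, Complex.ofReal_add, Complex.ofReal_mul,
    Complex.ofReal_ofNat, ofReal_cos_eq_phase, phase_sub, phase_ofNat_mul]
  field_simp
  ring

lemma wick_polar_mon₃₁_pair {a b : ι} (hab : a ≠ b) :
    wick φ (mon₃₁ a a a b) =
      ((2 * ρ a 3 0 * ρ b 1 0 * Real.cos (3 * θ a - θ b) : ℝ) : ℂ) := by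
  have a0 := phase_ne_zero (θ a)
  have b0 := phase_ne_zero (θ b)
  rw [wick_mon₃₁_pair hφ.map_zero hab]
  simp only [hφ.eq, hφ.symm, Complex.ofReal_mul,
    Complex.ofReal_ofNat, ofReal_cos_eq_phase, phase_sub, phase_ofNat_mul]
  field_simp
  ring

lemma wick_polar_mon₂₂_pair {a b : ι} (hab : a ≠ b) :
    wick φ (mon₂₂ a b a b) =
      ((2 * ρ a 1 1 * ρ b 1 1 : ℝ) : ℂ) := by
  have a0 := phase_ne_zero (θ a)
  have b0 := phase_ne_zero (θ b)
  rw [wick_mon₂₂_pair hφ.map_zero hab]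
  simp only [hφ.eq, Complex.ofReal_mul,
    Complex.ofReal_ofNat]
  field_simp
  ring

lemma wick_polar_mon₃_triple {a b c : ι} (hab : a ≠ b) (hac : a ≠ c) (hbc : b ≠ c) :
    wick φ (mon₃ a b c) =
      ((2 * ρ a 1 0 * ρ b 1 0 * ρ c 1 0 * Real.cos (θ a + θ b - θ c) : ℝ) : ℂ) := by
  have a0 := phase_ne_zero (θ a)
  have b0 := phase_ne_zero (θ b)
  have c0 := phase_ne_zero (θ c)
  rw [wick_mon₃_triple hφ.map_zero hab hac hbc]
  simp only [hφ.eq, hφ.symm, Complex.ofReal_mul,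
    Complex.ofReal_ofNat, ofReal_cos_eq_phase, phase_sub, phase_add]
  field_simp
  ring

lemma wick_polar_mon₃₁_triple {a b c : ι} (hab : a ≠ b) (hac : a ≠ c) (hbc : b ≠ c) :
    wick φ (mon₃₁ a a b c) =
      ((2 * ρ a 2 0 * ρ b 1 0 * ρ c 1 0 * Real.cos (2 * θ a + θ b - θ c) : ℝ) : ℂ) := by
  have a0 := phase_ne_zero (θ a)
  have b0 := phase_ne_zero (θ b)
  have c0 := phase_ne_zero (θ c)
  rw [wick_mon₃₁_triple hφ.map_zero hab hac hbc]
  simp only [hφ.eq, hφ.symm, Complex.ofReal_mul,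
    Complex.ofReal_ofNat, ofReal_cos_eq_phase, phase_sub, phase_add, phase_ofNat_mul]
  field_simp
  ring

lemma wick_polar_mon₂₂_triple {a b c : ι} (hab : a ≠ b) (hac : a ≠ c) (hbc : b ≠ c) :
    wick φ (mon₂₂ a a b c) =
      ((2 * ρ a 2 0 * ρ b 1 0 * ρ c 1 0 * Real.cos (2 * θ a - θ b - θ c) : ℝ) : ℂ) := by
  have a0 := phase_ne_zero (θ a)
  have b0 := phase_ne_zero (θ b)
  have c0 := phase_ne_zero (θ c)
  rw [wick_mon₂₂_triple hφ.map_zero hab hac hbc]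
  simp only [hφ.eq, hφ.symm, Complex.ofReal_mul,
    Complex.ofReal_ofNat, ofReal_cos_eq_phase, phase_sub, phase_ofNat_mul]
  field_simp
  ring

lemma wick_polar_mon₃_triple_sq {a b c : ι} (hab : a ≠ b) (hac : a ≠ c) (hbc : b ≠ c) :
    wick φ (mon₃ a b c * mon₃ a b c) =
      ((2 * ρ a 2 0 * ρ b 2 0 * ρ c 2 0 * Real.cos (2 * (θ a + θ b - θ c))
        + 2 * ρ a 1 1 * ρ b 1 1 * ρ c 1 1 : ℝ) : ℂ) := by
  have a0 := phase_ne_zero (θ a)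
  have b0 := phase_ne_zero (θ b)
  have c0 := phase_ne_zero (θ c)
  rw [wick_mon₃_triple_sq hφ.map_zero hab hac hbc]
  simp only [hφ.eq, hφ.symm, Complex.ofReal_add, Complex.ofReal_mul,
    Complex.ofReal_ofNat, ofReal_cos_eq_phase, phase_sub, phase_add, phase_ofNat_mul]
  field_simp
  ring

lemma wick_polar_mon₃_double_double {a b c : ι} (hab : a ≠ b) (hac : a ≠ c) (hbc : b ≠ c) :
    wick φ (mon₃ a a b * mon₃ b b c) =
      ((2 * ρ a 2 0 * ρ b 2 1 * ρ c 1 0 * Real.cos (2 * θ a + θ b - θ c)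
        + 2 * ρ a 2 0 * ρ b 3 0 * ρ c 1 0 * Real.cos (2 * θ a - 3 * θ b + θ c) : ℝ) : ℂ) := by
  have a0 := phase_ne_zero (θ a)
  have b0 := phase_ne_zero (θ b)
  have c0 := phase_ne_zero (θ c)
  rw [wick_mon₃_double_double hφ.map_zero hab hac hbc]
  simp only [hφ.eq, hφ.symm, hφ.symm', Complex.ofReal_add, Complex.ofReal_mul,
    Complex.ofReal_ofNat, ofReal_cos_eq_phase, phase_sub, phase_add, phase_ofNat_mul]
  field_simp
  ring

lemma wick_polar_mon₃_double_sum {a b c : ι} (hab : a ≠ b) (hac : a ≠ c) (hbc : b ≠ c) :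
    wick φ (mon₃ a a b * mon₃ a b c) =
      ((2 * ρ a 3 0 * ρ b 1 1 * ρ c 1 0 * Real.cos (3 * θ a - θ c)
        + 2 * ρ a 2 1 * ρ b 2 0 * ρ c 1 0 * Real.cos (θ a - 2 * θ b + θ c) : ℝ) : ℂ) := by
  have a0 := phase_ne_zero (θ a)
  have b0 := phase_ne_zero (θ b)
  have c0 := phase_ne_zero (θ c)
  rw [wick_mon₃_double_sum hφ.map_zero hab hac hbc]
  simp only [hφ.eq, hφ.symm, hφ.symm', Complex.ofReal_add, Complex.ofReal_mul,
    Complex.ofReal_ofNat, ofReal_cos_eq_phase, phase_sub, phase_add, phase_ofNat_mul]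
  field_simp
  ring

lemma wick_polar_mon₃₁_four {a b c e : ι} (hab : a ≠ b) (hac : a ≠ c) (hae : a ≠ e)
    (hbc : b ≠ c) (hbe : b ≠ e) (hce : c ≠ e) :
    wick φ (mon₃₁ a b c e) =
      ((2 * ρ a 1 0 * ρ b 1 0 * ρ c 1 0 * ρ e 1 0 * Real.cos (θ a + θ b + θ c - θ e) : ℝ) : ℂ) := by
  have a0 := phase_ne_zero (θ a)
  have b0 := phase_ne_zero (θ b)
  have c0 := phase_ne_zero (θ c)
  have e0 := phase_ne_zero (θ e)
  rw [wick_mon₃₁_four hφ.map_zero hab hac hae hbc hbe hce]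
  simp only [hφ.eq, hφ.symm, Complex.ofReal_mul,
    Complex.ofReal_ofNat, ofReal_cos_eq_phase, phase_sub, phase_add]
  field_simp
  ring

lemma wick_polar_mon₂₂_four {a b c e : ι} (hab : a ≠ b) (hac : a ≠ c) (hae : a ≠ e)
    (hbc : b ≠ c) (hbe : b ≠ e) (hce : c ≠ e) :
    wick φ (mon₂₂ a b c e) =
      ((2 * ρ a 1 0 * ρ b 1 0 * ρ c 1 0 * ρ e 1 0 * Real.cos (θ a + θ b - θ c - θ e) : ℝ) : ℂ) := by
  have a0 := phase_ne_zero (θ a)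
  have b0 := phase_ne_zero (θ b)
  have c0 := phase_ne_zero (θ c)
  have e0 := phase_ne_zero (θ e)
  rw [wick_mon₂₂_four hφ.map_zero hab hac hae hbc hbe hce]
  simp only [hφ.eq, hφ.symm, Complex.ofReal_mul,
    Complex.ofReal_ofNat, ofReal_cos_eq_phase, phase_sub, phase_add]
  field_simp
  ring

lemma wick_polar_mon₃_four₃ {a b c e : ι} (hab : a ≠ b) (hac : a ≠ c) (hae : a ≠ e)
    (hbc : b ≠ c) (hbe : b ≠ e) (hce : c ≠ e) :
    wick φ (mon₃ a a c * mon₃ a e b) =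
      ((2 * ρ a 3 0 * ρ b 1 0 * ρ c 1 0 * ρ e 1 0 * Real.cos (3 * θ a - θ b - θ c + θ e)
        + 2 * ρ a 2 1 * ρ b 1 0 * ρ c 1 0 * ρ e 1 0 * Real.cos (θ a + θ b - θ c - θ e) : ℝ) : ℂ) := by
  have a0 := phase_ne_zero (θ a)
  have b0 := phase_ne_zero (θ b)
  have c0 := phase_ne_zero (θ c)
  have e0 := phase_ne_zero (θ e)
  rw [wick_mon₃_four₃ hφ.map_zero hab hac hae hbc hbe hce]
  simp only [hφ.eq, hφ.symm, hφ.symm', Complex.ofReal_add, Complex.ofReal_mul,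
    Complex.ofReal_ofNat, ofReal_cos_eq_phase, phase_sub, phase_add, phase_ofNat_mul]
  field_simp
  ring

lemma wick_polar_mon₃_four₄ {a b c e : ι} (hab : a ≠ b) (hac : a ≠ c) (hae : a ≠ e)
    (hbc : b ≠ c) (hbe : b ≠ e) (hce : c ≠ e) :
    wick φ (mon₃ a a e * mon₃ b c a) =
      ((2 * ρ a 2 1 * ρ b 1 0 * ρ c 1 0 * ρ e 1 0 * Real.cos (θ a + θ b + θ c - θ e)
        + 2 * ρ a 3 0 * ρ b 1 0 * ρ c 1 0 * ρ e 1 0 * Real.cos (3 * θ a - θ b - θ c - θ e) : ℝ) : ℂ) := by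
  have a0 := phase_ne_zero (θ a)
  have b0 := phase_ne_zero (θ b)
  have c0 := phase_ne_zero (θ c)
  have e0 := phase_ne_zero (θ e)
  rw [wick_mon₃_four₄ hφ.map_zero hab hac hae hbc hbe hce]
  simp only [hφ.eq, hφ.symm, hφ.symm', Complex.ofReal_add, Complex.ofReal_mul,
    Complex.ofReal_ofNat, ofReal_cos_eq_phase, phase_sub, phase_add, phase_ofNat_mul]
  field_simp
  ring

lemma wick_polar_mon₃_four₅ {a b c e : ι} (hab : a ≠ b) (hac : a ≠ c) (hae : a ≠ e)
    (hbc : b ≠ c) (hbe : b ≠ e) (hce : c ≠ e) :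
    wick φ (mon₃ a a e * mon₃ b e c) =
      ((2 * ρ a 2 0 * ρ b 1 0 * ρ c 1 0 * ρ e 1 1 * Real.cos (2 * θ a + θ b - θ c)
        + 2 * ρ a 2 0 * ρ b 1 0 * ρ c 1 0 * ρ e 2 0 * Real.cos (2 * θ a - θ b + θ c - 2 * θ e) : ℝ) : ℂ) := by
  have a0 := phase_ne_zero (θ a)
  have b0 := phase_ne_zero (θ b)
  have c0 := phase_ne_zero (θ c)
  have e0 := phase_ne_zero (θ e)
  rw [wick_mon₃_four₅ hφ.map_zero hab hac hae hbc hbe hce]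
  simp only [hφ.eq, hφ.symm, Complex.ofReal_add, Complex.ofReal_mul,
    Complex.ofReal_ofNat, ofReal_cos_eq_phase, phase_sub, phase_add, phase_ofNat_mul]
  field_simp
  ring

lemma wick_polar_mon₃_four₆ {a b c e : ι} (hab : a ≠ b) (hac : a ≠ c) (hae : a ≠ e)
    (hbc : b ≠ c) (hbe : b ≠ e) (hce : c ≠ e) :
    wick φ (mon₃ a a e * mon₃ b c e) =
      ((2 * ρ a 2 0 * ρ b 1 0 * ρ c 1 0 * ρ e 2 0 * Real.cos (2 * θ a + θ b + θ c - 2 * θ e)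
        + 2 * ρ a 2 0 * ρ b 1 0 * ρ c 1 0 * ρ e 1 1 * Real.cos (2 * θ a - θ b - θ c) : ℝ) : ℂ) := by
  have a0 := phase_ne_zero (θ a)
  have b0 := phase_ne_zero (θ b)
  have c0 := phase_ne_zero (θ c)
  have e0 := phase_ne_zero (θ e)
  rw [wick_mon₃_four₆ hφ.map_zero hab hac hae hbc hbe hce]
  simp only [hφ.eq, hφ.symm, Complex.ofReal_add, Complex.ofReal_mul,
    Complex.ofReal_ofNat, ofReal_cos_eq_phase, phase_sub, phase_add, phase_ofNat_mul]
  field_simp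
  ring

lemma wick_polar_mon₃_four₇ {a b c e : ι} (hab : a ≠ b) (hac : a ≠ c) (hae : a ≠ e)
    (hbc : b ≠ c) (hbe : b ≠ e) (hce : c ≠ e) :
    wick φ (mon₃ a b e * mon₃ a e c) =
      ((2 * ρ a 2 0 * ρ b 1 0 * ρ c 1 0 * ρ e 1 1 * Real.cos (2 * θ a + θ b - θ c)
        + 2 * ρ a 1 1 * ρ b 1 0 * ρ c 1 0 * ρ e 2 0 * Real.cos (θ b + θ c - 2 * θ e) : ℝ) : ℂ) := by
  have a0 := phase_ne_zero (θ a)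
  have b0 := phase_ne_zero (θ b)
  have c0 := phase_ne_zero (θ c)
  have e0 := phase_ne_zero (θ e)
  rw [wick_mon₃_four₇ hφ.map_zero hab hac hae hbc hbe hce]
  simp only [hφ.eq, hφ.symm, Complex.ofReal_add, Complex.ofReal_mul,
    Complex.ofReal_ofNat, ofReal_cos_eq_phase, phase_sub, phase_add, phase_ofNat_mul]
  field_simp
  ring

end Evaluation

end FourierModes

end

noncomputable section

namespace FourierModes

open MvPolynomial

/-! ## The weights at given moduli, and averaged over the moduli -/

lemma radialHermite_zero_right (p : ℕ) (A : ℝ) : radialHermite p 0 A = A ^ p := by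
  induction p with
  | zero => rfl
  | succ p ih => rw [radialHermite, ih, Nat.cast_zero, zero_mul, sub_zero, pow_succ']

lemma radialHermite_one_one (A : ℝ) : radialHermite 1 1 A = A ^ 2 - 1 := by
  simp [radialHermite]
  ring

lemma radialHermite_one_two (A : ℝ) : radialHermite 1 2 A = A ^ 3 - 2 * A := by
  simp [radialHermite]
  ring

lemma radialHermite_two_one (A : ℝ) : radialHermite 2 1 A = A ^ 3 - 2 * A := by
  simp [radialHermite]
  ring

lemma radialHermite_two_two (A : ℝ) : radialHermite 2 2 A = A ^ 4 - 4 * A ^ 2 + 2 := by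
  simp [radialHermite]
  ring

/-- The moduli of the weights `modeWeight`. -/
def modeModulus {ι : Type*} (A : ι → ℝ) (i : ι) (p q : ℕ) : ℝ := radialHermite p q (A i)

/-- The moduli of the weights `phaseWeight`. -/
def phaseModulus {ι : Type*} (_ : ι) (p q : ℕ) : ℝ := 2 * radialMean (radialHermite p q)

section

variable {ι : Type*}

lemma isPolarWeight_modeWeight (A θ : ι → ℝ) :
    IsPolarWeight (modeWeight A θ) (modeModulus A) θ where
  eq i p q := by rw [modeWeight, complexHermite_polar, phase, modeModulus, Complex.exp_neg]
  zero i := by simp [modeModulus, radialHermite]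
  symm i p := by rw [modeModulus, modeModulus, radialHermite_zero_right, radialHermite]
  symm' i := by rw [modeModulus, modeModulus, radialHermite_one_two, radialHermite_two_one]

lemma isPolarWeight_phaseWeight (θ : ι → ℝ) :
    IsPolarWeight (phaseWeight θ) phaseModulus θ where
  eq i p q := by
    rw [phaseWeight, phase, phaseModulus, Complex.exp_neg]
    push_cast
    ring
  zero i := by rw [phaseModulus, radialMean_radialHermite_self]; norm_num
  symm i p := by
    rw [phaseModulus, phaseModulus, funext (radialHermite_zero_right p)]
    rfl
  symm' i := by
    rw [phaseModulus, phaseModulus, funext radialHermite_one_two, funext radialHermite_two_one]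

variable (i : ι)

lemma phaseModulus_zero_right (p : ℕ) :
    phaseModulus i p 0 = Real.Gamma (p / 2 + 1) := by
  rw [phaseModulus, funext (radialHermite_zero_right p), radialMean_pow]
  ring

lemma phaseModulus_one_zero : phaseModulus i 1 0 = Real.sqrt Real.pi / 2 := by
  rw [phaseModulus_zero_right, Real.Gamma_add_one (by norm_num), Nat.cast_one,
    Real.Gamma_one_half_eq]
  ring

lemma phaseModulus_two_zero : phaseModulus i 2 0 = 1 := by
  rw [phaseModulus_zero_right, show ((2 : ℕ) : ℝ) / 2 + 1 = (1 : ℕ) + 1 by norm_num,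
    Real.Gamma_nat_eq_factorial]
  norm_num

lemma phaseModulus_three_zero : phaseModulus i 3 0 = 3 / 4 * Real.sqrt Real.pi := by
  rw [phaseModulus_zero_right, Real.Gamma_add_one (by norm_num),
    show ((3 : ℕ) : ℝ) / 2 = 1 / 2 + 1 by norm_num, Real.Gamma_add_one (by norm_num),
    Real.Gamma_one_half_eq]
  ring

lemma phaseModulus_four_zero : phaseModulus i 4 0 = 2 := by
  rw [phaseModulus_zero_right, show ((4 : ℕ) : ℝ) / 2 + 1 = (2 : ℕ) + 1 by norm_num,
    Real.Gamma_nat_eq_factorial]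
  norm_num

lemma phaseModulus_self {p : ℕ} (hp : p ≠ 0) : phaseModulus i p p = 0 := by
  rw [phaseModulus, radialMean_radialHermite_self, if_neg hp, mul_zero]

/-- The polynomial is A³ - 2A, hence (3/4)√π - 2·(1/2)√π. -/
lemma phaseModulus_two_one : phaseModulus i 2 1 = -(Real.sqrt Real.pi / 4) := by
  have h₁ := phaseModulus_one_zero i
  have h₃ := phaseModulus_three_zero i
  rw [phaseModulus, funext (radialHermite_zero_right _)] at h₁ h₃
  rw [phaseModulus, funext radialHermite_two_one, radialMean_sub (radialIntegrable_pow 3)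
    (by simpa using (radialIntegrable_pow 1).const_mul 2), radialMean_const_mul]
  simp only [pow_one] at h₁
  linear_combination h₃ - 2 * h₁

end

section Terms

variable {ι : Type*} [Fintype ι] [DecidableEq ι] (b : ι → ι → ι → ℂ) (q r : ι → ι → ι → ι → ℂ)

/-- The constants are products of Gamma values. Terms with a factor ρ(1,1) = 0 disappear: the
constant part of the square, and cos(3θ_x - θ_z) in the last product. -/
lemma orderedTerm₃_phaseWeight (θ : ι → ℝ) {x y z : ι} (hxy : x ≠ y) (hxz : x ≠ z) (hyz : y ≠ z) :
    orderedTerm₃ b q r (phaseWeight θ) x y z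
      = q x x y z * ((Real.pi / 4 * Real.cos (2 * θ x + θ y - θ z) : ℝ) : ℂ)
        + r x x y z * ((Real.pi / 8 * Real.cos (2 * θ x - θ y - θ z) : ℝ) : ℂ)
        + b x y z ^ 2 * ((1 / 2 * Real.cos (2 * (θ x + θ y - θ z)) : ℝ) : ℂ)
        + b x x y * b y y z * ((Real.pi / 16 * (3 * Real.cos (2 * θ x - 3 * θ y + θ z)
          - Real.cos (2 * θ x + θ y - θ z)) : ℝ) : ℂ)
        - b x x y * b x y z * ((Real.pi / 8 * Real.cos (θ x - 2 * θ y + θ z) : ℝ) : ℂ) := by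
  have hφ := isPolarWeight_phaseWeight θ
  have hs : (Real.pi : ℂ) = (Real.sqrt Real.pi : ℂ) ^ 2 := by
    rw [← Complex.ofReal_pow, Real.sq_sqrt Real.pi_pos.le]
  rw [orderedTerm₃, wick_polar_mon₃₁_triple hφ hxy hxz hyz, wick_polar_mon₂₂_triple hφ hxy hxz hyz,
    wick_polar_mon₃_triple_sq hφ hxy hxz hyz, wick_polar_mon₃_double_double hφ hxy hxz hyz,
    wick_polar_mon₃_double_sum hφ hxy hxz hyz]
  simp only [phaseModulus_one_zero, phaseModulus_two_zero, phaseModulus_three_zero,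
    phaseModulus_two_one, phaseModulus_self _ one_ne_zero]
  push_cast
  rw [hs]
  ring

/-- The product `b x y w * b x w z` contributes nothing: both of its monomials contain one of the
modes with the weight ρ(1,1) = 0. -/
lemma orderedTerm₄_phaseWeight (θ : ι → ℝ) {x y z w : ι} (hxy : x ≠ y) (hxz : x ≠ z) (hxw : x ≠ w)
    (hyz : y ≠ z) (hyw : y ≠ w) (hzw : z ≠ w) :
    orderedTerm₄ b q r (phaseWeight θ) x y z w
      = q x y z w * ((Real.pi ^ 2 / 48 * Real.cos (θ x + θ y + θ z - θ w) : ℝ) : ℂ)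
        + r x y z w * ((Real.pi ^ 2 / 64 * Real.cos (θ x + θ y - θ z - θ w) : ℝ) : ℂ)
        + b x x z * b x w y * ((Real.pi ^ 2 / 32 * (3 * Real.cos (3 * θ x - θ y - θ z + θ w)
          - Real.cos (θ x + θ y - θ z - θ w)) : ℝ) : ℂ)
        + b x x w * b y z x * ((Real.pi ^ 2 / 64 * (3 * Real.cos (3 * θ x - θ y - θ z - θ w)
          - Real.cos (θ x + θ y + θ z - θ w)) : ℝ) : ℂ)
        + b x x w * b y w z * ((Real.pi / 4 * Real.cos (2 * θ x - θ y + θ z - 2 * θ w) : ℝ) : ℂ)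
        + b x x w * b y z w * ((Real.pi / 8 * Real.cos (2 * θ x + θ y + θ z - 2 * θ w) : ℝ) : ℂ) := by
  have hφ := isPolarWeight_phaseWeight θ
  have hs : (Real.pi : ℂ) = (Real.sqrt Real.pi : ℂ) ^ 2 := by
    rw [← Complex.ofReal_pow, Real.sq_sqrt Real.pi_pos.le]
  rw [orderedTerm₄, wick_polar_mon₃₁_four hφ hxy hxz hxw hyz hyw hzw,
    wick_polar_mon₂₂_four hφ hxy hxz hxw hyz hyw hzw,
    wick_polar_mon₃_four₃ hφ hxy hxz hxw hyz hyw hzw,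
    wick_polar_mon₃_four₄ hφ hxy hxz hxw hyz hyw hzw,
    wick_polar_mon₃_four₅ hφ hxy hxz hxw hyz hyw hzw,
    wick_polar_mon₃_four₆ hφ hxy hxz hxw hyz hyw hzw,
    wick_polar_mon₃_four₇ hφ hxy hxz hxw hyz hyw hzw]
  simp only [phaseModulus_one_zero, phaseModulus_two_zero, phaseModulus_three_zero,
    phaseModulus_two_one, phaseModulus_self _ one_ne_zero]
  push_cast
  rw [hs]
  ring

end Terms

section Reduced

variable {d : ℕ} {L : Fin d → ℝ} [∀ i, Fact (0 < L i)] {Ω : Type*} [MeasurableSpace Ω]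
  {μ : MeasureTheory.Measure Ω} {f : Ω → Box L → ℝ}
  {ι : Type*} [Fintype ι] [DecidableEq ι] {k : ι → Wavevector d} (A θ : ι → ℝ)

lemma wick_mon₃_pair_eq_R₂term₁ {x y : ι} (hxy : x ≠ y) :
    sumCoupling μ f k x x y / 2 * wick (modeWeight A θ) (mon₃ x x y)
      = R₂term₁ (bispec μ f) k A θ x y := by
  rw [wick_polar_mon₃_pair (isPolarWeight_modeWeight A θ) hxy, R₂term₁, sumCoupling]
  simp only [modeModulus, radialHermite_zero_right]
  push_cast
  ring

lemma wick_mon₃_pair_sq_eq_R₂term₂ {x y : ι} (hxy : x ≠ y) :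
    sumCoupling μ f k x x y ^ 2 / 8 * wick (modeWeight A θ) (mon₃ x x y * mon₃ x x y)
      = R₂term₂ (bispec μ f) k A θ x y := by
  rw [wick_polar_mon₃_pair_sq (isPolarWeight_modeWeight A θ) hxy, R₂term₂, sumCoupling]
  simp only [modeModulus, radialHermite_zero_right, radialHermite_one_one, radialHermite_two_two,
    Real.cos_two_mul (2 * θ x - θ y)]
  push_cast
  ring

lemma wick_mon₃₁_pair_eq_R₂term₃ {x y : ι} (hxy : x ≠ y) :
    sumCoupling₃₁ μ f k x x x y / 6 * wick (modeWeight A θ) (mon₃₁ x x x y)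
      = R₂term₃ (trispec μ f) k A θ x y := by
  rw [wick_polar_mon₃₁_pair (isPolarWeight_modeWeight A θ) hxy, R₂term₃, sumCoupling₃₁]
  simp only [modeModulus, radialHermite_zero_right]
  push_cast
  ring

lemma wick_mon₂₂_pair_eq_R₂term₄ {x y : ι} (hxy : x ≠ y) :
    sumCoupling₂₂ μ f k x y x y / 2 * wick (modeWeight A θ) (mon₂₂ x y x y)
      = R₂term₄ (trispec μ f) k A x y := by
  rw [wick_polar_mon₂₂_pair (isPolarWeight_modeWeight A θ) hxy, R₂term₄, sumCoupling₂₂]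
  simp only [modeModulus, radialHermite_one_one]
  push_cast
  ring

lemma wick_mon₃_triple_eq_R₃term₁ {x y z : ι} (hxy : x ≠ y) (hxz : x ≠ z) (hyz : y ≠ z) :
    sumCoupling μ f k x y z / 2 * wick (modeWeight A θ) (mon₃ x y z)
      = R₃term₁ (bispec μ f) k A θ x y z := by
  rw [wick_polar_mon₃_triple (isPolarWeight_modeWeight A θ) hxy hxz hyz, R₃term₁, sumCoupling]
  simp only [modeModulus, radialHermite_zero_right]
  push_cast
  ring

/-- The Wick functional produces single cosines, while the formula contains products of cosines. The
lower powers of A from the Hermite polynomials are the subtracted terms of the formula. -/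
lemma orderedTerm₃_eq_R₃asym {x y z : ι} (hxy : x ≠ y) (hxz : x ≠ z) (hyz : y ≠ z) :
    orderedTerm₃ (sumCoupling μ f k) (sumCoupling₃₁ μ f k) (sumCoupling₂₂ μ f k) (modeWeight A θ)
      x y z = R₃asym (bispec μ f) (trispec μ f) k A θ x y z := by
  have hφ := isPolarWeight_modeWeight A θ
  rw [orderedTerm₃, R₃asym, wick_polar_mon₃₁_triple hφ hxy hxz hyz,
    wick_polar_mon₂₂_triple hφ hxy hxz hyz, wick_polar_mon₃_triple_sq hφ hxy hxz hyz,
    wick_polar_mon₃_double_double hφ hxy hxz hyz, wick_polar_mon₃_double_sum hφ hxy hxz hyz]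
  -- Product-to-sum identities for the fifth and the sixth term.
  have c₅ := Real.two_mul_cos_mul_cos (2 * θ x - θ y) (2 * θ y - θ z)
  rw [show 2 * θ x - θ y - (2 * θ y - θ z) = 2 * θ x - 3 * θ y + θ z by ring,
    show 2 * θ x - θ y + (2 * θ y - θ z) = 2 * θ x + θ y - θ z by ring] at c₅
  have c₆ := Real.two_mul_cos_mul_cos (2 * θ x - θ y) (θ x + θ y - θ z)
  rw [show 2 * θ x - θ y - (θ x + θ y - θ z) = θ x - 2 * θ y + θ z by ring,
    show 2 * θ x - θ y + (θ x + θ y - θ z) = 3 * θ x - θ z by ring] at c₆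
  have c₅' := congrArg (fun t : ℝ => (t : ℂ)) c₅
  have c₆' := congrArg (fun t : ℝ => (t : ℂ)) c₆
  simp only [modeModulus, radialHermite_zero_right, radialHermite_one_one, radialHermite_two_one,
    Real.cos_two_mul (θ x + θ y - θ z), R₃term₂, R₃term₃, R₃term₄, R₃term₅, R₃term₆, sumCoupling,
    sumCoupling₃₁, sumCoupling₂₂, Complex.ofReal_add, Complex.ofReal_sub, Complex.ofReal_mul,
    Complex.ofReal_pow, Complex.ofReal_ofNat, Complex.ofReal_div, Complex.ofReal_one] at c₅' c₆' ⊢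
  linear_combination
    (-(1 / 2) * (A x : ℂ) ^ 2 * (A y : ℂ) ^ 3 * (A z : ℂ) *
      (bispec μ f (k x) (k x) (-k y) * bispec μ f (k y) (k y) (-k z))) * c₅'
    - (A x : ℂ) ^ 3 * (A y : ℂ) ^ 2 * (A z : ℂ) *
      (bispec μ f (k x) (k x) (-k y) * bispec μ f (k x) (k y) (-k z)) * c₆'

omit [Fintype ι] [DecidableEq ι] in
lemma two_mul_cos_mul_cos_eq {x y s t : ℝ} (hs : x - y = s) (ht : x + y = t) :
    2 * (Real.cos x : ℂ) * (Real.cos y : ℂ) = (Real.cos s : ℂ) + (Real.cos t : ℂ) := by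
  rw [← hs, ← ht]
  exact_mod_cast congrArg (fun t : ℝ => (t : ℂ)) (Real.two_mul_cos_mul_cos x y)

lemma orderedTerm₄_eq_R₄asym [MeasureTheory.IsProbabilityMeasure μ] (hf : IsHomogeneousField μ f)
    {x y z w : ι} (hxy : x ≠ y) (hxz : x ≠ z) (hxw : x ≠ w) (hyz : y ≠ z) (hyw : y ≠ w)
    (hzw : z ≠ w) :
    orderedTerm₄ (sumCoupling μ f k) (sumCoupling₃₁ μ f k) (sumCoupling₂₂ μ f k) (modeWeight A θ)
      x y z w = R₄asym (bispec μ f) (trispec μ f) k A θ x y z w := by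
  have hφ := isPolarWeight_modeWeight A θ
  rw [orderedTerm₄, R₄asym, wick_polar_mon₃₁_four hφ hxy hxz hxw hyz hyw hzw,
    wick_polar_mon₂₂_four hφ hxy hxz hxw hyz hyw hzw,
    wick_polar_mon₃_four₃ hφ hxy hxz hxw hyz hyw hzw,
    wick_polar_mon₃_four₄ hφ hxy hxz hxw hyz hyw hzw,
    wick_polar_mon₃_four₅ hφ hxy hxz hxw hyz hyw hzw,
    wick_polar_mon₃_four₆ hφ hxy hxz hxw hyz hyw hzw,
    wick_polar_mon₃_four₇ hφ hxy hxz hxw hyz hyw hzw]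
  have c₃ := two_mul_cos_mul_cos_eq (x := 2 * θ x - θ z) (y := θ x - θ y + θ w)
    (s := θ x + θ y - θ z - θ w) (t := 3 * θ x - θ y - θ z + θ w) (by ring) (by ring)
  have c₄ := two_mul_cos_mul_cos_eq (x := 2 * θ x - θ w) (y := θ x - θ y - θ z)
    (s := θ x + θ y + θ z - θ w) (t := 3 * θ x - θ y - θ z - θ w) (by ring) (by ring)
  have c₅ := two_mul_cos_mul_cos_eq (x := 2 * θ x - θ w) (y := θ y - θ z + θ w)
    (s := 2 * θ x - θ y + θ z - 2 * θ w) (t := 2 * θ x + θ y - θ z) (by ring) (by ring)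
  have c₆ := two_mul_cos_mul_cos_eq (x := 2 * θ x - θ w) (y := θ y + θ z - θ w)
    (s := 2 * θ x - θ y - θ z) (t := 2 * θ x + θ y + θ z - 2 * θ w) (by ring) (by ring)
  have c₇ := two_mul_cos_mul_cos_eq (x := θ x + θ y - θ w) (y := θ x - θ z + θ w)
    (s := θ y + θ z - 2 * θ w) (t := 2 * θ x + θ y - θ z) (by ring) (by ring)
  -- The formula lists some arguments in another order than the couplings, whose last argument is
  -- the negative one.
  have e₃ : bispec μ f (k x) (-k y) (k w) = bispec μ f (k x) (k w) (-k y) := bispec_swap₂₃ hf _ _ _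
  have e₄ : bispec μ f (-k x) (k y) (k z) = bispec μ f (k y) (k z) (-k x) := by
    rw [bispec_swap₁₂ hf, bispec_swap₂₃ hf]
  have e₅ : bispec μ f (k y) (-k z) (k w) = bispec μ f (k y) (k w) (-k z) := bispec_swap₂₃ hf _ _ _
  have e₇ : bispec μ f (k x) (-k z) (k w) = bispec μ f (k x) (k w) (-k z) := bispec_swap₂₃ hf _ _ _
  simp only [modeModulus, radialHermite_zero_right, radialHermite_one_one, radialHermite_two_one,
    R₄term₁, R₄term₂, R₄term₃, R₄term₄, R₄term₅, R₄term₆, R₄term₇, sumCoupling, e₃, e₄, e₅, e₇,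
    sumCoupling₃₁, sumCoupling₂₂, Complex.ofReal_add, Complex.ofReal_sub, Complex.ofReal_mul,
    Complex.ofReal_pow, Complex.ofReal_ofNat, Complex.ofReal_div, Complex.ofReal_one]
  linear_combination
    -(A x : ℂ) ^ 3 * A y * A z * A w *
      (bispec μ f (k x) (k x) (-k z) * bispec μ f (k x) (k w) (-k y)) * c₃
    - 1 / 2 * (A x : ℂ) ^ 3 * A y * A z * A w *
      (bispec μ f (k x) (k x) (-k w) * bispec μ f (k y) (k z) (-k x)) * c₄
    - (A x : ℂ) ^ 2 * A y * A z * A w ^ 2 *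
      (bispec μ f (k x) (k x) (-k w) * bispec μ f (k y) (k w) (-k z)) * c₅
    - 1 / 2 * (A x : ℂ) ^ 2 * A y * A z * A w ^ 2 *
      (bispec μ f (k x) (k x) (-k w) * bispec μ f (k y) (k z) (-k w)) * c₆
    - 2 * (A x : ℂ) ^ 2 * A y * A z * A w ^ 2 *
      (bispec μ f (k x) (k y) (-k w) * bispec μ f (k x) (k w) (-k z)) * c₇

end Reduced

end FourierModes

end

noncomputable section

namespace FourierModes

open MeasureTheory

section Reduced

variable {d : ℕ} {L : Fin d → ℝ} [∀ i, Fact (0 < L i)] {Ω : Type*} [MeasurableSpace Ω]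
  {μ : Measure Ω} [IsProbabilityMeasure μ] {f : Ω → Box L → ℝ} (hf : IsHomogeneousField μ f)
  (hparity : ∀ (n : ℕ) (q : Fin n → Wavevector d),
    polyspectrum μ f n (fun i => -q i) = polyspectrum μ f n q)
  {U : Set (Wavevector d)} (hU : IsUpperHalf U)
  {ι : Type*} [Fintype ι] [DecidableEq ι] {k : ι → Wavevector d} (hk : Function.Injective k)
  (hkU : ∀ i, k i ∈ U) (hP : ∀ i, powerSpectrum μ f (k i) ≠ 0)

include hf hparity hU hk hkU hP

/-! ## The reduced distributions -/

theorem upToSecondOrder_R₂ {A : ι → ℝ} (hA : ∀ i, 0 < A i) (θ : ι → ℝ) {a b : ι} (hab : a ≠ b) :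
    UpToSecondOrder (R₂ μ f k a b A θ)
      (R₂term₁ (bispec μ f) k A θ a b + R₂term₁ (bispec μ f) k A θ b a)
      (R₂term₂ (bispec μ f) k A θ a b + R₂term₂ (bispec μ f) k A θ b a
        + (R₂term₃ (trispec μ f) k A θ a b + R₂term₃ (trispec μ f) k A θ b a)
        + R₂term₄ (trispec μ f) k A a b) := by
  have hb := isModeCoupling hf hparity hU hk hkU
  refine ((hasJet_R₂ hf hparity hU hk hkU hP hA θ hab).congr rfl ?_ ?_).upToSecondOrder
  · rw [← wick_mon₃_pair_eq_R₂term₁ A θ hab, ← wick_mon₃_pair_eq_R₂term₁ A θ hab.symm]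
    exact wick_cubic_pair (modeWeight A θ) hb hab
  · rw [← wick_mon₃_pair_sq_eq_R₂term₂ A θ hab, ← wick_mon₃_pair_sq_eq_R₂term₂ A θ hab.symm,
      ← wick_mon₃₁_pair_eq_R₂term₃ A θ hab, ← wick_mon₃₁_pair_eq_R₂term₃ A θ hab.symm,
      ← wick_mon₂₂_pair_eq_R₂term₄ A θ hab]
    exact wick_secondOrder_exact₂ (modeWeight A θ) hb hab

theorem upToSecondOrder_R₃ {A : ι → ℝ} (hA : ∀ i, 0 < A i) (θ : ι → ℝ) {m : Fin 3 → ι}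
    (hm : Function.Injective m) :
    UpToSecondOrder (R₃ μ f k (m 0) (m 1) (m 2) A θ)
      (∑ σ : Equiv.Perm (Fin 3), R₃term₁ (bispec μ f) k A θ (m (σ 0)) (m (σ 1)) (m (σ 2)))
      (∑ σ : Equiv.Perm (Fin 3),
        R₃asym (bispec μ f) (trispec μ f) k A θ (m (σ 0)) (m (σ 1)) (m (σ 2))) := by
  have h : ∀ (σ : Equiv.Perm (Fin 3)) {i j : Fin 3}, i ≠ j → m (σ i) ≠ m (σ j) := fun σ i j hij =>
    (hm.comp σ.injective).ne hij
  refine ((hasJet_R₃ hf hparity hU hk hkU hP hA θ hm).congr rfl ?_ ?_).upToSecondOrder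
  · exact Finset.sum_congr rfl fun σ _ => wick_mon₃_triple_eq_R₃term₁ A θ (h σ (by decide))
      (h σ (by decide)) (h σ (by decide))
  · exact Finset.sum_congr rfl fun σ _ => orderedTerm₃_eq_R₃asym A θ (h σ (by decide))
      (h σ (by decide)) (h σ (by decide))

theorem upToSecondOrder_R₄ {A : ι → ℝ} (hA : ∀ i, 0 < A i) (θ : ι → ℝ) {m : Fin 4 → ι}
    (hm : Function.Injective m) :
    UpToSecondOrder (R₄ μ f k (m 0) (m 1) (m 2) (m 3) A θ) 0
      (∑ σ : Equiv.Perm (Fin 4),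
        R₄asym (bispec μ f) (trispec μ f) k A θ (m (σ 0)) (m (σ 1)) (m (σ 2)) (m (σ 3))) := by
  have h : ∀ (σ : Equiv.Perm (Fin 4)) {i j : Fin 4}, i ≠ j → m (σ i) ≠ m (σ j) := fun σ i j hij =>
    (hm.comp σ.injective).ne hij
  refine ((hasJet_R₄ hf hparity hU hk hkU hP hA θ hm).congr rfl rfl ?_).upToSecondOrder
  exact Finset.sum_congr rfl fun σ _ => orderedTerm₄_eq_R₄asym A θ hf (h σ (by decide))
    (h σ (by decide)) (h σ (by decide)) (h σ (by decide)) (h σ (by decide)) (h σ (by decide))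

end Reduced

/-! ### Linear relations under which the single terms contribute. -/

section Relations

variable {d : ℕ} {L : Fin d → ℝ} [∀ i, Fact (0 < L i)] {Ω : Type*} [MeasurableSpace Ω]
  {μ : Measure Ω} {f : Ω → Box L → ℝ}

lemma add_eq_zero_of_bispec_ne_zero {x y z : Wavevector d} (h : bispec μ f x y z ≠ 0) :
    x + y + z = 0 := not_imp_comm.1 bispec_eq_zero h

lemma add_eq_zero_of_trispec_ne_zero {x y z w : Wavevector d} (h : trispec μ f x y z w ≠ 0) :
    x + y + z + w = 0 := not_imp_comm.1 trispec_eq_zero h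

variable {ι : Type*} (k : ι → Wavevector d) (A θ : ι → ℝ) (a b c e : ι)

lemma relation_of_R₂term₁_ne_zero (h : R₂term₁ (bispec μ f) k A θ a b ≠ 0) : 2 • k a = k b := by
  have h₁ := add_eq_zero_of_bispec_ne_zero (right_ne_zero_of_mul h)
  linear_combination h₁

lemma relation_of_R₂term₂_ne_zero (h : R₂term₂ (bispec μ f) k A θ a b ≠ 0) : 2 • k a = k b := by
  have h₁ := add_eq_zero_of_bispec_ne_zero (ne_zero_pow two_ne_zero (right_ne_zero_of_mul h))
  linear_combination h₁

lemma relation_of_R₂term₃_ne_zero (h : R₂term₃ (trispec μ f) k A θ a b ≠ 0) : 3 • k a = k b := by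
  have h₁ := add_eq_zero_of_trispec_ne_zero (right_ne_zero_of_mul h)
  linear_combination h₁

lemma relation_of_R₃term₁_ne_zero (h : R₃term₁ (bispec μ f) k A θ a b c ≠ 0) :
    k a + k b = k c := by
  have h₁ := add_eq_zero_of_bispec_ne_zero (right_ne_zero_of_mul h)
  linear_combination h₁

lemma relation_of_R₃term₂_ne_zero (h : R₃term₂ (trispec μ f) k A θ a b c ≠ 0) :
    2 • k a + k b = k c := by
  have h₁ := add_eq_zero_of_trispec_ne_zero (right_ne_zero_of_mul h)
  linear_combination h₁

lemma relation_of_R₃term₃_ne_zero (h : R₃term₃ (trispec μ f) k A θ a b c ≠ 0) :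
    2 • k a = k b + k c := by
  have h₁ := add_eq_zero_of_trispec_ne_zero (right_ne_zero_of_mul h)
  linear_combination h₁

lemma relation_of_R₃term₄_ne_zero (h : R₃term₄ (bispec μ f) k A θ a b c ≠ 0) :
    k a + k b = k c := by
  have h₁ := add_eq_zero_of_bispec_ne_zero (ne_zero_pow two_ne_zero (right_ne_zero_of_mul h))
  linear_combination h₁

lemma relation_of_R₃term₅_ne_zero (h : R₃term₅ (bispec μ f) k A θ a b c ≠ 0) :
    2 • k a = k b ∧ 4 • k a = k c := by
  have h₁ := add_eq_zero_of_bispec_ne_zero (left_ne_zero_of_mul (right_ne_zero_of_mul h))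
  have h₂ := add_eq_zero_of_bispec_ne_zero (right_ne_zero_of_mul (right_ne_zero_of_mul h))
  constructor
  · linear_combination h₁
  · linear_combination 2 * h₁ + h₂

lemma relation_of_R₃term₆_ne_zero (h : R₃term₆ (bispec μ f) k A θ a b c ≠ 0) :
    2 • k a = k b ∧ 3 • k a = k c := by
  have h₁ := add_eq_zero_of_bispec_ne_zero (left_ne_zero_of_mul (right_ne_zero_of_mul h))
  have h₂ := add_eq_zero_of_bispec_ne_zero (right_ne_zero_of_mul (right_ne_zero_of_mul h))
  constructor
  · linear_combination h₁
  · linear_combination h₁ + h₂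

lemma relation_of_R₄term₁_ne_zero (h : R₄term₁ (trispec μ f) k A θ a b c e ≠ 0) :
    k a + k b + k c = k e := by
  have h₁ := add_eq_zero_of_trispec_ne_zero (right_ne_zero_of_mul h)
  linear_combination h₁

lemma relation_of_R₄term₂_ne_zero (h : R₄term₂ (trispec μ f) k A θ a b c e ≠ 0) :
    k a + k b = k c + k e := by
  have h₁ := add_eq_zero_of_trispec_ne_zero (right_ne_zero_of_mul h)
  linear_combination h₁

lemma relation_of_R₄term₃_ne_zero (h : R₄term₃ (bispec μ f) k A θ a b c e ≠ 0) :
    2 • k a = k c ∧ k a + k e = k b := by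
  have h₁ := add_eq_zero_of_bispec_ne_zero (left_ne_zero_of_mul (right_ne_zero_of_mul h))
  have h₂ := add_eq_zero_of_bispec_ne_zero (right_ne_zero_of_mul (right_ne_zero_of_mul h))
  constructor
  · linear_combination h₁
  · linear_combination h₂

lemma relation_of_R₄term₄_ne_zero (h : R₄term₄ (bispec μ f) k A θ a b c e ≠ 0) :
    2 • k a = k e ∧ k a = k b + k c := by
  have h₁ := add_eq_zero_of_bispec_ne_zero (left_ne_zero_of_mul (right_ne_zero_of_mul h))
  have h₂ := add_eq_zero_of_bispec_ne_zero (right_ne_zero_of_mul (right_ne_zero_of_mul h))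
  constructor
  · linear_combination h₁
  · linear_combination -h₂

lemma relation_of_R₄term₅_ne_zero (h : R₄term₅ (bispec μ f) k A θ a b c e ≠ 0) :
    2 • k a = k e ∧ k b + k e = k c := by
  have h₁ := add_eq_zero_of_bispec_ne_zero (left_ne_zero_of_mul (right_ne_zero_of_mul h))
  have h₂ := add_eq_zero_of_bispec_ne_zero (right_ne_zero_of_mul (right_ne_zero_of_mul h))
  constructor
  · linear_combination h₁
  · linear_combination h₂

lemma relation_of_R₄term₆_ne_zero (h : R₄term₆ (bispec μ f) k A θ a b c e ≠ 0) :
    2 • k a = k e ∧ k b + k c = k e := by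
  have h₁ := add_eq_zero_of_bispec_ne_zero (left_ne_zero_of_mul (right_ne_zero_of_mul h))
  have h₂ := add_eq_zero_of_bispec_ne_zero (right_ne_zero_of_mul (right_ne_zero_of_mul h))
  constructor
  · linear_combination h₁
  · linear_combination h₂

lemma relation_of_R₄term₇_ne_zero (h : R₄term₇ (bispec μ f) k A θ a b c e ≠ 0) :
    k a + k b = k e ∧ k a + k e = k c := by
  have h₁ := add_eq_zero_of_bispec_ne_zero (left_ne_zero_of_mul (right_ne_zero_of_mul h))
  have h₂ := add_eq_zero_of_bispec_ne_zero (right_ne_zero_of_mul (right_ne_zero_of_mul h))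
  constructor
  · linear_combination h₁
  · linear_combination h₂

end Relations

end FourierModes

end

noncomputable section

namespace FourierModes

open MeasureTheory

/-! ## Phase correlations -/

section Couplings

variable {d : ℕ} {L : Fin d → ℝ} [∀ i, Fact (0 < L i)] {Ω : Type*} [MeasurableSpace Ω]
  {μ : Measure Ω} {f : Ω → Box L → ℝ} {ι : Type*} {k : ι → Wavevector d} {n : ℕ} {m : Fin n → ι}

/-- The indicator of an index. -/
def unitRelation {n : ℕ} (x i : Fin n) : ℤ := if i = x then 1 else 0

omit [∀ i, Fact (0 < L i)] in
lemma sum_unitRelation_smul (v : Fin n → Wavevector d) (x : Fin n) :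
    ∑ i, unitRelation x i • v i = v x := by
  simp [unitRelation, ite_smul]

/-- The relations between the wavevectors of the modes `m i` satisfy `Z`. -/
def RelationsSatisfy (k : ι → Wavevector d) (m : Fin n → ι) (Z : (Fin n → ℤ) → Prop) : Prop :=
  ∀ j : Fin n → ℤ, ∑ i, j i • k (m i) = 0 → Z j

variable {Z : (Fin n → ℤ) → Prop} (hZ : RelationsSatisfy k m Z)

include hZ

/-- A nonzero coupling makes its coefficient vector a relation, which then satisfies Z. For explicit
indices and equations Z, the failure of Z is decidable, so this serves as a simplification rule
discharged by `decide`. -/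
lemma sumCoupling_eq_zero (x y z : Fin n)
    (h : ¬ Z (fun i => unitRelation x i + unitRelation y i - unitRelation z i)) :
    sumCoupling μ f k (m x) (m y) (m z) = 0 :=
  bispec_eq_zero fun h₀ => h <| hZ _ <| by
    simp only [add_smul, sub_smul, Finset.sum_add_distrib, Finset.sum_sub_distrib,
      sum_unitRelation_smul fun i => k (m i)]
    simpa only [sub_eq_add_neg] using h₀

lemma sumCoupling₃₁_eq_zero (x y z w : Fin n)
    (h : ¬ Z (fun i => unitRelation x i + unitRelation y i + unitRelation z i
      - unitRelation w i)) :
    sumCoupling₃₁ μ f k (m x) (m y) (m z) (m w) = 0 :=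
  trispec_eq_zero fun h₀ => h <| hZ _ <| by
    simp only [add_smul, sub_smul, Finset.sum_add_distrib, Finset.sum_sub_distrib,
      sum_unitRelation_smul fun i => k (m i)]
    simpa only [sub_eq_add_neg] using h₀

lemma sumCoupling₂₂_eq_zero (x y z w : Fin n)
    (h : ¬ Z (fun i => unitRelation x i + unitRelation y i - unitRelation z i
      - unitRelation w i)) :
    sumCoupling₂₂ μ f k (m x) (m y) (m z) (m w) = 0 :=
  trispec_eq_zero fun h₀ => h <| hZ _ <| by
    simp only [add_smul, sub_smul, Finset.sum_add_distrib, Finset.sum_sub_distrib,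
      sum_unitRelation_smul fun i => k (m i)]
    simpa only [sub_eq_add_neg] using h₀

end Couplings

section Phases

variable {d : ℕ} {L : Fin d → ℝ} [∀ i, Fact (0 < L i)] {Ω : Type*} [MeasurableSpace Ω]
  {μ : Measure Ω} [IsProbabilityMeasure μ] {f : Ω → Box L → ℝ} (hf : IsHomogeneousField μ f)
  (hparity : ∀ (n : ℕ) (q : Fin n → Wavevector d),
    polyspectrum μ f n (fun i => -q i) = polyspectrum μ f n q)
  {U : Set (Wavevector d)} (hU : IsUpperHalf U)
  {ι : Type*} [Fintype ι] [DecidableEq ι] {k : ι → Wavevector d} (hk : Function.Injective k)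
  (hkU : ∀ i, k i ∈ U) (hP : ∀ i, powerSpectrum μ f (k i) ≠ 0) (θ : ι → ℝ)

include hf hparity hU hk hkU hP

/-- The trispectrum p₄(k_a, k_b, -k_a, -k_b) is always allowed by its relation, but it enters with
ρ(1,1)² = 0 and so does not correlate phases. -/
lemma upToSecondOrder_C₂ {a b : ι} (hab : a ≠ b) :
    UpToSecondOrder (C₂ μ f k a b θ)
      (((Real.sqrt Real.pi / 2 * Real.cos (2 * θ a - θ b) : ℝ) : ℂ) * sumCoupling μ f k a a b
        + ((Real.sqrt Real.pi / 2 * Real.cos (2 * θ b - θ a) : ℝ) : ℂ) * sumCoupling μ f k b b a)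
      (((1 / 2 * Real.cos (2 * (2 * θ a - θ b)) : ℝ) : ℂ) * sumCoupling μ f k a a b ^ 2
        + ((1 / 2 * Real.cos (2 * (2 * θ b - θ a)) : ℝ) : ℂ) * sumCoupling μ f k b b a ^ 2
        + ((Real.pi / 8 * Real.cos (3 * θ a - θ b) : ℝ) : ℂ) * sumCoupling₃₁ μ f k a a a b
        + ((Real.pi / 8 * Real.cos (3 * θ b - θ a) : ℝ) : ℂ) * sumCoupling₃₁ μ f k b b b a) := by
  have hb := isModeCoupling hf hparity hU hk hkU
  have hφ := isPolarWeight_phaseWeight θ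
  have hs : (Real.pi : ℂ) = (Real.sqrt Real.pi : ℂ) ^ 2 := by
    rw [← Complex.ofReal_pow, Real.sq_sqrt Real.pi_pos.le]
  have h₁ := modeOrder_phaseWeight_singleton hf hparity hU hk hkU θ
  have h₂ := wick_secondOrder_exact₂ (phaseWeight θ) hb hab
  refine ((hasJet_C₂ hf hparity hU hk hkU hP θ hab).congr rfl ?_ ?_).upToSecondOrder
  · refine (wick_cubic_pair (phaseWeight θ) hb hab).trans ?_
    rw [wick_polar_mon₃_pair hφ hab, wick_polar_mon₃_pair hφ hab.symm]
    simp only [phaseModulus_one_zero, phaseModulus_two_zero]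
    push_cast
    ring
  · have h₃ : modeOrder μ f k (phaseWeight θ) {a, b} 2 - (modeOrder μ f k (phaseWeight θ) {a} 2
      + modeOrder μ f k (phaseWeight θ) {b} 2) = _ := h₂
    rw [h₁, h₁, add_zero, sub_zero] at h₃
    rw [h₃, wick_polar_mon₃_pair_sq hφ hab, wick_polar_mon₃_pair_sq hφ hab.symm,
      wick_polar_mon₃₁_pair hφ hab, wick_polar_mon₃₁_pair hφ hab.symm,
      wick_polar_mon₂₂_pair hφ hab]
    simp only [phaseModulus_one_zero, phaseModulus_two_zero, phaseModulus_three_zero,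
      phaseModulus_four_zero, phaseModulus_self _ one_ne_zero, phaseModulus_self _ two_ne_zero]
    push_cast
    rw [hs]
    ring

end Phases

end FourierModes

end

noncomputable section

namespace FourierModes

open MeasureTheory

/-! ### General phase correlations of three and four modes as sums over orderings. -/

section Phases

variable {d : ℕ} {L : Fin d → ℝ} [∀ i, Fact (0 < L i)] {Ω : Type*} [MeasurableSpace Ω]
  {μ : Measure Ω} [IsProbabilityMeasure μ] {f : Ω → Box L → ℝ} (hf : IsHomogeneousField μ f)
  (hparity : ∀ (n : ℕ) (q : Fin n → Wavevector d),
    polyspectrum μ f n (fun i => -q i) = polyspectrum μ f n q)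
  {U : Set (Wavevector d)} (hU : IsUpperHalf U)
  {ι : Type*} [Fintype ι] [DecidableEq ι] {k : ι → Wavevector d} (hk : Function.Injective k)
  (hkU : ∀ i, k i ∈ U) (hP : ∀ i, powerSpectrum μ f (k i) ≠ 0) (θ : ι → ℝ)

/-- The second-order contribution of an ordered triple to the phase correlations. -/
def phaseTerm₃ (b : ι → ι → ι → ℂ) (q r : ι → ι → ι → ι → ℂ) (θ : ι → ℝ) (x y z : ι) : ℂ :=
  q x x y z * ((Real.pi / 4 * Real.cos (2 * θ x + θ y - θ z) : ℝ) : ℂ)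
    + r x x y z * ((Real.pi / 8 * Real.cos (2 * θ x - θ y - θ z) : ℝ) : ℂ)
    + b x y z ^ 2 * ((1 / 2 * Real.cos (2 * (θ x + θ y - θ z)) : ℝ) : ℂ)
    + b x x y * b y y z * ((Real.pi / 16 * (3 * Real.cos (2 * θ x - 3 * θ y + θ z)
      - Real.cos (2 * θ x + θ y - θ z)) : ℝ) : ℂ)
    - b x x y * b x y z * ((Real.pi / 8 * Real.cos (θ x - 2 * θ y + θ z) : ℝ) : ℂ)

/-- The contribution of an ordered quadruple to the phase correlations. -/
def phaseTerm₄ (b : ι → ι → ι → ℂ) (q r : ι → ι → ι → ι → ℂ) (θ : ι → ℝ) (x y z w : ι) : ℂ :=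
  q x y z w * ((Real.pi ^ 2 / 48 * Real.cos (θ x + θ y + θ z - θ w) : ℝ) : ℂ)
    + r x y z w * ((Real.pi ^ 2 / 64 * Real.cos (θ x + θ y - θ z - θ w) : ℝ) : ℂ)
    + b x x z * b x w y * ((Real.pi ^ 2 / 32 * (3 * Real.cos (3 * θ x - θ y - θ z + θ w)
      - Real.cos (θ x + θ y - θ z - θ w)) : ℝ) : ℂ)
    + b x x w * b y z x * ((Real.pi ^ 2 / 64 * (3 * Real.cos (3 * θ x - θ y - θ z - θ w)
      - Real.cos (θ x + θ y + θ z - θ w)) : ℝ) : ℂ)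
    + b x x w * b y w z * ((Real.pi / 4 * Real.cos (2 * θ x - θ y + θ z - 2 * θ w) : ℝ) : ℂ)
    + b x x w * b y z w * ((Real.pi / 8 * Real.cos (2 * θ x + θ y + θ z - 2 * θ w) : ℝ) : ℂ)

include hf hparity hU hk hkU hP

lemma upToSecondOrder_C₃ {m : Fin 3 → ι} (hm : Function.Injective m) :
    UpToSecondOrder (C₃ μ f k (m 0) (m 1) (m 2) θ)
      (permSum₃ (fun x y z => sumCoupling μ f k x y z *
        ((Real.pi ^ (3 / 2 : ℝ) / 8 * Real.cos (θ x + θ y - θ z) : ℝ) : ℂ)) (m 0) (m 1) (m 2))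
      (permSum₃ (phaseTerm₃ (sumCoupling μ f k) (sumCoupling₃₁ μ f k) (sumCoupling₂₂ μ f k) θ)
        (m 0) (m 1) (m 2)) := by
  have h : ∀ (σ : Equiv.Perm (Fin 3)) {i j : Fin 3}, i ≠ j → m (σ i) ≠ m (σ j) := fun σ i j hij =>
    (hm.comp σ.injective).ne hij
  have hs : Real.pi ^ (3 / 2 : ℝ) = Real.sqrt Real.pi ^ 3 := by
    rw [Real.sqrt_eq_rpow, ← Real.rpow_natCast, ← Real.rpow_mul Real.pi_pos.le]
    norm_num
  rw [← sum_perm_three, ← sum_perm_three]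
  refine ((hasJet_C₃ hf hparity hU hk hkU hP θ hm).congr rfl ?_ ?_).upToSecondOrder
  · refine Finset.sum_congr rfl fun σ _ => ?_
    rw [wick_polar_mon₃_triple (isPolarWeight_phaseWeight θ) (h σ (by decide)) (h σ (by decide))
      (h σ (by decide)), hs]
    simp only [phaseModulus_one_zero]
    push_cast
    ring
  · exact Finset.sum_congr rfl fun σ _ => orderedTerm₃_phaseWeight _ _ _ θ (h σ (by decide))
      (h σ (by decide)) (h σ (by decide))

lemma upToSecondOrder_C₄ {m : Fin 4 → ι} (hm : Function.Injective m) :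
    UpToSecondOrder (C₄ μ f k (m 0) (m 1) (m 2) (m 3) θ) 0
      (permSum₄ (phaseTerm₄ (sumCoupling μ f k) (sumCoupling₃₁ μ f k) (sumCoupling₂₂ μ f k) θ)
        (m 0) (m 1) (m 2) (m 3)) := by
  have h : ∀ (σ : Equiv.Perm (Fin 4)) {i j : Fin 4}, i ≠ j → m (σ i) ≠ m (σ j) := fun σ i j hij =>
    (hm.comp σ.injective).ne hij
  rw [← sum_perm_four]
  refine ((hasJet_C₄ hf hparity hU hk hkU hP θ hm).congr rfl rfl ?_).upToSecondOrder
  exact Finset.sum_congr rfl fun σ _ => orderedTerm₄_phaseWeight _ _ _ θ (h σ (by decide))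
    (h σ (by decide)) (h σ (by decide)) (h σ (by decide)) (h σ (by decide)) (h σ (by decide))

end Phases

section Couplings

variable {ι : Type*} {b : ι → ι → ι → ℂ} {q r : ι → ι → ι → ι → ℂ} (hb : IsModeCoupling b q r)

include hb in
lemma IsModeCoupling.r_swap' (x y z w : ι) : r x y z w = r x y w z := by
  rw [hb.r_flip, hb.r_swap, hb.r_flip]

end Couplings

/-! ### Three phases with prescribed relations. -/

section ThreeModes

variable {d : ℕ} {L : Fin d → ℝ} [∀ i, Fact (0 < L i)] {Ω : Type*} [MeasurableSpace Ω]
  {μ : Measure Ω} [IsProbabilityMeasure μ] {f : Ω → Box L → ℝ} (hf : IsHomogeneousField μ f)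
  (hparity : ∀ (n : ℕ) (q : Fin n → Wavevector d),
    polyspectrum μ f n (fun i => -q i) = polyspectrum μ f n q)
  {U : Set (Wavevector d)} (hU : IsUpperHalf U)
  {ι : Type*} [Fintype ι] [DecidableEq ι] {k : ι → Wavevector d} (hk : Function.Injective k)
  (hkU : ∀ i, k i ∈ U) (hP : ∀ i, powerSpectrum μ f (k i) ≠ 0) (θ : ι → ℝ)
  {m : Fin 3 → ι} (hm : Function.Injective m)

include hf hparity hU hk hkU hP hm

/-- The condition says that every relation is a multiple of (1, 1, -1). Only the bispectrum of k_1 +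
k_2 = k_3 passes it, in the two orders of the summands. -/
lemma upToSecondOrder_C₃_of_sum
    (hZ : RelationsSatisfy k m fun j => j 0 = j 1 ∧ j 2 = -j 0) :
    UpToSecondOrder (C₃ μ f k (m 0) (m 1) (m 2) θ)
      (((Real.pi ^ (3 / 2 : ℝ) / 4 * Real.cos (θ (m 0) + θ (m 1) - θ (m 2)) : ℝ) : ℂ) *
        sumCoupling μ f k (m 0) (m 1) (m 2))
      (((Real.cos (2 * (θ (m 0) + θ (m 1) - θ (m 2))) : ℝ) : ℂ) *
        sumCoupling μ f k (m 0) (m 1) (m 2) ^ 2) := by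
  have hb := isModeCoupling hf hparity hU hk hkU
  convert upToSecondOrder_C₃ hf hparity hU hk hkU hP θ hm using 1
  · simp (disch := decide) only [permSum₃, sumCoupling_eq_zero hZ, zero_mul, add_zero]
    rw [hb.b_swap (m 1), add_comm (θ (m 1))]
    push_cast
    ring
  · simp (disch := decide) only [permSum₃, phaseTerm₃, sumCoupling_eq_zero hZ,
      sumCoupling₃₁_eq_zero hZ, sumCoupling₂₂_eq_zero hZ, mul_zero, zero_mul, add_zero, zero_add,
      sub_zero, sub_self, zero_pow]
    have h0 := phase_ne_zero (θ (m 0))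
    have h1 := phase_ne_zero (θ (m 1))
    have h2 := phase_ne_zero (θ (m 2))
    simp only [hb.b_swap]
    simp only [Complex.ofReal_mul, Complex.ofReal_div, Complex.ofReal_one, Complex.ofReal_ofNat,
      ofReal_cos_eq_phase, phase_add, phase_sub, phase_ofNat_mul]
    field_simp
    ring

lemma upToSecondOrder_C₃_of_double_add
    (hZ : RelationsSatisfy k m fun j => j 0 = 2 * j 1 ∧ j 2 = -j 1) :
    UpToSecondOrder (C₃ μ f k (m 0) (m 1) (m 2) θ)
      0
      (((Real.pi / 4 * Real.cos (2 * θ (m 0) + θ (m 1) - θ (m 2)) : ℝ) : ℂ) *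
        sumCoupling₃₁ μ f k (m 0) (m 0) (m 1) (m 2)) := by
  convert upToSecondOrder_C₃ hf hparity hU hk hkU hP θ hm using 1
  · simp (disch := decide) only [permSum₃, sumCoupling_eq_zero hZ, zero_mul, add_zero]
  · simp (disch := decide) only [permSum₃, phaseTerm₃, sumCoupling_eq_zero hZ,
      sumCoupling₃₁_eq_zero hZ, sumCoupling₂₂_eq_zero hZ, mul_zero, zero_mul, add_zero, sub_zero,
      sub_self, zero_pow]
    rw [mul_comm]

lemma upToSecondOrder_C₃_of_double
    (hZ : RelationsSatisfy k m fun j => j 0 = -2 * j 1 ∧ j 2 = j 1) :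
    UpToSecondOrder (C₃ μ f k (m 0) (m 1) (m 2) θ)
      0
      (((Real.pi / 4 * Real.cos (2 * θ (m 0) - θ (m 1) - θ (m 2)) : ℝ) : ℂ) *
        sumCoupling₂₂ μ f k (m 0) (m 0) (m 1) (m 2)) := by
  have hb := isModeCoupling hf hparity hU hk hkU
  convert upToSecondOrder_C₃ hf hparity hU hk hkU hP θ hm using 1
  · simp (disch := decide) only [permSum₃, sumCoupling_eq_zero hZ, zero_mul, add_zero]
  · simp (disch := decide) only [permSum₃, phaseTerm₃, sumCoupling_eq_zero hZ,
      sumCoupling₃₁_eq_zero hZ, sumCoupling₂₂_eq_zero hZ, mul_zero, zero_mul, add_zero, zero_add,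
      sub_zero, sub_self, zero_pow]
    have h0 := phase_ne_zero (θ (m 0))
    have h1 := phase_ne_zero (θ (m 1))
    have h2 := phase_ne_zero (θ (m 2))
    simp only [hb.r_swap']
    simp only [Complex.ofReal_mul, Complex.ofReal_div, Complex.ofReal_ofNat, ofReal_cos_eq_phase,
      phase_sub, phase_ofNat_mul]
    field_simp
    ring

/-- Besides the bispectrum of 1 + 2 = 3, the relation 2 + 2 = 1 + 3 admits a trispectrum and 1 + 1 =
2 a second bispectrum. Both corrections carry the same cosine. -/
lemma upToSecondOrder_C₃_one_two_three
    (hZ : RelationsSatisfy k m fun j => j 0 + 2 * j 1 + 3 * j 2 = 0) :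
    UpToSecondOrder (C₃ μ f k (m 0) (m 1) (m 2) θ)
      (((Real.pi ^ (3 / 2 : ℝ) / 4 * Real.cos (θ (m 0) + θ (m 1) - θ (m 2)) : ℝ) : ℂ) *
        sumCoupling μ f k (m 0) (m 1) (m 2))
      (((Real.cos (2 * (θ (m 0) + θ (m 1) - θ (m 2))) : ℝ) : ℂ) *
        sumCoupling μ f k (m 0) (m 1) (m 2) ^ 2
        + ((Real.pi / 8 * Real.cos (θ (m 0) - 2 * θ (m 1) + θ (m 2)) : ℝ) : ℂ) *
          (2 * sumCoupling₂₂ μ f k (m 1) (m 1) (m 0) (m 2)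
            - sumCoupling μ f k (m 0) (m 0) (m 1) * sumCoupling μ f k (m 0) (m 1) (m 2))) := by
  have hb := isModeCoupling hf hparity hU hk hkU
  convert upToSecondOrder_C₃ hf hparity hU hk hkU hP θ hm using 1
  · simp (disch := decide) only [permSum₃, sumCoupling_eq_zero hZ, zero_mul, add_zero]
    rw [hb.b_swap (m 1), add_comm (θ (m 1))]
    push_cast
    ring
  · simp (disch := decide) only [permSum₃, phaseTerm₃, sumCoupling_eq_zero hZ,
      sumCoupling₃₁_eq_zero hZ, sumCoupling₂₂_eq_zero hZ, mul_zero, zero_mul, add_zero, zero_add,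
      sub_zero, sub_self, zero_pow]
    have h0 := phase_ne_zero (θ (m 0))
    have h1 := phase_ne_zero (θ (m 1))
    have h2 := phase_ne_zero (θ (m 2))
    simp only [hb.b_swap, hb.r_swap', hb.r_flip]
    simp only [Complex.ofReal_mul, Complex.ofReal_div, Complex.ofReal_one, Complex.ofReal_ofNat,
      ofReal_cos_eq_phase, phase_add, phase_sub, phase_ofNat_mul]
    field_simp
    ring

/-- The admissible relations are 1 + 1 + 2 = 4 and the chain 1 + 1 = 2, 2 + 2 = 4. No bispectrum
involves all three modes, so there is no term of first order. -/
lemma upToSecondOrder_C₃_one_two_four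
    (hZ : RelationsSatisfy k m fun j => j 0 + 2 * j 1 + 4 * j 2 = 0) :
    UpToSecondOrder (C₃ μ f k (m 0) (m 1) (m 2) θ)
      0
      (((Real.pi / 4 * Real.cos (2 * θ (m 0) + θ (m 1) - θ (m 2)) : ℝ) : ℂ) *
        sumCoupling₃₁ μ f k (m 0) (m 0) (m 1) (m 2)
        + ((Real.pi / 8 * (3 * Real.cos (2 * θ (m 0) - θ (m 1)) * Real.cos (2 * θ (m 1) - θ (m 2))
          - 2 * Real.cos (2 * θ (m 0) + θ (m 1) - θ (m 2))) : ℝ) : ℂ) *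
            (sumCoupling μ f k (m 0) (m 0) (m 1) * sumCoupling μ f k (m 1) (m 1) (m 2))) := by
  have hb := isModeCoupling hf hparity hU hk hkU
  convert upToSecondOrder_C₃ hf hparity hU hk hkU hP θ hm using 1
  · simp (disch := decide) only [permSum₃, sumCoupling_eq_zero hZ, zero_mul, add_zero]
  · simp (disch := decide) only [permSum₃, phaseTerm₃, sumCoupling_eq_zero hZ,
      sumCoupling₃₁_eq_zero hZ, sumCoupling₂₂_eq_zero hZ, mul_zero, zero_mul, add_zero, sub_zero,
      sub_self, zero_pow]
    have h0 := phase_ne_zero (θ (m 0))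
    have h1 := phase_ne_zero (θ (m 1))
    have h2 := phase_ne_zero (θ (m 2))
    simp only [Complex.ofReal_sub, Complex.ofReal_mul, Complex.ofReal_div, Complex.ofReal_ofNat,
      ofReal_cos_eq_phase, phase_add, phase_sub, phase_ofNat_mul]
    field_simp
    ring

end ThreeModes

end FourierModes

end

noncomputable section

namespace FourierModes

open MeasureTheory

/-! ### Four phases with prescribed relations. -/

section FourModes

variable {d : ℕ} {L : Fin d → ℝ} [∀ i, Fact (0 < L i)] {Ω : Type*} [MeasurableSpace Ω]
  {μ : Measure Ω} [IsProbabilityMeasure μ] {f : Ω → Box L → ℝ} (hf : IsHomogeneousField μ f)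
  (hparity : ∀ (n : ℕ) (q : Fin n → Wavevector d),
    polyspectrum μ f n (fun i => -q i) = polyspectrum μ f n q)
  {U : Set (Wavevector d)} (hU : IsUpperHalf U)
  {ι : Type*} [Fintype ι] [DecidableEq ι] {k : ι → Wavevector d} (hk : Function.Injective k)
  (hkU : ∀ i, k i ∈ U) (hP : ∀ i, powerSpectrum μ f (k i) ≠ 0) (θ : ι → ℝ)
  {m : Fin 4 → ι} (hm : Function.Injective m)

include hf hparity hU hk hkU hP hm

lemma upToSecondOrder_C₄_of_sum_three
    (hZ : RelationsSatisfy k m fun j => j 0 = j 1 ∧ j 1 = j 2 ∧ j 3 = -j 0) :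
    UpToSecondOrder (C₄ μ f k (m 0) (m 1) (m 2) (m 3) θ)
      0
      (((Real.pi ^ 2 / 8 * Real.cos (θ (m 0) + θ (m 1) + θ (m 2) - θ (m 3)) : ℝ) : ℂ) *
        sumCoupling₃₁ μ f k (m 0) (m 1) (m 2) (m 3)) := by
  have hb := isModeCoupling hf hparity hU hk hkU
  convert upToSecondOrder_C₄ hf hparity hU hk hkU hP θ hm using 1
  simp (disch := decide) only [permSum₄, phaseTerm₄, sumCoupling_eq_zero hZ,
    sumCoupling₃₁_eq_zero hZ, sumCoupling₂₂_eq_zero hZ, mul_zero, zero_mul, add_zero]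
  have h0 := phase_ne_zero (θ (m 0))
  have h1 := phase_ne_zero (θ (m 1))
  have h2 := phase_ne_zero (θ (m 2))
  have h3 := phase_ne_zero (θ (m 3))
  simp only [hb.q_swap, hb.q_swap']
  simp only [Complex.ofReal_mul, Complex.ofReal_div, Complex.ofReal_pow, Complex.ofReal_ofNat,
    ofReal_cos_eq_phase, phase_add, phase_sub]
  field_simp
  ring

lemma upToSecondOrder_C₄_of_sum_two
    (hZ : RelationsSatisfy k m fun j => j 0 = j 1 ∧ j 2 = -j 0 ∧ j 3 = -j 0) :
    UpToSecondOrder (C₄ μ f k (m 0) (m 1) (m 2) (m 3) θ)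
      0
      (((Real.pi ^ 2 / 8 * Real.cos (θ (m 0) + θ (m 1) - θ (m 2) - θ (m 3)) : ℝ) : ℂ) *
        sumCoupling₂₂ μ f k (m 0) (m 1) (m 2) (m 3)) := by
  have hb := isModeCoupling hf hparity hU hk hkU
  convert upToSecondOrder_C₄ hf hparity hU hk hkU hP θ hm using 1
  simp (disch := decide) only [permSum₄, phaseTerm₄, sumCoupling_eq_zero hZ,
    sumCoupling₃₁_eq_zero hZ, sumCoupling₂₂_eq_zero hZ, mul_zero, zero_mul, add_zero, zero_add]
  have h0 := phase_ne_zero (θ (m 0))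
  have h1 := phase_ne_zero (θ (m 1))
  have h2 := phase_ne_zero (θ (m 2))
  have h3 := phase_ne_zero (θ (m 3))
  simp only [hb.r_swap, hb.r_swap', hb.r_flip]
  simp only [Complex.ofReal_mul, Complex.ofReal_div, Complex.ofReal_pow, Complex.ofReal_ofNat,
    ofReal_cos_eq_phase, phase_add, phase_sub]
  field_simp
  ring

/-- The difference of the relations (2, 0, -1, 0) and (1, -1, 0, 1) is (1, 1, -1, -1), which
accounts for the trispectrum. -/
lemma upToSecondOrder_C₄_of_double_sum₁
    (hZ : RelationsSatisfy k m fun j => j 0 + j 1 + 2 * j 2 = 0 ∧ j 1 + j 3 = 0) :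
    UpToSecondOrder (C₄ μ f k (m 0) (m 1) (m 2) (m 3) θ)
      0
      (((Real.pi ^ 2 / 8 * Real.cos (θ (m 0) + θ (m 1) - θ (m 2) - θ (m 3)) : ℝ) : ℂ) *
        sumCoupling₂₂ μ f k (m 0) (m 1) (m 2) (m 3)
        + ((Real.pi ^ 2 / 16 * (3 * Real.cos (2 * θ (m 0) - θ (m 2)) *
          Real.cos (θ (m 0) - θ (m 1) + θ (m 3))
          - 2 * Real.cos (θ (m 0) + θ (m 1) - θ (m 2) - θ (m 3))) : ℝ) : ℂ) *
            (sumCoupling μ f k (m 0) (m 0) (m 2) * sumCoupling μ f k (m 0) (m 3) (m 1))) := by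
  have hb := isModeCoupling hf hparity hU hk hkU
  convert upToSecondOrder_C₄ hf hparity hU hk hkU hP θ hm using 1
  simp (disch := decide) only [permSum₄, phaseTerm₄, sumCoupling_eq_zero hZ,
    sumCoupling₃₁_eq_zero hZ, sumCoupling₂₂_eq_zero hZ, mul_zero, zero_mul, add_zero, zero_add]
  have h0 := phase_ne_zero (θ (m 0))
  have h1 := phase_ne_zero (θ (m 1))
  have h2 := phase_ne_zero (θ (m 2))
  have h3 := phase_ne_zero (θ (m 3))
  simp only [hb.r_swap, hb.r_swap', hb.r_flip]
  simp only [Complex.ofReal_sub, Complex.ofReal_mul, Complex.ofReal_div, Complex.ofReal_pow,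
    Complex.ofReal_ofNat, ofReal_cos_eq_phase, phase_add, phase_sub, phase_ofNat_mul]
  field_simp
  ring

/-- The trispectrum belongs to (1, 1, 1, -1), the difference of (2, 0, 0, -1) and (1, -1, -1, 0). -/
lemma upToSecondOrder_C₄_of_double_sum₂
    (hZ : RelationsSatisfy k m fun j => j 0 + j 1 + 2 * j 3 = 0 ∧ j 0 + j 2 + 2 * j 3 = 0) :
    UpToSecondOrder (C₄ μ f k (m 0) (m 1) (m 2) (m 3) θ)
      0
      (((Real.pi ^ 2 / 8 * Real.cos (θ (m 0) + θ (m 1) + θ (m 2) - θ (m 3)) : ℝ) : ℂ) *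
        sumCoupling₃₁ μ f k (m 0) (m 1) (m 2) (m 3)
        + ((Real.pi ^ 2 / 16 * (3 * Real.cos (2 * θ (m 0) - θ (m 3)) *
          Real.cos (θ (m 0) - θ (m 1) - θ (m 2))
          - 2 * Real.cos (θ (m 0) + θ (m 1) + θ (m 2) - θ (m 3))) : ℝ) : ℂ) *
            (sumCoupling μ f k (m 0) (m 0) (m 3) * sumCoupling μ f k (m 1) (m 2) (m 0))) := by
  have hb := isModeCoupling hf hparity hU hk hkU
  convert upToSecondOrder_C₄ hf hparity hU hk hkU hP θ hm using 1
  simp (disch := decide) only [permSum₄, phaseTerm₄, sumCoupling_eq_zero hZ,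
    sumCoupling₃₁_eq_zero hZ, sumCoupling₂₂_eq_zero hZ, mul_zero, zero_mul, add_zero]
  have h0 := phase_ne_zero (θ (m 0))
  have h1 := phase_ne_zero (θ (m 1))
  have h2 := phase_ne_zero (θ (m 2))
  have h3 := phase_ne_zero (θ (m 3))
  simp only [hb.b_swap, hb.q_swap, hb.q_swap']
  simp only [Complex.ofReal_sub, Complex.ofReal_mul, Complex.ofReal_div, Complex.ofReal_pow,
    Complex.ofReal_ofNat, ofReal_cos_eq_phase, phase_add, phase_sub, phase_ofNat_mul]
  field_simp
  ring

/-- In every relation the first coefficient is even, so no trispectrum of four distinct modes is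
possible. A single ordering of the product of bispectra survives. -/
lemma upToSecondOrder_C₄_of_double_sum₃
    (hZ : RelationsSatisfy k m fun j => j 0 + 2 * j 2 + 2 * j 3 = 0 ∧ j 1 + j 2 = 0) :
    UpToSecondOrder (C₄ μ f k (m 0) (m 1) (m 2) (m 3) θ)
      0
      (((Real.pi / 4 * Real.cos (2 * θ (m 0) - θ (m 1) + θ (m 2) - 2 * θ (m 3)) : ℝ) : ℂ) *
        (sumCoupling μ f k (m 0) (m 0) (m 3) * sumCoupling μ f k (m 1) (m 3) (m 2))) := by
  convert upToSecondOrder_C₄ hf hparity hU hk hkU hP θ hm using 1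
  simp (disch := decide) only [permSum₄, phaseTerm₄, sumCoupling_eq_zero hZ,
    sumCoupling₃₁_eq_zero hZ, sumCoupling₂₂_eq_zero hZ, mul_zero, zero_mul, add_zero, zero_add]
  rw [mul_comm]

/-- Again the first coefficient is always even, which excludes trispectra. Exchanging the second and
third mode gives two equal orderings. -/
lemma upToSecondOrder_C₄_of_double_sum₄
    (hZ : RelationsSatisfy k m fun j => j 0 + 2 * j 2 + 2 * j 3 = 0 ∧ j 1 = j 2) :
    UpToSecondOrder (C₄ μ f k (m 0) (m 1) (m 2) (m 3) θ)
      0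
      (((Real.pi / 4 * Real.cos (2 * θ (m 0) + θ (m 1) + θ (m 2) - 2 * θ (m 3)) : ℝ) : ℂ) *
        (sumCoupling μ f k (m 0) (m 0) (m 3) * sumCoupling μ f k (m 1) (m 2) (m 3))) := by
  have hb := isModeCoupling hf hparity hU hk hkU
  convert upToSecondOrder_C₄ hf hparity hU hk hkU hP θ hm using 1
  simp (disch := decide) only [permSum₄, phaseTerm₄, sumCoupling_eq_zero hZ,
    sumCoupling₃₁_eq_zero hZ, sumCoupling₂₂_eq_zero hZ, mul_zero, zero_mul, add_zero, zero_add]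
  have h0 := phase_ne_zero (θ (m 0))
  have h1 := phase_ne_zero (θ (m 1))
  have h2 := phase_ne_zero (θ (m 2))
  have h3 := phase_ne_zero (θ (m 3))
  simp only [hb.b_swap]
  simp only [Complex.ofReal_mul, Complex.ofReal_div, Complex.ofReal_ofNat, ofReal_cos_eq_phase,
    phase_add, phase_sub, phase_ofNat_mul]
  field_simp
  ring

end FourModes

end FourierModes

end

noncomputable section

namespace FourierModes

open MeasureTheory

/-! ### From the absence of other relations to equations for the coefficients. -/

section Relations

variable {d : ℕ} {ι : Type*} {k : ι → Wavevector d} {a b c e : ι}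

/-- If all relations depend on a single one `v`, then every linear form that vanishes on `v`
vanishes on all relations. -/
lemma NoOtherRelation.eq_zero {n : ℕ} {q : Fin n → Wavevector d} {R : Set (Fin n → ℤ)}
    (h : NoOtherRelation q R) (φ : (Fin n → ℤ) →ₗ[ℤ] ℤ) (hφ : ∀ v ∈ R, φ v = 0) {j : Fin n → ℤ}
    (hj : ∑ i, j i • q i = 0) : φ j = 0 := by
  obtain ⟨c, hc, hmem⟩ := h j hj
  have h₀ : φ (c • j) = 0 := (Submodule.span_le (p := LinearMap.ker φ)).2 hφ hmem
  rw [map_smul, smul_eq_mul] at h₀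
  exact (mul_eq_zero.1 h₀).resolve_left hc

/-- The linear form with the coefficients `v`. -/
def coeffForm {n : ℕ} (v : Fin n → ℤ) : (Fin n → ℤ) →ₗ[ℤ] ℤ :=
  ∑ i, v i • LinearMap.proj i

lemma coeffForm_apply {n : ℕ} (v j : Fin n → ℤ) : coeffForm v j = ∑ i, v i * j i := by
  simp [coeffForm]

lemma NoOtherRelation.sum_mul_eq_zero {n : ℕ} {q : Fin n → Wavevector d} {R : Set (Fin n → ℤ)}
    (h : NoOtherRelation q R) (w : Fin n → ℤ) (hw : ∀ v ∈ R, ∑ i, w i * v i = 0) {j : Fin n → ℤ}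
    (hj : ∑ i, j i • q i = 0) : ∑ i, w i * j i = 0 := by
  simpa [coeffForm_apply] using h.eq_zero (coeffForm w) (by simpa [coeffForm_apply] using hw) hj

lemma relationsSatisfy_three {Z : (Fin 3 → ℤ) → Prop}
    (h : ∀ j : Fin 3 → ℤ, ∑ i, j i • ![k a, k b, k c] i = 0 → Z j) :
    RelationsSatisfy k ![a, b, c] Z := fun j hj =>
  h j (by simpa [Fin.sum_univ_three] using hj)

lemma relationsSatisfy_four {Z : (Fin 4 → ℤ) → Prop}
    (h : ∀ j : Fin 4 → ℤ, ∑ i, j i • ![k a, k b, k c, k e] i = 0 → Z j) :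
    RelationsSatisfy k ![a, b, c, e] Z := fun j hj =>
  h j (by simpa [Fin.sum_univ_four] using hj)

/-- Wavevectors have no torsion, so a relation between multiples of one nonzero vector is a single
equation of integers. -/
lemma relationsSatisfy_multiples (ha : k a ≠ 0) {s t : ℕ} (hb : k b = s • k a)
    (hc : k c = t • k a) :
    RelationsSatisfy k ![a, b, c] fun j => j 0 + s * j 1 + t * j 2 = 0 :=
  relationsSatisfy_three fun j hj => by
    have h₀ : (j 0 + s * j 1 + t * j 2) • k a = 0 := by
      rw [← hj, Fin.sum_univ_three]
      simp only [Matrix.cons_val, hb, hc, ← natCast_zsmul]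
      module
    exact (smul_eq_zero.1 h₀).resolve_right ha

lemma injective_three (hab : a ≠ b) (hac : a ≠ c) (hbc : b ≠ c) :
    Function.Injective ![a, b, c] := by
  intro i j
  fin_cases i <;> fin_cases j <;> simp [hab, hac, hbc, hab.symm, hac.symm, hbc.symm]

lemma injective_four (hab : a ≠ b) (hac : a ≠ c) (hae : a ≠ e) (hbc : b ≠ c) (hbe : b ≠ e)
    (hce : c ≠ e) : Function.Injective ![a, b, c, e] := by
  intro i j
  fin_cases i <;> fin_cases j <;> simp [hab, hac, hae, hbc, hbe, hce, hab.symm, hac.symm, hae.symm,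
    hbc.symm, hbe.symm, hce.symm]

end Relations

end FourierModes

end

/-! ### The main theorem. -/

open FourierModes MeasureTheory in
theorem mainTheorem11 {d : ℕ} (L : Fin d → ℝ) [∀ i, Fact (0 < L i)]
    {Ω : Type*} [MeasurableSpace Ω] (μ : Measure Ω) [IsProbabilityMeasure μ]
    (f : Ω → Box L → ℝ) (hf : IsHomogeneousField μ f)
    (hparity : ∀ (n : ℕ) (q : Fin n → Wavevector d),
      polyspectrum μ f n (fun i => -q i) = polyspectrum μ f n q)
    (U : Set (Wavevector d)) (hU : IsUpperHalf U)
    {ι : Type*} [Fintype ι] [DecidableEq ι] (k : ι → Wavevector d) (hk : Function.Injective k)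
    (hkU : ∀ i, k i ∈ U) (hP : ∀ i, powerSpectrum μ f (k i) ≠ 0) :
    -- the reduced 2-, 3- and 4-point distributions
    (∀ A θ : ι → ℝ, (∀ i, 0 < A i) →
      (∀ m : Fin 2 → ι, Function.Injective m →
        UpToSecondOrder (R₂ μ f k (m 0) (m 1) A θ)
          (R₂term₁ (bispec μ f) k A θ (m 0) (m 1) + R₂term₁ (bispec μ f) k A θ (m 1) (m 0))
          (R₂term₂ (bispec μ f) k A θ (m 0) (m 1) + R₂term₂ (bispec μ f) k A θ (m 1) (m 0)
            + (R₂term₃ (trispec μ f) k A θ (m 0) (m 1)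
              + R₂term₃ (trispec μ f) k A θ (m 1) (m 0))
            + R₂term₄ (trispec μ f) k A (m 0) (m 1))) ∧
      (∀ m : Fin 3 → ι, Function.Injective m →
        UpToSecondOrder (R₃ μ f k (m 0) (m 1) (m 2) A θ)
          (∑ σ : Equiv.Perm (Fin 3),
            R₃term₁ (bispec μ f) k A θ (m (σ 0)) (m (σ 1)) (m (σ 2)))
          (∑ σ : Equiv.Perm (Fin 3),
            R₃asym (bispec μ f) (trispec μ f) k A θ (m (σ 0)) (m (σ 1)) (m (σ 2)))) ∧
      (∀ m : Fin 4 → ι, Function.Injective m →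
        UpToSecondOrder (R₄ μ f k (m 0) (m 1) (m 2) (m 3) A θ)
          0
          (∑ σ : Equiv.Perm (Fin 4),
            R₄asym (bispec μ f) (trispec μ f) k A θ
              (m (σ 0)) (m (σ 1)) (m (σ 2)) (m (σ 3))))) ∧
    -- the linear relations under which the single terms contribute
    (∀ (A θ : ι → ℝ) (a b c e : ι),
      (R₂term₁ (bispec μ f) k A θ a b ≠ 0 → 2 • k a = k b) ∧
      (R₂term₂ (bispec μ f) k A θ a b ≠ 0 → 2 • k a = k b) ∧
      (R₂term₃ (trispec μ f) k A θ a b ≠ 0 → 3 • k a = k b) ∧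
      (R₃term₁ (bispec μ f) k A θ a b c ≠ 0 → k a + k b = k c) ∧
      (R₃term₂ (trispec μ f) k A θ a b c ≠ 0 → 2 • k a + k b = k c) ∧
      (R₃term₃ (trispec μ f) k A θ a b c ≠ 0 → 2 • k a = k b + k c) ∧
      (R₃term₄ (bispec μ f) k A θ a b c ≠ 0 → k a + k b = k c) ∧
      (R₃term₅ (bispec μ f) k A θ a b c ≠ 0 → 2 • k a = k b ∧ 4 • k a = k c) ∧
      (R₃term₆ (bispec μ f) k A θ a b c ≠ 0 → 2 • k a = k b ∧ 3 • k a = k c) ∧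
      (R₄term₁ (trispec μ f) k A θ a b c e ≠ 0 → k a + k b + k c = k e) ∧
      (R₄term₂ (trispec μ f) k A θ a b c e ≠ 0 → k a + k b = k c + k e) ∧
      (R₄term₃ (bispec μ f) k A θ a b c e ≠ 0 → 2 • k a = k c ∧ k a + k e = k b) ∧
      (R₄term₄ (bispec μ f) k A θ a b c e ≠ 0 → 2 • k a = k e ∧ k a = k b + k c) ∧
      (R₄term₅ (bispec μ f) k A θ a b c e ≠ 0 → 2 • k a = k e ∧ k b + k e = k c) ∧
      (R₄term₆ (bispec μ f) k A θ a b c e ≠ 0 → 2 • k a = k e ∧ k b + k c = k e) ∧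
      (R₄term₇ (bispec μ f) k A θ a b c e ≠ 0 → k a + k b = k e ∧ k a + k e = k c)) ∧
    -- two-point phase correlations
    (∀ (θ : ι → ℝ) (a b : ι), a ≠ b →
      (2 • k a = k b → UpToSecondOrder (C₂ μ f k a b θ)
        (((Real.sqrt Real.pi / 2 * Real.cos (2 * θ a - θ b) : ℝ) : ℂ) *
          bispec μ f (k a) (k a) (-k b))
        (((1 / 2 * Real.cos (2 * (2 * θ a - θ b)) : ℝ) : ℂ) *
          bispec μ f (k a) (k a) (-k b) ^ 2)) ∧
      (3 • k a = k b → UpToSecondOrder (C₂ μ f k a b θ)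
        0
        (((Real.pi / 8 * Real.cos (3 * θ a - θ b) : ℝ) : ℂ) *
          trispec μ f (k a) (k a) (k a) (-k b))) ∧
      (2 • k a ≠ k b → 2 • k b ≠ k a → 3 • k a ≠ k b → 3 • k b ≠ k a →
        UpToSecondOrder (C₂ μ f k a b θ) 0 0)) ∧
    -- three-point phase correlations
    (∀ (θ : ι → ℝ) (a b c : ι), a ≠ b → a ≠ c → b ≠ c →
      (k a + k b = k c → NoOtherRelation ![k a, k b, k c] {![1, 1, -1]} →
        UpToSecondOrder (C₃ μ f k a b c θ)
          (((Real.pi ^ (3 / 2 : ℝ) / 4 * Real.cos (θ a + θ b - θ c) : ℝ) : ℂ) *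
            bispec μ f (k a) (k b) (-k c))
          (((Real.cos (2 * (θ a + θ b - θ c)) : ℝ) : ℂ) *
            bispec μ f (k a) (k b) (-k c) ^ 2)) ∧
      (2 • k a + k b = k c → NoOtherRelation ![k a, k b, k c] {![2, 1, -1]} →
        UpToSecondOrder (C₃ μ f k a b c θ)
          0
          (((Real.pi / 4 * Real.cos (2 * θ a + θ b - θ c) : ℝ) : ℂ) *
            trispec μ f (k a) (k a) (k b) (-k c))) ∧
      (2 • k a = k b + k c → NoOtherRelation ![k a, k b, k c] {![2, -1, -1]} →
        UpToSecondOrder (C₃ μ f k a b c θ)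
          0
          (((Real.pi / 4 * Real.cos (2 * θ a - θ b - θ c) : ℝ) : ℂ) *
            trispec μ f (k a) (k a) (-k b) (-k c))) ∧
      (k b = 2 • k a → k c = 3 • k a →
        UpToSecondOrder (C₃ μ f k a b c θ)
          (((Real.pi ^ (3 / 2 : ℝ) / 4 * Real.cos (θ a + θ b - θ c) : ℝ) : ℂ) *
            bispec μ f (k a) (k b) (-k c))
          (((Real.cos (2 * (θ a + θ b - θ c)) : ℝ) : ℂ) *
              bispec μ f (k a) (k b) (-k c) ^ 2
            + ((Real.pi / 8 * Real.cos (θ a - 2 * θ b + θ c) : ℝ) : ℂ) *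
              (2 * trispec μ f (k b) (k b) (-k a) (-k c)
                - bispec μ f (k a) (k a) (-k b) * bispec μ f (k a) (k b) (-k c)))) ∧
      (k b = 2 • k a → k c = 4 • k a →
        UpToSecondOrder (C₃ μ f k a b c θ)
          0
          (((Real.pi / 4 * Real.cos (2 * θ a + θ b - θ c) : ℝ) : ℂ) *
              trispec μ f (k a) (k a) (k b) (-k c)
            + ((Real.pi / 8 * (3 * Real.cos (2 * θ a - θ b) * Real.cos (2 * θ b - θ c)
                - 2 * Real.cos (2 * θ a + θ b - θ c)) : ℝ) : ℂ) *
              (bispec μ f (k a) (k a) (-k b) * bispec μ f (k b) (k b) (-k c))))) ∧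
    -- four-point phase correlations
    (∀ (θ : ι → ℝ) (a b c e : ι), a ≠ b → a ≠ c → a ≠ e → b ≠ c → b ≠ e → c ≠ e →
      (k a + k b + k c = k e → NoOtherRelation ![k a, k b, k c, k e] {![1, 1, 1, -1]} →
        UpToSecondOrder (C₄ μ f k a b c e θ)
          0
          (((Real.pi ^ 2 / 8 * Real.cos (θ a + θ b + θ c - θ e) : ℝ) : ℂ) *
            trispec μ f (k a) (k b) (k c) (-k e))) ∧
      (k a + k b = k c + k e → NoOtherRelation ![k a, k b, k c, k e] {![1, 1, -1, -1]} →
        UpToSecondOrder (C₄ μ f k a b c e θ)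
          0
          (((Real.pi ^ 2 / 8 * Real.cos (θ a + θ b - θ c - θ e) : ℝ) : ℂ) *
            trispec μ f (k a) (k b) (-k c) (-k e))) ∧
      (2 • k a = k c → k a + k e = k b →
        NoOtherRelation ![k a, k b, k c, k e] {![2, 0, -1, 0], ![1, -1, 0, 1]} →
        UpToSecondOrder (C₄ μ f k a b c e θ)
          0
          (((Real.pi ^ 2 / 8 * Real.cos (θ a + θ b - θ c - θ e) : ℝ) : ℂ) *
              trispec μ f (k a) (k b) (-k c) (-k e)
            + ((Real.pi ^ 2 / 16 * (3 * Real.cos (2 * θ a - θ c) * Real.cos (θ a - θ b + θ e)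
                - 2 * Real.cos (θ a + θ b - θ c - θ e)) : ℝ) : ℂ) *
              (bispec μ f (k a) (k a) (-k c) * bispec μ f (k a) (-k b) (k e)))) ∧
      (2 • k a = k e → k a = k b + k c →
        NoOtherRelation ![k a, k b, k c, k e] {![2, 0, 0, -1], ![1, -1, -1, 0]} →
        UpToSecondOrder (C₄ μ f k a b c e θ)
          0
          (((Real.pi ^ 2 / 8 * Real.cos (θ a + θ b + θ c - θ e) : ℝ) : ℂ) *
              trispec μ f (k a) (k b) (k c) (-k e)
            + ((Real.pi ^ 2 / 16 * (3 * Real.cos (2 * θ a - θ e) * Real.cos (θ a - θ b - θ c)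
                - 2 * Real.cos (θ a + θ b + θ c - θ e)) : ℝ) : ℂ) *
              (bispec μ f (k a) (k a) (-k e) * bispec μ f (-k a) (k b) (k c)))) ∧
      (2 • k a = k e → k b + k e = k c →
        NoOtherRelation ![k a, k b, k c, k e] {![2, 0, 0, -1], ![0, 1, -1, 1]} →
        UpToSecondOrder (C₄ μ f k a b c e θ)
          0
          (((Real.pi / 4 * Real.cos (2 * θ a - θ b + θ c - 2 * θ e) : ℝ) : ℂ) *
            (bispec μ f (k a) (k a) (-k e) * bispec μ f (k b) (-k c) (k e)))) ∧
      (2 • k a = k e → k b + k c = k e →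
        NoOtherRelation ![k a, k b, k c, k e] {![2, 0, 0, -1], ![0, 1, 1, -1]} →
        UpToSecondOrder (C₄ μ f k a b c e θ)
          0
          (((Real.pi / 4 * Real.cos (2 * θ a + θ b + θ c - 2 * θ e) : ℝ) : ℂ) *
            (bispec μ f (k a) (k a) (-k e) * bispec μ f (k b) (k c) (-k e))))) := by
  refine ⟨fun A θ hA => ⟨fun m hm => upToSecondOrder_R₂ hf hparity hU hk hkU hP hA θ
      (hm.ne (by decide)),
    fun m hm => upToSecondOrder_R₃ hf hparity hU hk hkU hP hA θ hm,
    fun m hm => upToSecondOrder_R₄ hf hparity hU hk hkU hP hA θ hm⟩,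
    fun A θ a b c e => ⟨relation_of_R₂term₁_ne_zero k A θ a b,
      relation_of_R₂term₂_ne_zero k A θ a b, relation_of_R₂term₃_ne_zero k A θ a b,
      relation_of_R₃term₁_ne_zero k A θ a b c, relation_of_R₃term₂_ne_zero k A θ a b c,
      relation_of_R₃term₃_ne_zero k A θ a b c, relation_of_R₃term₄_ne_zero k A θ a b c,
      relation_of_R₃term₅_ne_zero k A θ a b c, relation_of_R₃term₆_ne_zero k A θ a b c,
      relation_of_R₄term₁_ne_zero k A θ a b c e, relation_of_R₄term₂_ne_zero k A θ a b c e,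
      relation_of_R₄term₃_ne_zero k A θ a b c e, relation_of_R₄term₄_ne_zero k A θ a b c e,
      relation_of_R₄term₅_ne_zero k A θ a b c e, relation_of_R₄term₆_ne_zero k A θ a b c e,
      relation_of_R₄term₇_ne_zero k A θ a b c e⟩, fun θ a b hab => ?_,
    fun θ a b c hab hac hbc => ?_, fun θ a b c e hab hac hae hbc hbe hce => ?_⟩
  · have h := upToSecondOrder_C₂ hf hparity hU hk hkU hP θ hab
    have hne : ∀ i, k i ≠ 0 := fun i => hU.ne_zero (hkU i)
    have hB : ∀ x y, 2 • k x ≠ k y → sumCoupling μ f k x x y = 0 := fun x y hxy =>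
      bispec_eq_zero fun h₀ => hxy (by linear_combination h₀)
    have hQ : ∀ x y, 3 • k x ≠ k y → sumCoupling₃₁ μ f k x x x y = 0 := fun x y hxy =>
      trispec_eq_zero fun h₀ => hxy (by linear_combination h₀)
    -- Two such relations would give (st - 1) k_a = 0. With `hdiff`, this shows that at most one of
    -- the four couplings of two modes is nonzero.
    have hmul : ∀ {s t : ℕ}, (s : ℤ) * t ≠ 1 → s • k a = k b → t • k b ≠ k a := by
      intro s t hst h₁ h₂
      have h₀ : ((s : ℤ) * t - 1) • k a = 0 := by
        rw [sub_smul, one_smul, mul_comm, mul_smul, natCast_zsmul, natCast_zsmul, h₁, h₂, sub_self]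
      exact (smul_ne_zero (sub_ne_zero.2 hst) (hne a)) h₀
    have hdiff : ∀ {s t : ℕ}, (s : ℤ) ≠ t → s • k a = k b → t • k a ≠ k b := by
      intro s t hst h₁ h₂
      have h₀ : ((s : ℤ) - t) • k a = 0 := by
        rw [sub_smul, natCast_zsmul, natCast_zsmul, h₁, h₂, sub_self]
      exact (smul_ne_zero (sub_ne_zero.2 hst) (hne a)) h₀
    refine ⟨fun h₂ => ?_, fun h₃ => ?_, fun n₁ n₂ n₃ n₄ => ?_⟩
    · rw [hB b a (hmul (by decide) h₂), hQ b a (hmul (by decide) h₂),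
        hQ a b (hdiff (by decide) h₂)] at h
      simpa [sumCoupling, sumCoupling₃₁] using h
    · rw [hB b a (hmul (by decide) h₃), hQ b a (hmul (by decide) h₃),
        hB a b (hdiff (by decide) h₃)] at h
      simpa [sumCoupling, sumCoupling₃₁] using h
    · rw [hB a b n₁, hB b a n₂, hQ a b n₃, hQ b a n₄] at h
      simpa [sumCoupling, sumCoupling₃₁] using h
  · have hm := injective_three hab hac hbc
    have hne : k a ≠ 0 := hU.ne_zero (hkU a)
    refine ⟨fun _ hR => ?_, fun _ hR => ?_, fun _ hR => ?_, fun h₂ h₃ => ?_, fun h₂ h₄ => ?_⟩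
    · refine upToSecondOrder_C₃_of_sum (m := ![a, b, c]) hf hparity hU hk hkU hP θ hm
        (relationsSatisfy_three fun j hj => ?_)
      -- These forms annihilate (1, 1, -1), hence all relations, and they read off the required
      -- equations. The forms in the other cases are chosen in the same way as the annihilator of
      -- the stated relations.
      have h₁ := hR.sum_mul_eq_zero ![1, -1, 0] (by simp [Fin.sum_univ_three]) hj
      have h₂ := hR.sum_mul_eq_zero ![1, 0, 1] (by simp [Fin.sum_univ_three]) hj
      simp [Fin.sum_univ_three] at h₁ h₂
      omega
    · refine upToSecondOrder_C₃_of_double_add (m := ![a, b, c]) hf hparity hU hk hkU hP θ hm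
        (relationsSatisfy_three fun j hj => ?_)
      have h₁ := hR.sum_mul_eq_zero ![1, -2, 0] (by simp [Fin.sum_univ_three]) hj
      have h₂ := hR.sum_mul_eq_zero ![0, 1, 1] (by simp [Fin.sum_univ_three]) hj
      simp [Fin.sum_univ_three] at h₁ h₂
      omega
    · refine upToSecondOrder_C₃_of_double (m := ![a, b, c]) hf hparity hU hk hkU hP θ hm
        (relationsSatisfy_three fun j hj => ?_)
      have h₁ := hR.sum_mul_eq_zero ![1, 2, 0] (by simp [Fin.sum_univ_three]) hj
      have h₂ := hR.sum_mul_eq_zero ![0, 1, -1] (by simp [Fin.sum_univ_three]) hj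
      simp [Fin.sum_univ_three] at h₁ h₂
      omega
    · exact upToSecondOrder_C₃_one_two_three (m := ![a, b, c]) hf hparity hU hk hkU hP θ hm
        (relationsSatisfy_multiples hne h₂ h₃)
    · exact upToSecondOrder_C₃_one_two_four (m := ![a, b, c]) hf hparity hU hk hkU hP θ hm
        (relationsSatisfy_multiples hne h₂ h₄)
  · have hm := injective_four hab hac hae hbc hbe hce
    refine ⟨fun _ hR => ?_, fun _ hR => ?_, fun _ _ hR => ?_, fun _ _ hR => ?_, fun _ _ hR => ?_,
      fun _ _ hR => ?_⟩
    · refine upToSecondOrder_C₄_of_sum_three (m := ![a, b, c, e]) hf hparity hU hk hkU hP θ hm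
        (relationsSatisfy_four fun j hj => ?_)
      have h₁ := hR.sum_mul_eq_zero ![1, -1, 0, 0] (by simp [Fin.sum_univ_four]) hj
      have h₂ := hR.sum_mul_eq_zero ![0, 1, -1, 0] (by simp [Fin.sum_univ_four]) hj
      have h₃ := hR.sum_mul_eq_zero ![1, 0, 0, 1] (by simp [Fin.sum_univ_four]) hj
      simp [Fin.sum_univ_four] at h₁ h₂ h₃
      omega
    · refine upToSecondOrder_C₄_of_sum_two (m := ![a, b, c, e]) hf hparity hU hk hkU hP θ hm
        (relationsSatisfy_four fun j hj => ?_)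
      have h₁ := hR.sum_mul_eq_zero ![1, -1, 0, 0] (by simp [Fin.sum_univ_four]) hj
      have h₂ := hR.sum_mul_eq_zero ![1, 0, 1, 0] (by simp [Fin.sum_univ_four]) hj
      have h₃ := hR.sum_mul_eq_zero ![1, 0, 0, 1] (by simp [Fin.sum_univ_four]) hj
      simp [Fin.sum_univ_four] at h₁ h₂ h₃
      omega
    -- The coupling of modes has its negative argument in the last place.
    · rw [bispec_swap₂₃ hf (k a) (-k b)]
      refine upToSecondOrder_C₄_of_double_sum₁ (m := ![a, b, c, e]) hf hparity hU hk hkU hP θ hm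
        (relationsSatisfy_four fun j hj => ?_)
      have h₁ := hR.sum_mul_eq_zero ![1, 1, 2, 0] (by simp [Fin.sum_univ_four]) hj
      have h₂ := hR.sum_mul_eq_zero ![0, 1, 0, 1] (by simp [Fin.sum_univ_four]) hj
      simp [Fin.sum_univ_four] at h₁ h₂
      omega
    · rw [bispec_swap₁₂ hf (-k a), bispec_swap₂₃ hf (k b) (-k a)]
      refine upToSecondOrder_C₄_of_double_sum₂ (m := ![a, b, c, e]) hf hparity hU hk hkU hP θ hm
        (relationsSatisfy_four fun j hj => ?_)
      have h₁ := hR.sum_mul_eq_zero ![1, 1, 0, 2] (by simp [Fin.sum_univ_four]) hj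
      have h₂ := hR.sum_mul_eq_zero ![1, 0, 1, 2] (by simp [Fin.sum_univ_four]) hj
      simp [Fin.sum_univ_four] at h₁ h₂
      omega
    · rw [bispec_swap₂₃ hf (k b) (-k c)]
      refine upToSecondOrder_C₄_of_double_sum₃ (m := ![a, b, c, e]) hf hparity hU hk hkU hP θ hm
        (relationsSatisfy_four fun j hj => ?_)
      have h₁ := hR.sum_mul_eq_zero ![1, 0, 2, 2] (by simp [Fin.sum_univ_four]) hj
      have h₂ := hR.sum_mul_eq_zero ![0, 1, 1, 0] (by simp [Fin.sum_univ_four]) hj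
      simp [Fin.sum_univ_four] at h₁ h₂
      omega
    · refine upToSecondOrder_C₄_of_double_sum₄ (m := ![a, b, c, e]) hf hparity hU hk hkU hP θ hm
        (relationsSatisfy_four fun j hj => ?_)
      have h₁ := hR.sum_mul_eq_zero ![1, 0, 2, 2] (by simp [Fin.sum_univ_four]) hj
      have h₂ := hR.sum_mul_eq_zero ![0, 1, -1, 0] (by simp [Fin.sum_univ_four]) hj
      simp [Fin.sum_univ_four] at h₁ h₂
      omega
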